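/- Let $k$ be a field of characteristic $p>0$. Let $\mathfrak h$ be a finite-dimensional abelian restricted Lie algebra over $k$, with restricted universal enveloping algebra $A=u(\mathfrak h)$, a Hopf algebra in which the elements of $\mathfrak h$ are primitive. Write $P(H)$ for the space of primitive elements of a Hopf algebra $H$ (a restricted Lie algebra under commutator and $p$-th power), and $H^+=\ker\varepsilon$. Let $n\ge 1$, $\lambda_0,\dots,\lambda_{n-1}\in k$, let $$f(z)=z^{p^n}+\lambda_{n-1}z^{p^{n-1}}+\dots+\lambda_1z^p+\lambda_0z,\qquad B=k[z]/(f(z)),$$ a Hopf algebra with $z$ primitive, and $\mathfrak g=P(B)$. Let $\rho$ be an algebraic representation of $\mathfrak g$ on $\mathfrak h$: a linear map $\rho:\mathfrak g\to\mathrm{End}_k(\mathfrak h)$, $x\mapsto\rho_x$, with $\rho_{[x,y]}=\rho_x\rho_y-\rho_y\rho_x$, $\rho_{x^p}=(\rho_x)^p$, $\rho_x([a,b])=[\rho_x(a),b]+[a,\rho_x(b)]$ and $\rho_x(a^{[p]})=(\mathrm{ad}\,a)^{p-1}(\rho_x(a))$ (which is $0$, as $\mathfrak h$ is abelian). Extend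 $\rho_z$ to a derivation of $A$, and let $\rho_z$ act on $A\otimes A$ as $\rho_z\otimes1+1\otimes\rho_z$. In the cobar construction $\Omega A=T(A^+)$ one has $d^1(a)=a\otimes1+1\otimes a-\Delta(a)$ and $d^2(a\otimes b)=d^1(a)\otimes b-a\otimes d^1(b)$; let $Z^2(\Omega A)=\{\chi\in A^+\otimes A^+: d^2(\chi)=0\}$ and $H^2(\Omega A)=Z^2(\Omega A)/d^1(A^+)$. On $A^+\otimes A^+$ define $$\mathcal D_z^0=\mathrm{Id},\qquad \mathcal D_z^m(\xi)=\bigl(\mathcal D_z^{m-1}(\xi)\bigr)^p+\rho_z^{\,p^m-p^{m-1}}\bigl(\mathcal D_z^{m-1}(\xi)\bigr)\quad(m\ge1),\qquad \Phi_z=\mathcal D_z^n+\sum_{i=0}^{n-1}\lambda_i\mathcal D_z^i ;$$ each $\mathcal D_z^m$ maps $Z^2(\Omega A)$ into itself. Let $\Theta\in A^+$ and $\chi\in Z^2(\Omega A)$ satisfy $$\rho_z(\Theta)=0,\qquad \Phi_z(\chi)=d^1(\Theta).$$ Put $T=(\mathfrak g,\mathfrak h,\rho)$ and $\mathscr D=(T,z,\Theta,\chi)$,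 and let $u(\mathscr D)$ be the $k$-algebra generated by $A$ and an indeterminate $x$ subject to the relations $$x^{p^n}+\lambda_{n-1}x^{p^{n-1}}+\dots+\lambda_0x+\Theta=0,\qquad xa-ax=\rho_z(a)\quad(a\in A).$$ **Theorem 0.1.** The algebra $u(\mathscr D)$ has a Hopf algebra structure for which the canonical map $A\to u(\mathscr D)$ is a coalgebra map, $\Delta(x)=x\otimes1+1\otimes x+\chi$ and $\varepsilon(x)=0$. With this structure: (a) $u(\mathscr D)$ is a connected Hopf algebra (its coradical is one-dimensional) of dimension $p^{\dim P(A)+n}$. (b) $u(\mathscr D)$ is a cocentral Hopf algebra extension of $A$ by $B$: the canonical map $\iota:A\to u(\mathscr D)$ is an injective Hopf algebra map with normal image ($\iota(A^+)u(\mathscr D)=u(\mathscr D)\iota(A^+)$), and there is a surjective Hopf algebra map $\pi:u(\mathscr D)\to B$ with $\pi(x)=z$ and $\ker\pi=\iota(A^+)u(\mathscr D)$, such that $\iota(A)$ is both the algebra of left and the algebra of right $\pi$-coinvariants of $u(\mathscr D)$, and $\sum\pi(y_1)\otimes y_2=\sum\pi(y_2)\otimes y_1$ for all $y\in u(\mathscr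 D)$. (c) The following are equivalent: (i) the classes $[\mathcal D_z^i(\chi)]$, $0\le i\le n-1$, are linearly independent in $H^2(\Omega A)$ (as a family indexed by $i$); (ii) $P(u(\mathscr D))$ is the image of $\mathfrak h$ in $u(\mathscr D)$; (iii) $P(u(\mathscr D))\cong\mathfrak h$ as restricted Lie algebras; (iv) $P(u(\mathscr D))\cong\mathfrak h$ as vector spaces. -/

import Mathlib

open scoped TensorProduct

attribute [local instance 100] LieRing.ofAssociativeRing

set_option linter.unusedSectionVars false

noncomputable section

/-! ### Restricted Lie algebras -/

namespace RestrictedLie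

/-- For a word `w₁ … w_m` in two letters, the iterated bracket `[w₁, [w₂, …, [w_m, x]]]`,
where the letter `true` stands for `x` and `false` for `y`. -/
def wordBracket {L : Type*} [LieRing L] (x y : L) (w : List Bool) : L :=
  w.foldr (fun b v => ⁅if b then x else y, v⁆) x

/-- Jacobson's `∑_{i=1}^{p-1} s_i(x, y)`, where `i s_i(x, y)` is the coefficient of `t^{i-1}` in
`ad(t x + y)^{p-1}(x)`. Expanding, `i s_i(x, y)` is the sum of the iterated brackets over all words
of length `p - 1` with exactly `i - 1` letters `x`. (The word with `p - 1` letters `x` has bracket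
zero and does not contribute.) -/
def jacobsonSum (k : Type*) (p : ℕ) {L : Type*} [Field k] [LieRing L] [LieAlgebra k L]
    (x y : L) : L :=
  ∑ w : Fin (p - 1) → Bool,
    (((Finset.univ.filter fun j => w j = true).card + 1 : ℕ) : k)⁻¹ •
      wordBracket x y (List.ofFn w)

end RestrictedLie

/-- A restricted Lie algebra structure (a `p`-map `x ↦ x^[p]`) on a Lie algebra over a field `k`
of characteristic `p`. -/
class RestrictedLieAlgebra (k : Type*) (p : ℕ) (L : Type*) [Field k] [LieRing L]
    [LieAlgebra k L] where
  /-- The restricted map `x ↦ x^[p]`. -/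
  pMap : L → L
  ad_pMap : ∀ x, LieAlgebra.ad k L (pMap x) = LieAlgebra.ad k L x ^ p
  pMap_smul : ∀ (c : k) (x : L), pMap (c • x) = c ^ p • pMap x
  pMap_add : ∀ x y : L, pMap (x + y) = pMap x + pMap y + RestrictedLie.jacobsonSum k p x y

namespace RestrictedLie

theorem jacobsonSum_eq_zero (k : Type*) (p : ℕ) [hp : Fact p.Prime] {L : Type*} [Field k]
    [LieRing L] [LieAlgebra k L] [IsLieAbelian L] (x y : L) : jacobsonSum k p x y = 0 := by
  unfold jacobsonSum
  refine Finset.sum_eq_zero fun w _ => ?_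
  have h2 := hp.out.two_le
  obtain ⟨m, hm⟩ : ∃ m, p - 1 = m + 1 := ⟨p - 2, by omega⟩
  generalize hl : List.ofFn w = l
  have hlen : l.length = p - 1 := by rw [← hl]; simp
  cases l with
  | nil => simp at hlen; omega
  | cons a t => simp [wordBracket, trivial_lie_zero]

end RestrictedLie

/-! ### The restricted universal enveloping algebra -/

/-- The relations `x^p = x^[p]`, `x ∈ L`, in the universal enveloping algebra of `L`. -/
inductive RestrictedEnveloping.Rel (k : Type*) (p : ℕ) (L : Type*) [Field k] [LieRing L]
    [LieAlgebra k L] [RestrictedLieAlgebra k p L] :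
    UniversalEnvelopingAlgebra k L → UniversalEnvelopingAlgebra k L → Prop
  | pow (x : L) : RestrictedEnveloping.Rel k p L (UniversalEnvelopingAlgebra.ι k x ^ p)
      (UniversalEnvelopingAlgebra.ι k (RestrictedLieAlgebra.pMap k p x))

/-- The restricted universal enveloping algebra `u(L)`. -/
def RestrictedEnveloping (k : Type*) (p : ℕ) (L : Type*) [Field k] [LieRing L]
    [LieAlgebra k L] [RestrictedLieAlgebra k p L] : Type _ :=
  RingQuot (RestrictedEnveloping.Rel k p L)

namespace RestrictedEnveloping

section Basic

variable (k : Type*) (p : ℕ) (L : Type*) [Field k] [LieRing L] [LieAlgebra k L]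
  [RestrictedLieAlgebra k p L]

instance : Ring (RestrictedEnveloping k p L) :=
  inferInstanceAs (Ring (RingQuot (RestrictedEnveloping.Rel k p L)))

instance : Algebra k (RestrictedEnveloping k p L) :=
  inferInstanceAs (Algebra k (RingQuot (RestrictedEnveloping.Rel k p L)))

/-- The quotient map `U(L) → u(L)`. -/
def mkAlgHom : UniversalEnvelopingAlgebra k L →ₐ[k] RestrictedEnveloping k p L :=
  RingQuot.mkAlgHom k (RestrictedEnveloping.Rel k p L)

/-- The canonical map `L → u(L)`. -/
def ι : L →ₗ⁅k⁆ RestrictedEnveloping k p L :=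
  (mkAlgHom k p L).toLieHom.comp (UniversalEnvelopingAlgebra.ι k)

variable {L}

theorem ι_apply (x : L) : ι k p L x = mkAlgHom k p L (UniversalEnvelopingAlgebra.ι k x) := rfl

theorem ι_pMap (x : L) : ι k p L (RestrictedLieAlgebra.pMap k p x) = ι k p L x ^ p := by
  rw [ι_apply, ι_apply, ← map_pow]
  exact (RingQuot.mkAlgHom_rel k (Rel.pow x)).symm

variable {C : Type*} [Ring C] [Algebra k C]

/-- The universal property of `u(L)`. -/
def lift (f : L →ₗ⁅k⁆ C) (hf : ∀ x, f (RestrictedLieAlgebra.pMap k p x) = f x ^ p) :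
    RestrictedEnveloping k p L →ₐ[k] C :=
  RingQuot.liftAlgHom k ⟨UniversalEnvelopingAlgebra.lift k f, by
    rintro _ _ ⟨x⟩
    rw [map_pow, UniversalEnvelopingAlgebra.lift_ι_apply, UniversalEnvelopingAlgebra.lift_ι_apply,
      hf]⟩

@[simp]
theorem lift_ι (f : L →ₗ⁅k⁆ C) (hf : ∀ x, f (RestrictedLieAlgebra.pMap k p x) = f x ^ p) (x : L) :
    lift k p f hf (ι k p L x) = f x := by
  rw [ι_apply, lift, mkAlgHom]
  erw [RingQuot.liftAlgHom_mkAlgHom_apply]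
  rw [UniversalEnvelopingAlgebra.lift_ι_apply]

variable {k p}

theorem algHom_ext {f g : RestrictedEnveloping k p L →ₐ[k] C}
    (h : ∀ x, f (ι k p L x) = g (ι k p L x)) : f = g := by
  apply RingQuot.ringQuot_ext' k
  apply UniversalEnvelopingAlgebra.hom_ext
  ext x
  exact h x

theorem induction {q : RestrictedEnveloping k p L → Prop}
    (hal : ∀ r : k, q (algebraMap k _ r)) (hι : ∀ x, q (ι k p L x))
    (hadd : ∀ a b, q a → q b → q (a + b)) (hmul : ∀ a b, q a → q b → q (a * b)) (a) : q a := by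
  let S : Subalgebra k (RestrictedEnveloping k p L) :=
    { carrier := {a | q a}
      mul_mem' := fun {a b} ha hb => hmul a b ha hb
      add_mem' := fun {a b} ha hb => hadd a b ha hb
      algebraMap_mem' := hal }
  let f : L →ₗ⁅k⁆ S :=
    { toFun := fun x => ⟨ι k p L x, hι x⟩
      map_add' := fun x y => Subtype.ext (by simp)
      map_smul' := fun c x => Subtype.ext (by simp)
      map_lie' := fun {x y} => Subtype.ext (by
        simp [LieRing.of_associative_ring_bracket]) }
  let F := lift k p f (fun x => Subtype.ext (by simp [f, ι_pMap]))
  have : S.val.comp F = AlgHom.id k _ := algHom_ext fun x => by simp [F, f]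
  have h2 := congrArg (fun g => g a) this
  simp only [AlgHom.comp_apply, AlgHom.id_apply] at h2
  rw [← h2]
  exact (F a).2

end Basic

end RestrictedEnveloping

/-! ### The Hopf algebra structure of `u(L)` -/

namespace HopfExt

theorem add_pow_of_commute (k : Type*) (p : ℕ) [Field k] [hp : Fact p.Prime] [CharP k p]
    {R : Type*} [Ring R] [Algebra k R] {a b : R} (h : Commute a b) :
    (a + b) ^ p = a ^ p + b ^ p := by
  obtain ⟨r, hr⟩ := h.exists_add_pow_prime_eq hp.out
  have h0 : (p : R) = 0 := by
    rw [← map_natCast (algebraMap k R), CharP.cast_eq_zero, map_zero]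
  rw [hr, h0]
  simp

theorem sub_pow_of_commute (k : Type*) (p : ℕ) [Field k] [hp : Fact p.Prime] [CharP k p]
    {R : Type*} [Ring R] [Algebra k R] {a b : R} (h : Commute a b) :
    (a - b) ^ p = a ^ p - b ^ p := by
  have h1 : Commute (a - b) b := h.sub_left (Commute.refl b)
  rw [eq_sub_iff_add_eq, ← add_pow_of_commute k p h1, sub_add_cancel]

end HopfExt

namespace RestrictedEnveloping

section Hopf

variable (k : Type*) (p : ℕ) (L : Type*) [Field k] [LieRing L] [LieAlgebra k L]
  [RestrictedLieAlgebra k p L] [hp : Fact p.Prime] [CharP k p]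

open TensorProduct in
/-- The comultiplication of `u(L)`, for which the elements of `L` are primitive. -/
def comul : RestrictedEnveloping k p L →ₐ[k]
    RestrictedEnveloping k p L ⊗[k] RestrictedEnveloping k p L :=
  lift k p
    { toFun := fun x => ι k p L x ⊗ₜ[k] 1 + 1 ⊗ₜ[k] ι k p L x
      map_add' := fun x y => by simp only [map_add, add_tmul, tmul_add]; abel
      map_smul' := fun c x => by simp [smul_tmul', tmul_smul]
      map_lie' := fun {x y} => by
        simp only [LieHom.map_lie, LieRing.of_associative_ring_bracket, sub_tmul, tmul_sub,
          add_mul, mul_add, Algebra.TensorProduct.tmul_mul_tmul, one_mul, mul_one]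
        abel }
    (fun x => by
      have hc : Commute (ι k p L x ⊗ₜ[k] (1 : RestrictedEnveloping k p L))
          ((1 : RestrictedEnveloping k p L) ⊗ₜ[k] ι k p L x) := by
        simp [commute_iff_eq]
      change ι k p L (RestrictedLieAlgebra.pMap k p x) ⊗ₜ[k] 1 +
        1 ⊗ₜ[k] ι k p L (RestrictedLieAlgebra.pMap k p x) = (ι k p L x ⊗ₜ[k] 1 +
        1 ⊗ₜ[k] ι k p L x) ^ p
      rw [HopfExt.add_pow_of_commute k p hc, ι_pMap]
      simp [Algebra.TensorProduct.tmul_pow])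

@[simp]
theorem comul_ι (x : L) : comul k p L (ι k p L x) = ι k p L x ⊗ₜ[k] 1 + 1 ⊗ₜ[k] ι k p L x :=
  lift_ι _ _ _ _ _

/-- The counit of `u(L)`, which vanishes on `L`. -/
def counit : RestrictedEnveloping k p L →ₐ[k] k :=
  lift k p 0 (fun x => by simp [hp.out.ne_zero])

@[simp]
theorem counit_ι (x : L) : counit k p L (ι k p L x) = 0 := by
  rw [counit, lift_ι]; rfl

instance : Bialgebra k (RestrictedEnveloping k p L) :=
  Bialgebra.ofAlgHom (comul k p L) (counit k p L)
    (algHom_ext fun x => by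
      simp [TensorProduct.add_tmul, TensorProduct.tmul_add, Algebra.TensorProduct.one_def]; abel)
    (algHom_ext fun x => by simp)
    (algHom_ext fun x => by simp)

end Hopf

section Abelian

variable (k : Type*) (p : ℕ) (L : Type*) [Field k] [LieRing L] [LieAlgebra k L]
  [RestrictedLieAlgebra k p L] [IsLieAbelian L]

theorem commute_ι (x y : L) : Commute (ι k p L x) (ι k p L y) := by
  have h := (ι k p L).map_lie x y
  rw [trivial_lie_zero, map_zero, LieRing.of_associative_ring_bracket] at h
  exact (sub_eq_zero.mp h.symm)

theorem commute_all (a b : RestrictedEnveloping k p L) : Commute a b := by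
  induction a using induction with
  | hal r => exact Algebra.commutes r b
  | hadd a a' h h' => exact h.add_left h'
  | hmul a a' h h' => exact h.mul_left h'
  | hι x =>
    induction b using induction with
    | hal r => exact (Algebra.commutes r _).symm
    | hadd a a' h h' => exact h.add_right h'
    | hmul a a' h h' => exact h.mul_right h'
    | hι y => exact commute_ι k p L x y

/-- `u(L)` is commutative when `L` is abelian. -/
instance : CommRing (RestrictedEnveloping k p L) :=
  { (inferInstance : Ring (RestrictedEnveloping k p L)) with
    mul_comm := fun a b => commute_all k p L a b }

variable [hp : Fact p.Prime] [CharP k p]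

/-- For `L` abelian, the antipode of `u(L)` is the algebra map with `x ↦ -x` for `x ∈ L`. -/
def antipode : RestrictedEnveloping k p L →ₐ[k] RestrictedEnveloping k p L :=
  lift k p
    { toFun := fun x => - ι k p L x
      map_add' := fun x y => by rw [map_add]; abel
      map_smul' := fun c x => by simp
      map_lie' := fun {x y} => by
        simp [LieRing.of_associative_ring_bracket, trivial_lie_zero, mul_comm] }
    (fun x => by
      change - ι k p L (RestrictedLieAlgebra.pMap k p x) = (- ι k p L x) ^ p
      have h := HopfExt.sub_pow_of_commute k p (Commute.zero_left (ι k p L x))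
      rw [zero_pow hp.out.ne_zero, zero_sub, zero_sub] at h
      rw [h, ι_pMap])

@[simp]
theorem antipode_ι (x : L) : antipode k p L (ι k p L x) = - ι k p L x := by
  rw [antipode, lift_ι]; rfl

instance : HopfAlgebra k (RestrictedEnveloping k p L) :=
  HopfAlgebra.ofAlgHom (antipode k p L)
    (algHom_ext fun x => by
      have h1 : Bialgebra.comulAlgHom k (RestrictedEnveloping k p L) (ι k p L x) =
        ι k p L x ⊗ₜ[k] 1 + 1 ⊗ₜ[k] ι k p L x := comul_ι k p L x
      have h2 : Bialgebra.counitAlgHom k (RestrictedEnveloping k p L) (ι k p L x) = 0 :=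
        counit_ι k p L x
      simp only [AlgHom.comp_apply, h1, h2]
      rw [map_add, map_zero]
      change antipode k p L (ι k p L x) * 1 + antipode k p L 1 * ι k p L x = 0
      simp)
    (algHom_ext fun x => by
      have h1 : Bialgebra.comulAlgHom k (RestrictedEnveloping k p L) (ι k p L x) =
        ι k p L x ⊗ₜ[k] 1 + 1 ⊗ₜ[k] ι k p L x := comul_ι k p L x
      have h2 : Bialgebra.counitAlgHom k (RestrictedEnveloping k p L) (ι k p L x) = 0 :=
        counit_ι k p L x
      simp only [AlgHom.comp_apply, h1, h2]
      simp)

end Abelian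

end RestrictedEnveloping

/-! ### Primitive elements -/

namespace HopfExt

section Primitives

variable (k : Type*) (H : Type*) [Field k] [Ring H] [Bialgebra k H]

/-- The primitive space `P(H)`, as a Lie subalgebra of `H` under the commutator. -/
def primitives : LieSubalgebra k H where
  carrier := {x | Coalgebra.comul (R := k) x = x ⊗ₜ[k] 1 + 1 ⊗ₜ[k] x}
  zero_mem' := by simp
  add_mem' {x y} hx hy := by
    simp only [Set.mem_ofPred_eq] at hx hy ⊢
    rw [map_add, hx, hy, TensorProduct.add_tmul, TensorProduct.tmul_add]; abel
  smul_mem' c x hx := by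
    simp only [Set.mem_ofPred_eq] at hx ⊢
    rw [map_smul, hx, smul_add, TensorProduct.smul_tmul', TensorProduct.tmul_smul]
  lie_mem' {x y} hx hy := by
    change Coalgebra.comul (R := k) _ = _ at hx
    change Coalgebra.comul (R := k) _ = _ at hy
    change Coalgebra.comul (R := k) _ = _
    rw [LieRing.of_associative_ring_bracket, map_sub, Bialgebra.comul_mul, Bialgebra.comul_mul,
      hx, hy]
    simp only [TensorProduct.sub_tmul, TensorProduct.tmul_sub,
      add_mul, mul_add, Algebra.TensorProduct.tmul_mul_tmul, one_mul, mul_one]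
    abel

variable {k H}

theorem mem_primitives {x : H} :
    x ∈ primitives k H ↔ Coalgebra.comul (R := k) x = x ⊗ₜ[k] 1 + 1 ⊗ₜ[k] x := Iff.rfl

variable (p : ℕ) [hp : Fact p.Prime] [CharP k p]

theorem pow_mem_primitives {x : H} (hx : x ∈ primitives k H) : x ^ p ∈ primitives k H := by
  rw [mem_primitives] at hx ⊢
  have hc : Commute (x ⊗ₜ[k] (1 : H)) ((1 : H) ⊗ₜ[k] x) := by simp [commute_iff_eq]
  rw [Bialgebra.comul_pow, hx, add_pow_of_commute k p hc]
  simp [Algebra.TensorProduct.tmul_pow]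

/-- The restricted map of `P(H)`: the `p`-th power in `H`. -/
def primitivePow (x : primitives k H) : primitives k H :=
  ⟨(x : H) ^ p, pow_mem_primitives p x.2⟩

end Primitives

section CommPrimitives

variable (k : Type*) (p : ℕ) (H : Type*) [Field k] [CommRing H] [Bialgebra k H]

instance : IsLieAbelian (primitives k H) where
  trivial x y := Subtype.ext (by
    rw [LieSubalgebra.coe_bracket, LieRing.of_associative_ring_bracket, mul_comm, sub_self]; rfl)

/-- For a commutative Hopf algebra `H`, the `p`-th power makes `P(H)` a restricted Lie algebra. -/
instance [hp : Fact p.Prime] [CharP k p] : RestrictedLieAlgebra k p (primitives k H) where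
  pMap := primitivePow p
  ad_pMap x := by
    have h (y : primitives k H) : LieAlgebra.ad k (primitives k H) y = 0 := by
      ext1 z; simp [trivial_lie_zero]
    rw [h, h, zero_pow hp.out.ne_zero]
  pMap_smul c x := Subtype.ext (by
    change (((c • x : primitives k H) : H)) ^ p = c ^ p • (x : H) ^ p
    rw [show ((c • x : primitives k H) : H) = c • (x : H) from rfl, smul_pow])
  pMap_add x y := Subtype.ext (by
    rw [RestrictedLie.jacobsonSum_eq_zero, add_zero]
    change (((x + y : primitives k H) : H)) ^ p = (x : H) ^ p + (y : H) ^ p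
    rw [show ((x + y : primitives k H) : H) = (x : H) + y from rfl, add_pow_of_commute k p (Commute.all _ _)])

end CommPrimitives

end HopfExt

/-! ### The Hopf algebra `B = k[z]/f(z)` for a `p`-polynomial `f` -/

open Polynomial in
/-- The `p`-polynomial `z^{p^n} + λ_{n-1} z^{p^{n-1}} + ⋯ + λ_1 z^p + λ_0 z`. -/
def pPolynomial (k : Type*) (p : ℕ) [Field k] {n : ℕ} (lam : Fin n → k) : k[X] :=
  X ^ p ^ n + ∑ i : Fin n, C (lam i) * X ^ p ^ (i : ℕ)

/-- `B = k[z]/f(z)`, with `f` the `p`-polynomial with coefficients `lam`. -/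
def MonogenicHopf (k : Type*) (p : ℕ) [Field k] {n : ℕ} (lam : Fin n → k) : Type _ :=
  AdjoinRoot (pPolynomial k p lam)

namespace MonogenicHopf

variable (k : Type*) (p : ℕ) [Field k] {n : ℕ} (lam : Fin n → k)

instance : CommRing (MonogenicHopf k p lam) :=
  inferInstanceAs (CommRing (AdjoinRoot (pPolynomial k p lam)))

instance : Algebra k (MonogenicHopf k p lam) :=
  inferInstanceAs (Algebra k (AdjoinRoot (pPolynomial k p lam)))

/-- The generator `z` of `B`. -/
def z : MonogenicHopf k p lam := AdjoinRoot.root (pPolynomial k p lam)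

/-- The value `c^{p^n} + λ_{n-1} c^{p^{n-1}} + ⋯ + λ_0 c` of the `p`-polynomial. -/
theorem aeval_pPolynomial {C : Type*} [Ring C] [Algebra k C] (c : C) :
    Polynomial.aeval c (pPolynomial k p lam) =
      c ^ p ^ n + ∑ i : Fin n, lam i • c ^ p ^ (i : ℕ) := by
  simp [pPolynomial, Algebra.smul_def]

theorem aeval_z : Polynomial.aeval (z k p lam) (pPolynomial k p lam) = 0 := by
  have := AdjoinRoot.aeval_eq (f := pPolynomial k p lam) (pPolynomial k p lam)
  rw [AdjoinRoot.mk_self] at this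
  exact this

variable {C : Type*} [CommRing C] [Algebra k C]

/-- The universal property of `B`. -/
def lift (c : C) (hc : Polynomial.aeval c (pPolynomial k p lam) = 0) :
    MonogenicHopf k p lam →ₐ[k] C :=
  AdjoinRoot.liftAlgHom (pPolynomial k p lam) (Algebra.ofId k C) c hc

@[simp]
theorem lift_z (c : C) (hc : Polynomial.aeval c (pPolynomial k p lam) = 0) :
    lift k p lam c hc (z k p lam) = c :=
  AdjoinRoot.liftAlgHom_root _ _ _ _

variable {k p lam} in
theorem algHom_ext {f g : MonogenicHopf k p lam →ₐ[k] C}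
    (h : f (z k p lam) = g (z k p lam)) : f = g :=
  AdjoinRoot.algHom_ext h

variable [hp : Fact p.Prime] [CharP k p]

theorem aeval_add_of_commute {C : Type*} [Ring C] [Algebra k C] {a b : C} (h : Commute a b) :
    Polynomial.aeval (a + b) (pPolynomial k p lam) =
      Polynomial.aeval a (pPolynomial k p lam) + Polynomial.aeval b (pPolynomial k p lam) := by
  have key : ∀ m : ℕ, (a + b) ^ p ^ m = a ^ p ^ m + b ^ p ^ m := by
    intro m
    induction m with
    | zero => simp
    | succ m ih =>
      rw [pow_succ, pow_mul, ih, HopfExt.add_pow_of_commute k p ((h.pow_left _).pow_right _),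
        pow_mul, pow_mul]
  simp only [aeval_pPolynomial, key, smul_add, Finset.sum_add_distrib]
  abel

/-- The comultiplication of `B`, for which `z` is primitive. -/
def comul : MonogenicHopf k p lam →ₐ[k] MonogenicHopf k p lam ⊗[k] MonogenicHopf k p lam :=
  lift k p lam (z k p lam ⊗ₜ[k] 1 + 1 ⊗ₜ[k] z k p lam) (by
    rw [aeval_add_of_commute k p lam (Commute.all _ _)]
    have h1 := Polynomial.aeval_algHom_apply (Algebra.TensorProduct.includeLeft :
      MonogenicHopf k p lam →ₐ[k] MonogenicHopf k p lam ⊗[k] MonogenicHopf k p lam)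
      (z k p lam) (pPolynomial k p lam)
    have h2 := Polynomial.aeval_algHom_apply (Algebra.TensorProduct.includeRight :
      MonogenicHopf k p lam →ₐ[k] MonogenicHopf k p lam ⊗[k] MonogenicHopf k p lam)
      (z k p lam) (pPolynomial k p lam)
    rw [aeval_z, map_zero] at h1 h2
    simp only [Algebra.TensorProduct.includeLeft_apply,
      Algebra.TensorProduct.includeRight_apply] at h1 h2
    rw [h1, h2, add_zero])

@[simp]
theorem comul_z : comul k p lam (z k p lam) = z k p lam ⊗ₜ[k] 1 + 1 ⊗ₜ[k] z k p lam :=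
  lift_z _ _ _ _ _

/-- The counit of `B`, which vanishes on `z`. -/
def counit : MonogenicHopf k p lam →ₐ[k] k :=
  lift k p lam 0 (by simp [aeval_pPolynomial, hp.out.ne_zero])

@[simp]
theorem counit_z : counit k p lam (z k p lam) = 0 :=
  lift_z _ _ _ _ _

instance : Bialgebra k (MonogenicHopf k p lam) :=
  Bialgebra.ofAlgHom (comul k p lam) (counit k p lam)
    (algHom_ext <| by
      simp [TensorProduct.add_tmul, TensorProduct.tmul_add, Algebra.TensorProduct.one_def]; abel)
    (algHom_ext <| by simp)
    (algHom_ext <| by simp)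

/-- The antipode of `B`, with `z ↦ -z`. -/
def antipode : MonogenicHopf k p lam →ₐ[k] MonogenicHopf k p lam :=
  lift k p lam (- z k p lam) (by
    have h := aeval_add_of_commute k p lam (Commute.all (z k p lam) (- z k p lam))
    have h0 : Polynomial.aeval (0 : MonogenicHopf k p lam) (pPolynomial k p lam) = 0 := by
      simp [aeval_pPolynomial, hp.out.ne_zero]
    rw [add_neg_cancel, h0, aeval_z, zero_add] at h
    exact h.symm)

@[simp]
theorem antipode_z : antipode k p lam (z k p lam) = - z k p lam :=
  lift_z _ _ _ _ _

instance : HopfAlgebra k (MonogenicHopf k p lam) :=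
  HopfAlgebra.ofAlgHom (antipode k p lam)
    (algHom_ext <| by
      have h1 : Bialgebra.comulAlgHom k (MonogenicHopf k p lam) (z k p lam) =
        z k p lam ⊗ₜ[k] 1 + 1 ⊗ₜ[k] z k p lam := comul_z k p lam
      have h2 : Bialgebra.counitAlgHom k (MonogenicHopf k p lam) (z k p lam) = 0 :=
        counit_z k p lam
      simp only [AlgHom.comp_apply, h1, h2]
      rw [map_add, map_zero]
      change antipode k p lam (z k p lam) * 1 + antipode k p lam 1 * z k p lam = 0
      simp)
    (algHom_ext <| by
      have h1 : Bialgebra.comulAlgHom k (MonogenicHopf k p lam) (z k p lam) =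
        z k p lam ⊗ₜ[k] 1 + 1 ⊗ₜ[k] z k p lam := comul_z k p lam
      have h2 : Bialgebra.counitAlgHom k (MonogenicHopf k p lam) (z k p lam) = 0 :=
        counit_z k p lam
      simp only [AlgHom.comp_apply, h1, h2]
      rw [map_add, map_zero]
      change z k p lam * antipode k p lam 1 + 1 * antipode k p lam (z k p lam) = 0
      simp)

/-- The generator `z` as an element of `P(B)`. -/
def zPrim : HopfExt.primitives k (MonogenicHopf k p lam) :=
  ⟨z k p lam, comul_z k p lam⟩

end MonogenicHopf

/-! ### Algebraic representations -/

/-- An algebraic representation of a restricted Lie algebra `g` on a restricted Lie algebra `h`.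
In `map_pMap_right`, `(ad a)^{p-1}` acts from the left; it agrees with the `(p-1)`-st power of
`b ↦ [b, a]`, since `(-1)^{p-1} = 1` in `k`. -/
structure AlgebraicRep (k : Type*) (p : ℕ) (g h : Type*) [Field k] [LieRing g] [LieAlgebra k g]
    [RestrictedLieAlgebra k p g] [LieRing h] [LieAlgebra k h] [RestrictedLieAlgebra k p h] where
  /-- The underlying linear map `x ↦ ρ_x`. -/
  toLin : g →ₗ[k] Module.End k h
  map_lie : ∀ x y : g, toLin ⁅x, y⁆ = toLin x * toLin y - toLin y * toLin x
  map_pMap : ∀ x : g, toLin (RestrictedLieAlgebra.pMap k p x) = toLin x ^ p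
  leibniz : ∀ (x : g) (a b : h), toLin x ⁅a, b⁆ = ⁅toLin x a, b⁆ + ⁅a, toLin x b⁆
  map_pMap_right : ∀ (x : g) (a : h), toLin x (RestrictedLieAlgebra.pMap k p a) =
    (LieAlgebra.ad k h a ^ (p - 1)) (toLin x a)

namespace AlgebraicRep

variable {k : Type*} {p : ℕ} {g h : Type*} [Field k] [LieRing g] [LieAlgebra k g]
    [RestrictedLieAlgebra k p g] [LieRing h] [LieAlgebra k h] [RestrictedLieAlgebra k p h]
    [IsLieAbelian h] [hp : Fact p.Prime] [CharP k p]

theorem map_pMap_right_eq_zero (ρ : AlgebraicRep k p g h) (x : g) (a : h) :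
    ρ.toLin x (RestrictedLieAlgebra.pMap k p a) = 0 := by
  have h0 : LieAlgebra.ad k h a = 0 := by ext1 b; simp [trivial_lie_zero]
  rw [ρ.map_pMap_right, h0, zero_pow (by have := hp.out.two_le; omega)]; rfl

/-- The algebra map `u(h) → u(h)[ε]/(ε²)`, `a ↦ a + ε ρ_x(a)` for `a ∈ h`. -/
def toTriv (ρ : AlgebraicRep k p g h) (x : g) :
    RestrictedEnveloping k p h →ₐ[k]
      TrivSqZeroExt (RestrictedEnveloping k p h) (RestrictedEnveloping k p h) :=
  RestrictedEnveloping.lift k p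
    { toFun := fun a => TrivSqZeroExt.inl (RestrictedEnveloping.ι k p h a) +
        TrivSqZeroExt.inr (RestrictedEnveloping.ι k p h (ρ.toLin x a))
      map_add' := fun a b => by ext <;> simp
      map_smul' := fun c a => by ext <;> simp
      map_lie' := fun {a b} => by
        rw [LieRing.of_associative_ring_bracket, mul_comm, sub_self]
        simp [trivial_lie_zero] }
    (fun a => by
      have hp0 : (p : RestrictedEnveloping k p h) = 0 := by
        rw [← map_natCast (algebraMap k (RestrictedEnveloping k p h)), CharP.cast_eq_zero,
          map_zero]
      change TrivSqZeroExt.inl (RestrictedEnveloping.ι k p h (RestrictedLieAlgebra.pMap k p a)) +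
        TrivSqZeroExt.inr (RestrictedEnveloping.ι k p h
          (ρ.toLin x (RestrictedLieAlgebra.pMap k p a))) =
        (TrivSqZeroExt.inl (RestrictedEnveloping.ι k p h a) +
        TrivSqZeroExt.inr (RestrictedEnveloping.ι k p h (ρ.toLin x a))) ^ p
      rw [ρ.map_pMap_right_eq_zero]
      ext
      · simp [RestrictedEnveloping.ι_pMap]
      · simp [TrivSqZeroExt.snd_pow, hp0])

theorem toTriv_ι (ρ : AlgebraicRep k p g h) (x : g) (a : h) :
    ρ.toTriv x (RestrictedEnveloping.ι k p h a) =
      TrivSqZeroExt.inl (RestrictedEnveloping.ι k p h a) +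
        TrivSqZeroExt.inr (RestrictedEnveloping.ι k p h (ρ.toLin x a)) :=
  RestrictedEnveloping.lift_ι _ _ _ _ _

theorem fst_toTriv (ρ : AlgebraicRep k p g h) (x : g) (a : RestrictedEnveloping k p h) :
    (ρ.toTriv x a).fst = a := by
  have : (TrivSqZeroExt.fstHom k (RestrictedEnveloping k p h) (RestrictedEnveloping k p h)).comp
      (ρ.toTriv x) = AlgHom.id k _ :=
    RestrictedEnveloping.algHom_ext fun b => by simp [toTriv_ι]
  exact congrArg (fun f => f a) this

/-- For `h` abelian, the derivation of `u(h)` extending `ρ_x : h → h`, by which `x ∈ g` acts on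
`u(h)`. It is again denoted `ρ_x`. -/
def derivation (ρ : AlgebraicRep k p g h) (x : g) :
    Derivation k (RestrictedEnveloping k p h) (RestrictedEnveloping k p h) :=
  Derivation.mk' (TrivSqZeroExt.sndHom (RestrictedEnveloping k p h)
      (RestrictedEnveloping k p h) |>.restrictScalars k |>.comp (ρ.toTriv x).toLinearMap) (by
    intro a b
    simp [fst_toTriv, mul_comm, add_comm])

@[simp]
theorem derivation_ι (ρ : AlgebraicRep k p g h) (x : g) (a : h) :
    ρ.derivation x (RestrictedEnveloping.ι k p h a) =
      RestrictedEnveloping.ι k p h (ρ.toLin x a) := by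
  change (ρ.toTriv x _).snd = _
  rw [toTriv_ι]; simp

end AlgebraicRep

/-! ### The cobar construction in low degrees

Over a field the tensor powers of the augmentation ideal `A⁺` embed in those of `A`, so the
degree-`m` part `(A⁺)^{⊗m}` of the cobar construction is treated as a subspace of `A^{⊗m}`. The
second cohomology only involves the degrees `1, 2, 3`. -/

namespace Cobar

open TensorProduct

section Defs

variable (k : Type*) (A : Type*) [Field k] [Ring A] [Bialgebra k A]

/-- The augmentation ideal `A⁺ = ker ε`. -/
def augIdeal : Submodule k A := LinearMap.ker (Coalgebra.counit (R := k) (A := A))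

/-- `A⁺ ⊗ A⁺`, as a subspace of `A ⊗ A`. -/
def augSq : Submodule k (A ⊗[k] A) :=
  LinearMap.range (TensorProduct.map (augIdeal k A).subtype (augIdeal k A).subtype)

/-- `d¹(a) = -(Δ(a) - a ⊗ 1 - 1 ⊗ a)`. -/
def d1 : A →ₗ[k] A ⊗[k] A :=
  -(Coalgebra.comul - (TensorProduct.mk k A A).flip 1 - TensorProduct.mk k A A 1)

/-- `d²(a ⊗ b) = d¹(a) ⊗ b - a ⊗ d¹(b)`. -/
def d2 : A ⊗[k] A →ₗ[k] A ⊗[k] (A ⊗[k] A) :=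
  (TensorProduct.assoc k A A A).toLinearMap ∘ₗ (d1 k A).rTensor A - (d1 k A).lTensor A

/-- The 2-cocycles `Z²(ΩA)`. -/
def cocycles : Submodule k (A ⊗[k] A) := augSq k A ⊓ LinearMap.ker (d2 k A)

/-- The 2-coboundaries `B²(ΩA)`. -/
def coboundaries : Submodule k (A ⊗[k] A) := (augIdeal k A).map (d1 k A)

/-- `H²(ΩA) = Z²(ΩA) / B²(ΩA)`. -/
abbrev H2 : Type _ := cocycles k A ⧸ (coboundaries k A).submoduleOf (cocycles k A)

end Defs

section Operators

variable {k : Type*} {A : Type*} [Field k] [CommRing A] [Bialgebra k A]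

/-- The action `δ ⊗ 1 + 1 ⊗ δ` on `A ⊗ A` of a primitive element acting on `A` by `δ`. -/
def act (δ : A →ₗ[k] A) : A ⊗[k] A →ₗ[k] A ⊗[k] A := δ.rTensor A + δ.lTensor A

/-- The operators `D^m` on `A ⊗ A`: `D^0 = Id` and `D^m = P ∘ D^{m-1} + ρ^{p^m - p^{m-1}} ∘ D^{m-1}`,
where `P` is the `p`-th power and `ρ` is the action of `δ` on `A ⊗ A`. -/
def opD (p : ℕ) (δ : A →ₗ[k] A) : ℕ → A ⊗[k] A → A ⊗[k] A
  | 0, f => f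
  | m + 1, f => opD p δ m f ^ p + (act δ ^ (p ^ (m + 1) - p ^ m)) (opD p δ m f)

/-- `Φ = D^n + λ_{n-1} D^{n-1} + ⋯ + λ_0 D^0`. -/
def opPhi (p : ℕ) {n : ℕ} (lam : Fin n → k) (δ : A →ₗ[k] A) (f : A ⊗[k] A) : A ⊗[k] A :=
  opD p δ n f + ∑ i : Fin n, lam i • opD p δ i f

theorem d1_apply (a : A) : d1 k A a = a ⊗ₜ 1 + 1 ⊗ₜ a - Coalgebra.comul a := by
  simp [d1]; abel

theorem d2_tmul (a b : A) : d2 k A (a ⊗ₜ b) =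
    TensorProduct.assoc k A A A (d1 k A a ⊗ₜ b) - a ⊗ₜ d1 k A b := by
  simp [d2]

/-- `d²` as an alternating sum of four algebra maps. -/
theorem d2_eq (x : A ⊗[k] A) : d2 k A x =
    ((Algebra.TensorProduct.includeRight : A ⊗[k] A →ₐ[k] A ⊗[k] (A ⊗[k] A)) x +
      Algebra.TensorProduct.map (AlgHom.id k A) (Bialgebra.comulAlgHom k A) x) -
    (Algebra.TensorProduct.assoc k k k A A A
      (Algebra.TensorProduct.map (Bialgebra.comulAlgHom k A) (AlgHom.id k A) x) +
      Algebra.TensorProduct.assoc k k k A A A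
        ((Algebra.TensorProduct.includeLeft : A ⊗[k] A →ₐ[k] (A ⊗[k] A) ⊗[k] A) x)) := by
  induction x with
  | zero => simp
  | add x y hx hy => simp only [map_add, hx, hy]; abel
  | tmul a b =>
    have hassoc (y : (A ⊗[k] A) ⊗[k] A) : Algebra.TensorProduct.assoc k k k A A A y =
      TensorProduct.assoc k A A A y := rfl
    simp only [hassoc]
    simp [d2_tmul, d1_apply, add_tmul, sub_tmul, tmul_add, tmul_sub]
    abel

variable (p : ℕ) [hp : Fact p.Prime] [CharP k p]

theorem d2_pow {x : A ⊗[k] A} (hx : d2 k A x = 0) : d2 k A (x ^ p) = 0 := by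
  have h : d2 k A (x ^ p) = (d2 k A x) ^ p := by
    have hc (y z : A ⊗[k] (A ⊗[k] A)) : Commute y z := mul_comm y z
    rw [d2_eq, d2_eq, HopfExt.sub_pow_of_commute k p (hc _ _),
      HopfExt.add_pow_of_commute k p (hc _ _), HopfExt.add_pow_of_commute k p (hc _ _)]
    simp only [map_pow]
  rw [h, hx, zero_pow hp.out.ne_zero]

theorem augSq_pow {x : A ⊗[k] A} (hx : x ∈ augSq k A) : x ^ p ∈ augSq k A := by
  obtain ⟨t, rfl⟩ := hx
  induction t with
  | zero => simp [hp.out.ne_zero]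
  | add x y hx hy =>
    rw [map_add, HopfExt.add_pow_of_commute k p (Commute.all _ _)]
    exact add_mem hx hy
  | tmul a b =>
    have h (a : augIdeal k A) : (a : A) ^ p ∈ augIdeal k A := by
      have : Coalgebra.counit (R := k) (a : A) = 0 := a.2
      change Coalgebra.counit (R := k) ((a : A) ^ p) = 0
      rw [Bialgebra.counit_pow, this, zero_pow hp.out.ne_zero]
    exact ⟨⟨_, h a⟩ ⊗ₜ ⟨_, h b⟩, by simp [Algebra.TensorProduct.tmul_pow]⟩

variable {δ : A →ₗ[k] A}

theorem augSq_act (hε : ∀ a, Coalgebra.counit (R := k) (δ a) = 0) {x : A ⊗[k] A}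
    (hx : x ∈ augSq k A) : act δ x ∈ augSq k A := by
  obtain ⟨t, rfl⟩ := hx
  induction t with
  | zero => simp
  | add x y hx hy => rw [map_add, map_add]; exact add_mem hx hy
  | tmul a b =>
    exact ⟨⟨δ a, hε a⟩ ⊗ₜ b + a ⊗ₜ ⟨δ b, hε b⟩, by simp [act]⟩

theorem d2_act (h1 : δ 1 = 0)
    (hΔ : ∀ a, Coalgebra.comul (R := k) (δ a) = act δ (Coalgebra.comul (R := k) a))
    (x : A ⊗[k] A) :
    d2 k A (act δ x) = (δ.rTensor (A ⊗[k] A) + (act δ).lTensor A) (d2 k A x) := by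
  have hd1 (a : A) : d1 k A (δ a) = act δ (d1 k A a) := by
    rw [d1_apply, d1_apply, map_sub, map_add, hΔ]
    simp [act, h1]
  have hassoc (y : A ⊗[k] A) (b : A) :
      (δ.rTensor (A ⊗[k] A) + (act δ).lTensor A) (TensorProduct.assoc k A A A (y ⊗ₜ b)) =
        TensorProduct.assoc k A A A (act δ y ⊗ₜ b + y ⊗ₜ δ b) := by
    induction y with
    | zero => simp
    | add x y hx hy =>
      rw [add_tmul, map_add, map_add, hx, hy, map_add (act δ), add_tmul, add_tmul]
      simp only [map_add]
      abel
    | tmul a c => simp [act, add_tmul]; abel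
  induction x with
  | zero => simp
  | add x y hx hy => simp only [map_add, hx, hy]
  | tmul a b =>
    rw [d2_tmul, map_sub, hassoc]
    have : act δ (a ⊗ₜ[k] b) = δ a ⊗ₜ b + a ⊗ₜ δ b := by simp [act]
    rw [this, map_add, d2_tmul, d2_tmul, hd1, hd1, map_add]
    simp
    abel

theorem opD_mem_cocycles (h1 : δ 1 = 0)
    (hε : ∀ a, Coalgebra.counit (R := k) (δ a) = 0)
    (hΔ : ∀ a, Coalgebra.comul (R := k) (δ a) = act δ (Coalgebra.comul (R := k) a))
    {f : A ⊗[k] A} (hf : f ∈ cocycles k A) (m : ℕ) : opD p δ m f ∈ cocycles k A := by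
  have hact {x : A ⊗[k] A} (hx : x ∈ cocycles k A) : act δ x ∈ cocycles k A := by
    refine ⟨augSq_act hε hx.1, ?_⟩
    have h0 : d2 k A x = 0 := hx.2
    change d2 k A (act δ x) = 0
    rw [d2_act h1 hΔ, h0, map_zero]
  have hiter (j : ℕ) {x : A ⊗[k] A} (hx : x ∈ cocycles k A) :
      (act δ ^ j) x ∈ cocycles k A := by
    induction j with
    | zero => exact hx
    | succ j ih => rw [pow_succ']; exact hact ih
  induction m with
  | zero => exact hf
  | succ m ih => exact add_mem ⟨augSq_pow p ih.1, d2_pow p ih.2⟩ (hiter _ ih)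

end Operators

end Cobar

namespace AlgebraicRep

variable {k : Type*} {p : ℕ} {g h : Type*} [Field k] [LieRing g] [LieAlgebra k g]
    [RestrictedLieAlgebra k p g] [LieRing h] [LieAlgebra k h] [RestrictedLieAlgebra k p h]
    [IsLieAbelian h] [hp : Fact p.Prime] [CharP k p]

theorem act_mul {A : Type*} [CommRing A] [Bialgebra k A] (δ : Derivation k A A)
    (x y : A ⊗[k] A) : Cobar.act (δ : A →ₗ[k] A) (x * y) =
      Cobar.act (δ : A →ₗ[k] A) x * y + x * Cobar.act (δ : A →ₗ[k] A) y := by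
  induction x with
  | zero => simp
  | add x x' hx hx' => simp only [add_mul, map_add, hx, hx']; abel
  | tmul a b =>
    induction y with
    | zero => simp
    | add y y' hy hy' => simp only [mul_add, map_add, hy, hy']; abel
    | tmul c d =>
      simp [Cobar.act, TensorProduct.add_tmul, TensorProduct.tmul_add, add_mul, mul_add,
        mul_comm c (δ a), mul_comm d (δ b)]
      abel

theorem counit_derivation (ρ : AlgebraicRep k p g h) (x : g) (a : RestrictedEnveloping k p h) :
    Coalgebra.counit (R := k) (ρ.derivation x a) = 0 := by
  induction a using RestrictedEnveloping.induction with
  | hal r => simp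
  | hι y => rw [derivation_ι]; exact RestrictedEnveloping.counit_ι k p h _
  | hadd a b ha hb => simp [ha, hb]
  | hmul a b ha hb => simp [ha, hb]

theorem comul_derivation (ρ : AlgebraicRep k p g h) (x : g) (a : RestrictedEnveloping k p h) :
    Coalgebra.comul (R := k) (ρ.derivation x a) =
      Cobar.act (ρ.derivation x : RestrictedEnveloping k p h →ₗ[k] RestrictedEnveloping k p h)
        (Coalgebra.comul (R := k) a) := by
  induction a using RestrictedEnveloping.induction with
  | hal r => simp [Cobar.act, Algebra.TensorProduct.algebraMap_apply]
  | hι y =>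
    have hc (y : h) : Coalgebra.comul (R := k) (RestrictedEnveloping.ι k p h y) = 
      RestrictedEnveloping.ι k p h y ⊗ₜ[k] 1 + 1 ⊗ₜ[k] RestrictedEnveloping.ι k p h y :=
      RestrictedEnveloping.comul_ι k p h y
    rw [derivation_ι, hc, hc, map_add]
    simp [Cobar.act]
  | hadd a b ha hb => simp [ha, hb]
  | hmul a b ha hb =>
    rw [Bialgebra.comul_mul, act_mul, ← ha, ← hb, Derivation.leibniz, map_add, smul_eq_mul,
      smul_eq_mul, Bialgebra.comul_mul, Bialgebra.comul_mul]
    ring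

end AlgebraicRep

/-! ### Coradical, connectedness, extensions -/

namespace HopfExt

section Coradical

variable (k : Type*) (H : Type*) [Field k] [AddCommGroup H] [Module k H] [Coalgebra k H]

variable {H} in
/-- `C` is a subcoalgebra: `Δ(C) ⊆ C ⊗ C`. -/
def IsSubcoalgebra (C : Submodule k H) : Prop :=
  ∀ c ∈ C, Coalgebra.comul (R := k) c ∈ LinearMap.range (TensorProduct.map C.subtype C.subtype)

variable {H} in
/-- `C` is a simple subcoalgebra: it is non-zero and has no subcoalgebras but `0` and `C`. -/
def IsSimpleSubcoalgebra (C : Submodule k H) : Prop :=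
  IsSubcoalgebra k C ∧ C ≠ ⊥ ∧ ∀ E, IsSubcoalgebra k E → E ≤ C → E = ⊥ ∨ E = C

/-- The coradical: the sum of all simple subcoalgebras. -/
def coradical : Submodule k H := sSup {C | IsSimpleSubcoalgebra k C}

/-- `H` is connected if its coradical is one-dimensional. -/
def IsConnected : Prop := Module.finrank k (coradical k H) = 1

end Coradical

section Extension

variable {k : Type*} {A H B : Type*} [Field k] [Ring A] [Ring H] [Ring B]
  [HopfAlgebra k A] [HopfAlgebra k H] [HopfAlgebra k B]

/-- `1 → A → H → B → 1` is an extension of Hopf algebras (an exact sequence) : `ι` is injective,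
`π` is surjective, `A` is normal in `H`, the kernel of `π` is generated by the augmentation ideal
of `A`, and `A` is the algebra of (left and right) coinvariants of `π`. -/
structure IsExtension (ι : A →ₐc[k] H) (π : H →ₐc[k] B) : Prop where
  injective : Function.Injective ι
  surjective : Function.Surjective π
  normal : (Cobar.augIdeal k A).map (ι : A →ₗ[k] H) * ⊤ =
    ⊤ * (Cobar.augIdeal k A).map (ι : A →ₗ[k] H)
  ker_eq : LinearMap.ker (π : H →ₗ[k] B) = (Cobar.augIdeal k A).map (ι : A →ₗ[k] H) * ⊤
  right_coinvariants : ∀ x : H, x ∈ Set.range ι ↔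
    (π : H →ₗ[k] B).lTensor H (Coalgebra.comul (R := k) x) = x ⊗ₜ[k] 1
  left_coinvariants : ∀ x : H, x ∈ Set.range ι ↔
    (π : H →ₗ[k] B).rTensor H (Coalgebra.comul (R := k) x) = 1 ⊗ₜ[k] x

/-- `π : H → B` is cocentral: `∑ π(h₁) ⊗ h₂ = ∑ π(h₂) ⊗ h₁`. In finite dimension this says that
the image of `B*` in `H*` is central. -/
def IsCocentral (π : H →ₐc[k] B) : Prop :=
  ∀ x : H, (π : H →ₗ[k] B).rTensor H (Coalgebra.comul (R := k) x) =
    (π : H →ₗ[k] B).rTensor H (TensorProduct.comm k H H (Coalgebra.comul (R := k) x))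

end Extension

end HopfExt

/-- The data of a Hopf algebra structure on a given `k`-algebra `U`: a coassociative and counital
pair of algebra maps `Δ`, `ε`, and an antipode. -/
structure HopfStructure (k : Type*) (U : Type*) [Field k] [Ring U] [Algebra k U] where
  /-- The comultiplication `Δ`. -/
  comul : U →ₐ[k] U ⊗[k] U
  /-- The counit `ε`. -/
  counit : U →ₐ[k] k
  /-- The antipode `S`. -/
  antipode : U →ₗ[k] U
  coassoc : (Algebra.TensorProduct.assoc k k k U U U).toAlgHom.comp
    ((Algebra.TensorProduct.map comul (.id k U)).comp comul) =
    (Algebra.TensorProduct.map (.id k U) comul).comp comul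
  counit_left : (Algebra.TensorProduct.map counit (.id k U)).comp comul =
    (Algebra.TensorProduct.lid k U).symm
  counit_right : (Algebra.TensorProduct.map (.id k U) counit).comp comul =
    (Algebra.TensorProduct.rid k k U).symm
  antipode_left : ∀ u : U, LinearMap.mul' k U (antipode.rTensor U (comul u)) =
    algebraMap k U (counit u)
  antipode_right : ∀ u : U, LinearMap.mul' k U (antipode.lTensor U (comul u)) =
    algebraMap k U (counit u)

/-- The Hopf algebra given by a Hopf algebra structure. -/
abbrev HopfStructure.toHopfAlgebra {k : Type*} {U : Type*} [Field k] [Ring U] [Algebra k U]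
    (S : HopfStructure k U) : HopfAlgebra k U :=
  { Bialgebra.ofAlgHom S.comul S.counit S.coassoc S.counit_left S.counit_right with
    antipode := S.antipode
    mul_antipode_rTensor_comul := LinearMap.ext S.antipode_left
    mul_antipode_lTensor_comul := LinearMap.ext S.antipode_right }

/-! ### The datum `D` and the algebra `u(D)` -/

section Datum

variable (k : Type*) (p : ℕ) (h : Type*) [Field k] [Fact p.Prime] [CharP k p]
  [LieRing h] [LieAlgebra k h] [IsLieAbelian h] [RestrictedLieAlgebra k p h]

/-- A compatible datum `D = (T, z, Θ, χ)` with `A = u(h)`, `h` abelian, and `B = k[z]/f(z)`: here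
`T = (g, h, ρ)` is a type with `g = P(B)`, the element `Θ` is in `A⁺`, and `χ` is a 2-cocycle in
`A⁺ ⊗ A⁺`, such that `ρ_z(Θ) = 0` and `Φ_z(χ) = d¹(Θ)` (so that `χ` is a `z`-cocycle). -/
structure CompatibleDatum {n : ℕ} (lam : Fin n → k) where
  /-- The algebraic representation of `g = P(B)` on `h`. -/
  ρ : AlgebraicRep k p (HopfExt.primitives k (MonogenicHopf k p lam)) h
  /-- The element `Θ` of `A⁺`. -/
  Θ : RestrictedEnveloping k p h
  /-- The 2-cocycle `χ`. -/
  χ : RestrictedEnveloping k p h ⊗[k] RestrictedEnveloping k p h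
  Θ_mem : Θ ∈ Cobar.augIdeal k (RestrictedEnveloping k p h)
  χ_mem : χ ∈ Cobar.cocycles k (RestrictedEnveloping k p h)
  ρ_Θ : ρ.derivation (MonogenicHopf.zPrim k p lam) Θ = 0
  Φ_χ : Cobar.opPhi p lam (ρ.derivation (MonogenicHopf.zPrim k p lam)).toLinearMap χ =
    Cobar.d1 k (RestrictedEnveloping k p h) Θ

namespace CompatibleDatum

variable {k p h} {n : ℕ} {lam : Fin n → k} (D : CompatibleDatum k p h lam)

/-- The derivation `ρ_z` of `A = u(h)`. -/
def ρz : Derivation k (RestrictedEnveloping k p h) (RestrictedEnveloping k p h) :=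
  D.ρ.derivation (MonogenicHopf.zPrim k p lam)

/-- The cocycle `D_z^m(χ)`. -/
def cocycle (m : ℕ) : Cobar.cocycles k (RestrictedEnveloping k p h) :=
  ⟨Cobar.opD p D.ρz.toLinearMap m D.χ, Cobar.opD_mem_cocycles p (by simp)
    (D.ρ.counit_derivation _) (D.ρ.comul_derivation _) D.χ_mem m⟩

/-- The class `[D_z^m(χ)]` in `H²(ΩA)`. -/
def cohomologyClass (m : ℕ) : Cobar.H2 k (RestrictedEnveloping k p h) :=
  Submodule.Quotient.mk (D.cocycle m)

/-- The free algebra on the elements of `A` and an indeterminate `x`. -/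
abbrev Free (_ : CompatibleDatum k p h lam) : Type _ :=
  FreeAlgebra k (RestrictedEnveloping k p h ⊕ Unit)

/-- The generator of the free algebra that belongs to `a ∈ A`. -/
abbrev genA (a : RestrictedEnveloping k p h) : D.Free := FreeAlgebra.ι k (Sum.inl a)

/-- The generator `x` of the free algebra. -/
abbrev genX : D.Free := FreeAlgebra.ι k (Sum.inr ())

/-- The defining relations of `u(D)`: those of the algebra `A`, together with
`[x, a] = ρ_z(a)` for `a ∈ A` and `x^{p^n} + λ_{n-1} x^{p^{n-1}} + ⋯ + λ_0 x + Θ = 0`. -/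
inductive Rel : D.Free → D.Free → Prop
  | add (a b : RestrictedEnveloping k p h) : Rel (D.genA (a + b)) (D.genA a + D.genA b)
  | mul (a b : RestrictedEnveloping k p h) : Rel (D.genA (a * b)) (D.genA a * D.genA b)
  | scalar (c : k) : Rel (D.genA (algebraMap k _ c)) (algebraMap k _ c)
  | bracket (a : RestrictedEnveloping k p h) :
      Rel (D.genX * D.genA a - D.genA a * D.genX) (D.genA (D.ρz a))
  | top : Rel (Polynomial.aeval D.genX (pPolynomial k p lam) + D.genA D.Θ) 0

/-- The algebra `u(D)`, generated by `A` and `x` subject to the relations `Rel`. -/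
def u : Type _ := RingQuot D.Rel

instance : Ring D.u := inferInstanceAs (Ring (RingQuot D.Rel))

instance : Algebra k D.u := inferInstanceAs (Algebra k (RingQuot D.Rel))

/-- The quotient map from the free algebra to `u(D)`. -/
def quotMap : D.Free →ₐ[k] D.u := RingQuot.mkAlgHom k D.Rel

/-- The generator `x` of `u(D)`. -/
def x : D.u := D.quotMap D.genX

/-- The canonical map `A → u(D)`. -/
def incl : RestrictedEnveloping k p h →ₐ[k] D.u where
  toFun a := D.quotMap (D.genA a)
  map_one' := by
    have h := RingQuot.mkAlgHom_rel k (Rel.scalar (D := D) 1)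
    rw [map_one, map_one, map_one] at h
    exact h
  map_mul' a b := (RingQuot.mkAlgHom_rel k (Rel.mul (D := D) a b)).trans (map_mul _ _ _)
  map_zero' := by
    have h := RingQuot.mkAlgHom_rel k (Rel.scalar (D := D) 0)
    rw [map_zero, map_zero, map_zero] at h
    exact h
  map_add' a b := (RingQuot.mkAlgHom_rel k (Rel.add (D := D) a b)).trans (map_add _ _ _)
  commutes' c := (RingQuot.mkAlgHom_rel k (Rel.scalar (D := D) c)).trans (AlgHom.commutes _ _)

/-- A Hopf algebra structure on the algebra `u(D)` is the one prescribed by `D` if `A → u(D)` is a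
coalgebra map and `Δ(x) = x ⊗ 1 + 1 ⊗ x + χ`, `ε(x) = 0`. -/
structure IsPrescribed (S : HopfStructure k D.u) : Prop where
  comul_incl : ∀ a, S.comul (D.incl a) =
    Algebra.TensorProduct.map D.incl D.incl (Coalgebra.comul (R := k) a)
  counit_incl : ∀ a, S.counit (D.incl a) = Coalgebra.counit (R := k) a
  comul_x : S.comul D.x = D.x ⊗ₜ[k] 1 + 1 ⊗ₜ[k] D.x + Algebra.TensorProduct.map D.incl D.incl D.χ
  counit_x : S.counit D.x = 0

end CompatibleDatum

end Datum

end

noncomputable section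

/-! ### Jacobson's formula in characteristic `p` -/

namespace HopfExt

/-! The engine is Jacobson's formula in characteristic `p`. If `c` lies in a commutative subalgebra
stable under `ad X`, then `(X + c)^p = X^p + c^p + ad(X)^{p-1}(c)`. Since `ad(X)^{p^m} =
ad(X^{p^m})`, iteration gives `(X + c)^{p^m} = X^{p^m} + D^m(c)`; this is where the operators `D^m`
come from. With `X = x ⊗ 1 + 1 ⊗ x` and `c = χ` it follows that `f(Δ(x)) = f(x) ⊗ 1 + 1 ⊗ f(x) +
Φ(χ)`, so the condition `Φ(χ) = d¹(Θ)` is what makes `Δ` compatible with `f(x) + Θ = 0`. The cocycle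
condition gives coassociativity and the equality of the two convolutions needed for the antipode; `χ
∈ A⁺ ⊗ A⁺` gives the counit axioms (`Cobar.aeval_add_eq_opPhi`, `comul_coassoc`,
`convLeft_eq_convRight`).

The size of `u(D)` is controlled by a normal form: it is free over `A` on `x^j`, `j < p^n`. Spanning
is rewriting; independence comes from a representation on `A[t]/(f(t) + Θ)` in which `x` acts as `t
+ ∂`, where the derivation `∂` extends `ρ_z` and kills `t`. It exists because `ρ_z(Θ) = 0`, and
satisfies `f(∂) = 0` because `f(z) = 0` in `B` and `ρ` is algebraic (`aeval_modelDer`,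
`coeffEquiv`). The size of `A` itself comes from a monomial basis of `u(h)`, which also yields `P(A)
= h`.

Connectedness follows from a coalgebra filtration in which `x` is heavier than `χ`. For the
extension, `(id ⊗ π) ∘ Δ` followed by the constant coefficient sends `a x^j` to `a ⊗ z^j`; this
identifies the coinvariants.

For the primitives, let `y` be primitive. Then `π(y)` is primitive in `B`, hence a combination of
the `z^{p^i}`. Subtracting the same combination of the `x^{p^i}` from `y` leaves a coinvariant, so
`y = ∑ c_i x^{p^i} + b` with `b ∈ A`. Such an element is primitive exactly when `d¹(b) = ∑ c_i
D^i(χ)`, that is, when it witnesses a linear relation among the classes. Without a nontrivial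
relation only `b ∈ P(A) = h` remains. A dimension count closes the circle of equivalences. -/

theorem choose_pred_eq (k : Type*) (p : ℕ) [Field k] [hp : Fact p.Prime] [CharP k p] (m : ℕ)
    (hm : m < p) : (((p - 1).choose m : ℕ) : k) = (-1) ^ m := by
  induction m with
  | zero => simp
  | succ m ih =>
    -- By Pascal's rule two neighbouring entries of row `p - 1` add up to an inner entry of row `p`,
    -- which is zero in `k`.
    have h1 := Nat.choose_succ_succ (p - 1) m
    have h2 : p - 1 + 1 = p := Nat.succ_pred_prime hp.out
    have h3 : ((p.choose (m + 1) : ℕ) : k) = 0 := by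
      rw [CharP.cast_eq_zero_iff k p]
      exact hp.out.dvd_choose_self (by omega) hm
    rw [Nat.succ_eq_add_one, Nat.succ_eq_add_one, h2] at h1
    rw [h1, Nat.cast_add, ih (by omega)] at h3
    rw [pow_succ]
    linear_combination h3

/-- The binomial coefficients of row `p - 1` are alternating signs, and these cancel the signs in
the expansion of `(a - b)^{p-1}`. It is applied to left and right multiplication by one element,
whose difference is the inner derivation. -/
theorem geom_sum_of_commute (k : Type*) (p : ℕ) [Field k] [hp : Fact p.Prime] [CharP k p]
    {V : Type*} [Ring V] [Algebra k V] {a b : V} (h : Commute a b) :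
    ∑ i ∈ Finset.range p, a ^ i * b ^ (p - 1 - i) = (a - b) ^ (p - 1) := by
  rw [sub_eq_add_neg, h.neg_right.add_pow, Nat.sub_add_cancel hp.out.one_le]
  refine Finset.sum_congr rfl fun i hi => ?_
  have hi' : i < p := Finset.mem_range.mp hi
  have h1 : (((p - 1).choose i : ℕ) : V) = (-1) ^ (p - 1 - i) := by
    rw [← Nat.choose_symm (by omega), ← map_natCast (algebraMap k V),
      choose_pred_eq k p _ (by omega)]
    simp
  rw [h1, neg_pow b, mul_assoc, ((Commute.neg_one_left (b ^ (p - 1 - i))).pow_left _).eq,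
    mul_assoc (b ^ _), ← pow_add, ← two_mul, pow_mul]
  simp

section CharP

variable (k : Type*) (p : ℕ) [Field k] [hp : Fact p.Prime] [CharP k p]
  {V : Type*} [Ring V] [Algebra k V]

variable {k} in
/-- The inner derivation `v ↦ X v - v X`. -/
def innerDer (X : V) : Module.End k V := LinearMap.mulLeft k X - LinearMap.mulRight k X

@[simp]
theorem innerDer_apply (X v : V) : innerDer (k := k) X v = X * v - v * X := rfl

/-- Left and right multiplication commute, so Frobenius is additive on their difference. -/
theorem innerDer_pow (X : V) (m : ℕ) :
    innerDer (k := k) X ^ p ^ m = innerDer (X ^ p ^ m) := by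
  induction m with
  | zero => simp
  | succ m ih =>
    rw [pow_succ, pow_mul, ih, innerDer, sub_pow_of_commute k p (LinearMap.commute_mulLeft_right ..),
      LinearMap.pow_mulLeft, LinearMap.pow_mulRight, ← pow_mul]
    rfl

open Polynomial in
-- The coefficients need not commute, so the summands cannot be collected into `n P^{n-1} P'`.
theorem derivative_pow_eq_sum (P : V[X]) (n : ℕ) :
    derivative (P ^ n) = ∑ i ∈ Finset.range n, P ^ i * derivative P * P ^ (n - 1 - i) := by
  induction n with
  | zero => simp
  | succ n ih =>
    rw [pow_succ', derivative_mul, ih, Finset.sum_range_succ', Finset.mul_sum, add_comm]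
    simp only [pow_zero, one_mul, Nat.sub_zero, Nat.add_sub_cancel]
    congr 1
    refine Finset.sum_congr rfl fun i _ => ?_
    rw [pow_succ', Nat.sub_sub, add_comm 1 i]
    simp only [mul_assoc]

variable {C : Type*} [CommRing C] [Algebra k C] {k}
  {X : V} {ψ : C →ₐ[k] V} {d : Module.End k C}

theorem innerDer_iterate (hX : ∀ c, X * ψ c - ψ c * X = ψ (d c)) (j : ℕ) (c : C) :
    (innerDer (k := k) X ^ j) (ψ c) = ψ ((d ^ j) c) := by
  induction j with
  | zero => simp
  | succ j ih => rw [pow_succ', pow_succ', Module.End.mul_apply, ih, innerDer_apply, hX]; rfl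

open Polynomial in
/-- Jacobson's formula `(X + c)^p = X^p + c^p + ad(X)^{p-1}(c)`, for `c` in a commutative
subalgebra which is stable under `ad(X)`. -/
theorem jacobson_formula (hX : ∀ c, X * ψ c - ψ c * X = ψ (d c)) (c : C) :
    (X + ψ c) ^ p = X ^ p + ψ (c ^ p + (d ^ (p - 1)) c) := by
  -- Let a central variable `t` scale `c` and compare the coefficients of `(X + t c)^p`. Its
  -- derivative in `t` is `ad(P)^{p-1}(c)`, by `geom_sum_of_commute`.
  set P : V[X] := Polynomial.C X + Polynomial.X * Polynomial.C (ψ c) with hP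
  have hp2 := hp.out.two_le
  have hdP : derivative P = Polynomial.C (ψ c) := by simp [hP]
  -- The part of `P` with `t` commutes with the image of `C`, so `ad P` acts there as `ad X`. Hence
  -- the derivative of `P^p` is constant in `t`.
  have hcomm (b : C) : P * Polynomial.C (ψ b) - Polynomial.C (ψ b) * P =
      Polynomial.C (ψ (d b)) := by
    rw [hP, ← hX, map_sub, map_mul, map_mul, add_mul, mul_add, mul_assoc, ← map_mul, ← map_mul,
      ← map_mul, ← mul_assoc, ← Polynomial.X_mul_C (ψ b), mul_assoc, ← map_mul, mul_comm c b]
    simp only [map_mul]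
    abel
  have hder : derivative (P ^ p) = Polynomial.C (ψ ((d ^ (p - 1)) c)) := by
    have h1 : ∀ j : ℕ, (innerDer (k := k) P ^ j) (Polynomial.C (ψ c)) =
        Polynomial.C (ψ ((d ^ j) c)) := by
      intro j
      induction j with
      | zero => simp
      | succ j ih =>
        rw [pow_succ', pow_succ', Module.End.mul_apply, ih, innerDer_apply, hcomm]; rfl
    rw [← h1, innerDer, ← geom_sum_of_commute k p (LinearMap.commute_mulLeft_right ..),
      derivative_pow_eq_sum, hdP, LinearMap.sum_apply]
    refine Finset.sum_congr rfl fun i _ => ?_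
    rw [LinearMap.pow_mulLeft, LinearMap.pow_mulRight, Module.End.mul_apply]
    simp [mul_assoc]
  have hdeg1 : P.natDegree ≤ 1 := by
    refine (natDegree_add_le _ _).trans (max_le (by simp) ?_)
    exact (natDegree_mul_C_le _ _).trans natDegree_X_le
  have hdeg : (P ^ p).natDegree ≤ p := by
    simpa using natDegree_pow_le_of_le p hdeg1
  have hc0 : (P ^ p).coeff 0 = X ^ p := by
    have := map_pow (Polynomial.constantCoeff (R := V)) P p
    simpa [hP] using this
  have hcp : (P ^ p).coeff p = ψ c ^ p := by
    have := coeff_pow_of_natDegree_le (m := p) hdeg1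
    simpa [hP] using this
  have hc1 : (P ^ p).coeff 1 = ψ ((d ^ (p - 1)) c) := by
    have := congrArg (fun q => q.coeff 0) hder
    simpa [coeff_derivative] using this
  -- The derivative has no term of degree `j - 1 > 0`, and `j` is invertible in `k`.
  have hcj (j : ℕ) (hj : 1 < j) (hjp : j < p) : (P ^ p).coeff j = 0 := by
    obtain ⟨i, rfl⟩ : ∃ i, j = i + 1 := ⟨j - 1, by omega⟩
    have h1 := congrArg (fun q => q.coeff i) hder
    simp only [coeff_derivative, coeff_C, if_neg (show i ≠ 0 by omega)] at h1
    have h2 : ((i + 1 : ℕ) : k) ≠ 0 := by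
      rw [Ne, CharP.cast_eq_zero_iff k p]
      exact fun h => absurd (Nat.le_of_dvd (by omega) h) (by omega)
    have h3 : ((i : V) + 1) * algebraMap k V ((i + 1 : ℕ) : k)⁻¹ = 1 := by
      have : ((i : V) + 1) = algebraMap k V ((i + 1 : ℕ) : k) := by simp
      rw [this, ← map_mul, mul_inv_cancel₀ h2, map_one]
    calc (P ^ p).coeff (i + 1) = (P ^ p).coeff (i + 1) * (((i : V) + 1) *
          algebraMap k V ((i + 1 : ℕ) : k)⁻¹) := by rw [h3, mul_one]
      _ = 0 := by rw [← mul_assoc, h1, zero_mul]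
  -- Evaluation at `1` is multiplicative even over a noncommutative ring, since `1` is central.
  have heval : (P ^ p).eval 1 = (X + ψ c) ^ p := by
    have := map_pow (Polynomial.eval₂RingHom' (RingHom.id V) (1 : V) fun a => Commute.one_right _) P p
    simp only [Polynomial.eval₂RingHom', RingHom.coe_mk, MonoidHom.coe_mk, OneHom.coe_mk] at this
    rw [Polynomial.eval, this]
    congr 1
    simp [hP, X_mul_C]
  rw [← heval, eval_eq_sum_range' (n := p + 1) (by omega)]
  simp only [one_pow, mul_one]
  rw [Finset.sum_range_succ, ← Finset.add_sum_erase (Finset.range p) _ (a := 0) (by simp; omega),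
    ← Finset.add_sum_erase ((Finset.range p).erase 0) _ (a := 1) (by simp; omega),
    Finset.sum_eq_zero, hc0, hc1, hcp]
  · simp only [map_add, map_pow]; abel
  · intro j hj
    simp only [Finset.mem_erase, Finset.mem_range] at hj
    exact hcj j (by omega) (by omega)

end CharP

end HopfExt

namespace Cobar

variable {k : Type*} {p : ℕ} [Field k] [hp : Fact p.Prime] [CharP k p]
  {V : Type*} [Ring V] [Algebra k V] {A : Type*} [CommRing A] [Bialgebra k A]
  {δ : Module.End k A} {X : V} {ψ : A ⊗[k] A →ₐ[k] V}

/-- The operators `D^m` describe the `p^m`-th powers of `X + χ`, if `X` acts by `δ` on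
`A ⊗ A`. -/
theorem add_pow_eq_opD (hX : ∀ c, X * ψ c - ψ c * X = ψ (act δ c)) (c : A ⊗[k] A) (m : ℕ) :
    (X + ψ c) ^ p ^ m = X ^ p ^ m + ψ (opD p δ m c) := by
  induction m with
  | zero => simp [opD]
  | succ m ih =>
    -- `X^{p^m}` acts by the `p^m`-th power of the action, so Jacobson's formula for it contributes
    -- the exponent `p^m (p - 1) = p^{m+1} - p^m`.
    have hXm (b : A ⊗[k] A) : X ^ p ^ m * ψ b - ψ b * X ^ p ^ m = ψ ((act δ ^ p ^ m) b) := by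
      rw [← HopfExt.innerDer_iterate hX, HopfExt.innerDer_pow, HopfExt.innerDer_apply]
    rw [pow_succ p m, pow_mul, ih, HopfExt.jacobson_formula p hXm, pow_mul, opD, ← pow_mul (act δ),
      Nat.mul_sub, mul_one, ← pow_succ]

/-- `V` is left general for two uses: `u(D) ⊗ u(D)` for the comultiplication, and `u(D)` with `a ⊗ b
↦ S(a) b` for the antipode. -/
theorem aeval_add_eq_opPhi {n : ℕ} (lam : Fin n → k)
    (hX : ∀ c, X * ψ c - ψ c * X = ψ (act δ c)) (c : A ⊗[k] A) :
    Polynomial.aeval (X + ψ c) (pPolynomial k p lam) =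
      Polynomial.aeval X (pPolynomial k p lam) + ψ (opPhi p lam δ c) := by
  simp only [MonogenicHopf.aeval_pPolynomial, add_pow_eq_opD hX, opPhi, map_add, map_sum, map_smul,
    smul_add, Finset.sum_add_distrib]
  abel

end Cobar

/-! ### Polynomials modulo `X_i^p - L_i` with `L_i` of lower degree -/

namespace RestrictedMonomials

open MvPolynomial

variable {k : Type*} [Field k] {σ : Type*}

variable (k σ) in
/-- The polynomials of total degree less than `n`. -/
def lowDegree (n : ℕ) : Submodule k (MvPolynomial σ k) :=
  Submodule.span k {f | ∃ m : σ →₀ ℕ, m.degree < n ∧ monomial m 1 = f}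

theorem monomial_mem_lowDegree {m : σ →₀ ℕ} {n : ℕ} (h : m.degree < n) :
    monomial m (1 : k) ∈ lowDegree k σ n :=
  Submodule.subset_span ⟨m, h, rfl⟩

theorem lowDegree_mono {n n' : ℕ} (h : n ≤ n') : lowDegree k σ n ≤ lowDegree k σ n' :=
  Submodule.span_mono fun _ ⟨m, hm, e⟩ => ⟨m, hm.trans_le h, e⟩

theorem lowDegree_zero : lowDegree k σ 0 = ⊥ := by
  rw [lowDegree, Submodule.span_eq_bot]
  rintro _ ⟨m, hm, -⟩
  exact absurd hm (Nat.not_lt_zero _)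

/-- One bound is strict and the other (`b + 1`) allows degree `b`, so the product stays strictly
below `a + b`. -/
theorem mul_mem_lowDegree {f g : MvPolynomial σ k} {a b : ℕ} (hf : f ∈ lowDegree k σ a)
    (hg : g ∈ lowDegree k σ (b + 1)) : f * g ∈ lowDegree k σ (a + b) := by
  have h := Submodule.mul_mem_mul hf hg
  rw [lowDegree, lowDegree, Submodule.span_mul_span] at h
  refine Submodule.span_mono ?_ h
  rintro _ ⟨_, ⟨m, hm, rfl⟩, _, ⟨m', hm', rfl⟩, rfl⟩
  refine ⟨m + m', ?_, by simp [monomial_mul]⟩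
  rw [map_add]
  omega

theorem exists_mem_lowDegree (f : MvPolynomial σ k) : ∃ n, f ∈ lowDegree k σ n := by
  induction f using MvPolynomial.induction_on' with
  | monomial m c =>
    refine ⟨m.degree + 1, ?_⟩
    have := (lowDegree k σ (m.degree + 1)).smul_mem c (monomial_mem_lowDegree (Nat.lt_succ_self _))
    rwa [smul_monomial, smul_eq_mul, mul_one] at this
  | add f g hf hg =>
    obtain ⟨a, ha⟩ := hf
    obtain ⟨b, hb⟩ := hg
    exact ⟨max a b, add_mem (lowDegree_mono (le_max_left _ _) ha)
      (lowDegree_mono (le_max_right _ _) hb)⟩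

/-- Leading monomials with coefficient one multiply; every cross term has a factor of lower degree.
-/
theorem mul_sub_monomial_mem {f g : MvPolynomial σ k} {a b : σ →₀ ℕ}
    (hf : f - monomial a 1 ∈ lowDegree k σ a.degree)
    (hg : g - monomial b 1 ∈ lowDegree k σ b.degree) :
    f * g - monomial (a + b) 1 ∈ lowDegree k σ (a + b).degree := by
  have h1 := mul_mem_lowDegree hf (lowDegree_mono (Nat.le_succ _) hg)
  have h2 := mul_mem_lowDegree hf (monomial_mem_lowDegree (k := k) (Nat.lt_succ_self b.degree))
  have h3 := mul_mem_lowDegree hg (monomial_mem_lowDegree (k := k) (Nat.lt_succ_self a.degree))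
  rw [add_comm b.degree] at h3
  have e : f * g - monomial (a + b) 1 = (f - monomial a 1) * (g - monomial b 1) +
      (f - monomial a 1) * monomial b 1 + (g - monomial b 1) * monomial a 1 := by
    rw [show monomial (a + b) (1 : k) = monomial a 1 * monomial b 1 by simp [monomial_mul]]
    ring
  rw [e, map_add]
  exact add_mem (add_mem h1 h2) h3

variable (p : ℕ) (L : σ → MvPolynomial σ k)

/-- The substitution `X_i ↦ X_i^p - L_i`. -/
def subst : MvPolynomial σ k →ₐ[k] MvPolynomial σ k := aeval fun i => X i ^ p - L i

variable {p L}

theorem subst_monomial_sub_mem (hL : ∀ i, L i ∈ lowDegree k σ p) (a : σ →₀ ℕ) :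
    subst p L (monomial a 1) - monomial (p • a) 1 ∈ lowDegree k σ (p • a).degree := by
  induction a using Finsupp.induction_linear with
  | zero => simp
  | add a b ha hb =>
    rw [show monomial (a + b) (1 : k) = monomial a 1 * monomial b 1 by simp [monomial_mul],
      map_mul, smul_add]
    exact mul_sub_monomial_mem ha hb
  | single i n =>
    induction n with
    | zero => simp
    | succ n ih =>
      rw [Finsupp.single_add, show monomial (Finsupp.single i n + Finsupp.single i 1) (1 : k) =
        monomial (Finsupp.single i n) 1 * monomial (Finsupp.single i 1) 1 by simp [monomial_mul],
        map_mul, smul_add]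
      refine mul_sub_monomial_mem ih ?_
      have h1 : monomial (p • Finsupp.single i 1) (1 : k) = X i ^ p := by
        simp [X_pow_eq_monomial]
      have h2 : subst p L (monomial (Finsupp.single i 1) 1) = X i ^ p - L i :=
        aeval_X _ i
      rw [h1, h2, sub_sub_cancel_left]
      simpa using neg_mem (hL i)

variable (p L) in
/-- The linear map which sends `X^{pa + e}`, `e_i < p`, to `∏ (X_i^p - L_i)^{a_i} X^e`. -/
def triangular : MvPolynomial σ k →ₗ[k] MvPolynomial σ k :=
  (basisMonomials σ k).constr k fun m =>
    subst p L (monomial (m.mapRange (· / p) (Nat.zero_div p)) 1) *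
      monomial (m.mapRange (· % p) (Nat.zero_mod p)) 1

theorem triangular_monomial (m : σ →₀ ℕ) : triangular p L (monomial m 1) =
    subst p L (monomial (m.mapRange (· / p) (Nat.zero_div p)) 1) *
      monomial (m.mapRange (· % p) (Nat.zero_mod p)) 1 := by
  have := (basisMonomials σ k).constr_basis k (fun m =>
    subst p L (monomial (m.mapRange (· / p) (Nat.zero_div p)) 1) *
      monomial (m.mapRange (· % p) (Nat.zero_mod p)) 1) m
  rwa [coe_basisMonomials] at this

/-- Division with remainder of the exponents, `m = p a + e`, shows that the image of `X^m` has
leading monomial `X^m`. So `triangular` is unipotent for the degree filtration, which makes it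
bijective. -/
theorem sub_triangular_mem (hL : ∀ i, L i ∈ lowDegree k σ p) {n : ℕ} {f : MvPolynomial σ k}
    (hf : f ∈ lowDegree k σ (n + 1)) : f - triangular p L f ∈ lowDegree k σ n := by
  suffices h : lowDegree k σ (n + 1) ≤
      (lowDegree k σ n).comap (LinearMap.id - triangular p L) from h hf
  rw [lowDegree, Submodule.span_le]
  rintro _ ⟨m, hm, rfl⟩
  rw [SetLike.mem_coe, Submodule.mem_comap]
  change monomial m 1 - triangular p L (monomial m 1) ∈ _
  refine lowDegree_mono (Nat.lt_succ_iff.mp hm) ?_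
  rw [← neg_mem_iff, neg_sub, triangular_monomial]
  have h := mul_sub_monomial_mem (k := k)
    (subst_monomial_sub_mem hL (m.mapRange (· / p) (Nat.zero_div p)))
    (g := monomial (m.mapRange (· % p) (Nat.zero_mod p)) 1) (by rw [sub_self]; exact zero_mem _)
  have e : p • m.mapRange (· / p) (Nat.zero_div p) + m.mapRange (· % p) (Nat.zero_mod p) = m := by
    ext i
    simp [Nat.div_add_mod]
  rwa [e] at h

theorem triangular_bijective (hL : ∀ i, L i ∈ lowDegree k σ p) :
    Function.Bijective (triangular p L) := by
  constructor
  · rw [← LinearMap.ker_eq_bot, LinearMap.ker_eq_bot']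
    intro f hf
    obtain ⟨n, hn⟩ := exists_mem_lowDegree f
    induction n with
    | zero => simpa [lowDegree_zero] using hn
    | succ n ih =>
      have := sub_triangular_mem hL hn
      rw [hf, sub_zero] at this
      exact ih this
  · intro f
    obtain ⟨n, hn⟩ := exists_mem_lowDegree f
    induction n generalizing f with
    | zero => exact ⟨0, by simpa [lowDegree_zero, eq_comm] using hn⟩
    | succ n ih =>
      obtain ⟨g, hg⟩ := ih _ (sub_triangular_mem hL hn)
      exact ⟨f + g, by rw [map_add, hg, add_sub_cancel]⟩

-- Under `triangular`, multiplication by a relation becomes multiplication by `X_i^p`. The ideal of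
-- the relations thus corresponds to the monomial ideal of the `X_i^p`, and the reduced monomials
-- give coordinates on the quotient.
variable (p) in
theorem subst_X_mul_triangular (hp : p ≠ 0) (i : σ) (f : MvPolynomial σ k) :
    (X i ^ p - L i) * triangular p L f = triangular p L (monomial (Finsupp.single i p) 1 * f) := by
  classical
  suffices h : LinearMap.mulLeft k (X i ^ p - L i) ∘ₗ triangular p L =
      triangular p L ∘ₗ LinearMap.mulLeft k (monomial (Finsupp.single i p) 1) from
    LinearMap.congr_fun h f
  refine (basisMonomials σ k).ext fun m => ?_
  rw [coe_basisMonomials]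
  simp only [LinearMap.comp_apply, LinearMap.mulLeft_apply]
  have h1 : (Finsupp.single i p + m).mapRange (· / p) (Nat.zero_div p) =
      Finsupp.single i 1 + m.mapRange (· / p) (Nat.zero_div p) := by
    ext j
    by_cases hj : i = j
    · subst hj
      simp [Nat.add_div_left, Nat.pos_of_ne_zero hp, add_comm]
    · simp [hj]
  have h2 : (Finsupp.single i p + m).mapRange (· % p) (Nat.zero_mod p) =
      m.mapRange (· % p) (Nat.zero_mod p) := by
    ext j
    by_cases hj : i = j
    · subst hj
      simp
    · simp [hj]
  have h3 (a : σ →₀ ℕ) : monomial (Finsupp.single i 1 + a) (1 : k) = X i * monomial a 1 := by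
    rw [X, monomial_mul, one_mul]
  have h4 : subst p L (X i) = X i ^ p - L i := aeval_X _ i
  rw [monomial_mul, one_mul, triangular_monomial, triangular_monomial, h1, h2, h3, map_mul, h4,
    mul_assoc]

variable [Fintype σ]

variable (p L) in
/-- The coefficients of the normal form modulo the polynomials `X_i^p - L_i`. -/
def normalForm (hL : ∀ i, L i ∈ lowDegree k σ p) :
    MvPolynomial σ k →ₗ[k] (σ → Fin p) → k :=
  LinearMap.pi (fun e => lcoeff k (Finsupp.equivFunOnFinite.symm fun i => (e i : ℕ))) ∘ₗ
    (LinearEquiv.ofBijective (triangular p L) (triangular_bijective hL)).symm.toLinearMap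

theorem normalForm_triangular (hL : ∀ i, L i ∈ lowDegree k σ p) (f : MvPolynomial σ k)
    (e : σ → Fin p) : normalForm p L hL (triangular p L f) e =
      coeff (Finsupp.equivFunOnFinite.symm fun i => (e i : ℕ)) f := by
  have := (LinearEquiv.ofBijective (triangular p L) (triangular_bijective hL)).symm_apply_apply f
  rw [LinearEquiv.ofBijective_apply] at this
  simp [normalForm, this]

theorem normalForm_eq_zero (hL : ∀ i, L i ∈ lowDegree k σ p) {f : MvPolynomial σ k}
    (hf : f ∈ Ideal.span (Set.range fun i => X i ^ p - L i)) : normalForm p L hL f = 0 := by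
  classical
  suffices h : ∀ g, normalForm p L hL (g * f) = 0 by simpa using h 1
  induction hf using Submodule.span_induction with
  | zero => simp
  | add x y _ _ hx hy => intro g; rw [mul_add, map_add, hx, hy, add_zero]
  | smul a x _ hx => intro g; rw [smul_eq_mul, ← mul_assoc]; exact hx _
  | mem x hx =>
    obtain ⟨i, rfl⟩ := hx
    intro g
    obtain ⟨g, rfl⟩ := (triangular_bijective hL).2 g
    ext e
    rw [mul_comm, subst_X_mul_triangular p (by have := (e i).pos; omega), normalForm_triangular,
      coeff_monomial_mul', if_neg, Pi.zero_apply]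
    intro h
    have h' := h i
    rw [Finsupp.single_eq_same, Finsupp.equivFunOnFinite_symm_apply_apply] at h'
    exact absurd h' (by have := (e i).2; omega)

theorem normalForm_monomial (hL : ∀ i, L i ∈ lowDegree k σ p) (e : σ → Fin p) [DecidableEq σ] :
    normalForm p L hL (monomial (Finsupp.equivFunOnFinite.symm fun i => (e i : ℕ)) 1) =
      Pi.single e 1 := by
  -- A reduced monomial has all quotients `0`, so `triangular` fixes it.
  have h : triangular p L (monomial (Finsupp.equivFunOnFinite.symm fun i => (e i : ℕ)) 1) =
      monomial (Finsupp.equivFunOnFinite.symm fun i => (e i : ℕ)) 1 := by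
    have h1 : (Finsupp.equivFunOnFinite.symm fun i => (e i : ℕ)).mapRange (· / p)
        (Nat.zero_div p) = 0 := by
      ext i; simp [Nat.div_eq_of_lt]
    have h2 : (Finsupp.equivFunOnFinite.symm fun i => (e i : ℕ)).mapRange (· % p)
        (Nat.zero_mod p) = Finsupp.equivFunOnFinite.symm fun i => (e i : ℕ) := by
      ext i; simp [Nat.mod_eq_of_lt]
    rw [triangular_monomial, h1, h2]
    simp
  rw [← h]
  ext e'
  rw [normalForm_triangular, coeff_monomial, Pi.single_apply]
  congr 1
  rw [EmbeddingLike.apply_eq_iff_eq, eq_comm, funext_iff, funext_iff]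
  simp [Fin.ext_iff, eq_comm]

end RestrictedMonomials

/-! ### A criterion for the primitive elements -/

namespace HopfExt

section Criterion

variable {k : Type*} {H : Type*} [Field k] [Ring H] [Bialgebra k H]

theorem counit_of_mem_primitives {x : H} (hx : x ∈ primitives k H) :
    Coalgebra.counit (R := k) x = 0 := by
  have h := congrArg (TensorProduct.lid k H ∘ Coalgebra.counit.rTensor H) (mem_primitives.mp hx)
  simp only [Function.comp_apply, Coalgebra.rTensor_counit_comul, map_add,
    LinearMap.rTensor_tmul, TensorProduct.lid_tmul, one_smul, Bialgebra.counit_one] at h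
  have h2 : algebraMap k H (Coalgebra.counit (R := k) x) = 0 := by
    rw [Algebra.algebraMap_eq_smul_one]
    exact right_eq_add.mp h
  have h3 := congrArg (Coalgebra.counit (R := k)) h2
  simpa using h3

/-- The operator `(φ ⊗ id) ∘ Δ`. -/
def contract (φ : H →ₗ[k] k) : H →ₗ[k] H :=
  (TensorProduct.lid k H).toLinearMap ∘ₗ φ.rTensor H ∘ₗ Coalgebra.comul

theorem contract_of_mem_primitives (φ : H →ₗ[k] k) {x : H} (hx : x ∈ primitives k H) :
    contract φ x = φ x • 1 + φ 1 • x := by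
  simp [contract, mem_primitives.mp hx]

/-- If the operators `(φ_s ⊗ id) ∘ Δ` separate the elements of a basis, then the primitive
elements are the combinations of the primitive elements dual to the `φ_s`. -/
theorem eq_sum_of_mem_primitives {E S : Type*} [Fintype S] [DecidableEq S] (β : Module.Basis E k H)
    {e0 : E} (hβ : β e0 = 1) {x : S → H} (hx : ∀ s, x s ∈ primitives k H) {φ : S → H →ₗ[k] k}
    (hφ1 : ∀ s, φ s 1 = 0) (hφx : ∀ s t, φ s (x t) = if s = t then 1 else 0)
    (hsep : ∀ e, e ≠ e0 → ∃ s, ∃ θ : H →ₗ[k] k, θ (contract (φ s) (β e)) ≠ 0 ∧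
      ∀ e', e' ≠ e → θ (contract (φ s) (β e')) = 0)
    {y : H} (hy : y ∈ primitives k H) : y = ∑ s, φ s y • x s := by
  rw [← sub_eq_zero]
  set y' := y - ∑ s, φ s y • x s with hy'
  have hp : y' ∈ primitives k H :=
    sub_mem hy (sum_mem fun s _ => (primitives k H).smul_mem _ (hx s))
  have hφ (s : S) : φ s y' = 0 := by simp [hy', hφx]
  have hc (s : S) : contract (φ s) y' = 0 := by
    rw [contract_of_mem_primitives _ hp, hφ, hφ1]; simp
  -- The contractions of `y'` vanish, since `y'` is primitive and `φ_s` kills both `y'` and `1`.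
  -- Composing one of them with `θ` isolates a single coordinate.
  have hrepr (e : E) (he : e ≠ e0) : β.repr y' e = 0 := by
    obtain ⟨s, θ, h1, h2⟩ := hsep e he
    have h3 : θ (contract (φ s) y') = β.repr y' e * θ (contract (φ s) (β e)) := by
      have h4 := congrArg (θ ∘ₗ contract (φ s)) (β.linearCombination_repr y')
      rw [Finsupp.linearCombination_apply, map_finsuppSum, Finsupp.sum_eq_single e] at h4
      · simpa [eq_comm] using h4
      · intro e' _ he'
        simp [h2 e' he']
      · simp
    rw [hc, map_zero] at h3
    exact (mul_eq_zero.mp h3.symm).resolve_right h1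
  -- Only a scalar is left, and the counit kills it.
  have h1 : y' = β.repr y' e0 • 1 := by
    conv_lhs => rw [← β.linearCombination_repr y']
    rw [Finsupp.linearCombination_apply, Finsupp.sum_eq_single e0, hβ]
    · intro e _ he
      rw [hrepr e he, zero_smul]
    · simp
  have h2 := counit_of_mem_primitives hp
  rw [h1, map_smul, Bialgebra.counit_one, smul_eq_mul, mul_one] at h2
  rw [h1, h2, zero_smul]

end Criterion

end HopfExt

/-! ### Monomial basis and primitive elements of `u(h)` for abelian `h` -/

namespace RestrictedEnveloping

open MvPolynomial RestrictedMonomials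

variable {k : Type*} {p : ℕ} {L : Type*} [Field k] [LieRing L] [LieAlgebra k L]
  [RestrictedLieAlgebra k p L] [IsLieAbelian L] [hp : Fact p.Prime] [CharP k p]
  {σ : Type*} [Fintype σ] (b : Module.Basis σ k L)

/-- The monomials in the elements of a basis. -/
def monom (e : σ → ℕ) : RestrictedEnveloping k p L := ∏ i, ι k p L (b i) ^ e i

theorem basis_induction {q : L → Prop} (x : L) (zero : q 0)
    (add : ∀ x y, q x → q y → q (x + y)) (smul : ∀ (c : k) (x : L), q x → q (c • x))
    (coe : ∀ i, q (b i)) : q x := by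
  have hx : x ∈ Submodule.span k (Set.range b) := by rw [b.span_eq]; trivial
  induction hx using Submodule.span_induction with
  | zero => exact zero
  | add x y _ _ hx hy => exact add x y hx hy
  | smul c x _ hx => exact smul c x hx
  | mem x hx => obtain ⟨i, rfl⟩ := hx; exact coe i

/-- The linear forms. -/
def toLinearForm : L →ₗ[k] MvPolynomial σ k := b.constr k X

@[simp]
theorem toLinearForm_basis (i : σ) : toLinearForm b (b i) = X i := b.constr_basis ..

theorem toLinearForm_mem (x : L) : toLinearForm b x ∈ lowDegree k σ p := by
  induction x using basis_induction b with
  | zero => simp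
  | add x y hx hy => rw [map_add]; exact add_mem hx hy
  | smul c x hx => rw [map_smul]; exact Submodule.smul_mem _ _ hx
  | coe i =>
    rw [toLinearForm_basis]
    exact monomial_mem_lowDegree (by simpa using hp.out.one_lt)

variable (p) in
/-- The linear forms by which the powers `X_i^p` have to be replaced. -/
def powForm (i : σ) : MvPolynomial σ k :=
  toLinearForm b (RestrictedLieAlgebra.pMap k p (b i))

theorem powForm_mem (i : σ) : powForm p b i ∈ lowDegree k σ p := toLinearForm_mem b _

variable (p) in
/-- The ideal of the relations of `u(L)`. -/
def relIdeal : Ideal (MvPolynomial σ k) := Ideal.span (Set.range fun i => X i ^ p - powForm p b i)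

theorem pMap_add' (x y : L) : RestrictedLieAlgebra.pMap k p (x + y) =
    RestrictedLieAlgebra.pMap k p x + RestrictedLieAlgebra.pMap k p y := by
  rw [RestrictedLieAlgebra.pMap_add, RestrictedLie.jacobsonSum_eq_zero, add_zero]

/-- Both sides are additive and `p`-semilinear, because `pMap` is additive on an abelian algebra and
Frobenius on a commutative ring. So the relations for a basis imply those for all of `L`. -/
theorem mk_toLinearForm_pMap (x : L) :
    Ideal.Quotient.mk (relIdeal p b) (toLinearForm b (RestrictedLieAlgebra.pMap k p x)) =
      Ideal.Quotient.mk (relIdeal p b) (toLinearForm b x) ^ p := by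
  induction x using basis_induction b with
  | zero =>
    have : RestrictedLieAlgebra.pMap k p (0 : L) = 0 := by
      have := RestrictedLieAlgebra.pMap_smul (p := p) (0 : k) (0 : L)
      simpa [hp.out.ne_zero] using this
    rw [this]
    simp [hp.out.ne_zero]
  | add x y hx hy =>
    rw [pMap_add', map_add, map_add, map_add, map_add, hx, hy,
      HopfExt.add_pow_of_commute k p (Commute.all _ _)]
  | smul c x hx =>
    have h (c : k) (f : MvPolynomial σ k) : Ideal.Quotient.mk (relIdeal p b) (c • f) =
        c • Ideal.Quotient.mk (relIdeal p b) f := map_smul (Ideal.Quotient.mkₐ k _) c f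
    rw [RestrictedLieAlgebra.pMap_smul, map_smul, h, (toLinearForm b).map_smul, h, smul_pow, hx]
  | coe i =>
    rw [← map_pow, eq_comm, Ideal.Quotient.eq, toLinearForm_basis]
    exact Ideal.subset_span ⟨i, rfl⟩

/-- The map from `u(L)` to the quotient of the polynomial ring. -/
def toQuotient : RestrictedEnveloping k p L →ₐ[k] MvPolynomial σ k ⧸ relIdeal p b :=
  lift k p
    { toLinearMap := (Ideal.Quotient.mkₐ k (relIdeal p b)).toLinearMap ∘ₗ toLinearForm b
      map_lie' := fun {x y} => by
        rw [LieRing.of_associative_ring_bracket, mul_comm, sub_self]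
        simp [trivial_lie_zero] }
    (mk_toLinearForm_pMap b)

theorem toQuotient_ι (x : L) :
    toQuotient b (ι k p L x) = Ideal.Quotient.mk (relIdeal p b) (toLinearForm b x) :=
  lift_ι _ _ _ _ _

variable (p) in
/-- The coordinates with respect to the monomial basis. -/
def coords : RestrictedEnveloping k p L →ₗ[k] (σ → Fin p) → k :=
  ((relIdeal p b).restrictScalars k).liftQ (normalForm p (powForm p b) (powForm_mem b))
      (fun _ hf => normalForm_eq_zero (powForm_mem b) hf) ∘ₗ
    (Submodule.Quotient.restrictScalarsEquiv k (relIdeal p b)).symm.toLinearMap ∘ₗ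
    (toQuotient b).toLinearMap

theorem coords_monom [DecidableEq σ] (e : σ → Fin p) :
    coords p b (monom b fun i => (e i : ℕ)) = Pi.single e 1 := by
  rw [← normalForm_monomial (powForm_mem b) e]
  have : toQuotient b (monom b fun i => (e i : ℕ)) = Ideal.Quotient.mk (relIdeal p b)
      (monomial (Finsupp.equivFunOnFinite.symm fun i => (e i : ℕ)) 1) := by
    rw [monom, map_prod, monomial_eq, Finsupp.prod_fintype _ _ (by simp), C_1, one_mul, map_prod]
    simp [toQuotient_ι]
  simp only [coords, LinearMap.comp_apply, AlgHom.toLinearMap_apply, this]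
  rfl

/-- The map from the polynomial ring to `u(L)`. -/
def ofPolynomial : MvPolynomial σ k →ₐ[k] RestrictedEnveloping k p L :=
  MvPolynomial.aeval fun i => ι k p L (b i)

@[simp]
theorem ofPolynomial_X (i : σ) : ofPolynomial (p := p) b (X i) = ι k p L (b i) := aeval_X _ i

theorem ofPolynomial_toLinearForm (x : L) :
    ofPolynomial (p := p) b (toLinearForm b x) = ι k p L x := by
  induction x using basis_induction b with
  | zero => simp
  | add x y hx hy => simp only [map_add, hx, hy]
  | smul c x hx => simp only [map_smul, hx]
  | coe i => simp

/-- Each `X_i^p - L_i` maps to zero in `u(L)`, so only the constant term survives. -/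
theorem ofPolynomial_subst (f : MvPolynomial σ k) :
    ofPolynomial (p := p) b (subst p (powForm p b) f) = algebraMap k _ (constantCoeff f) := by
  have : (ofPolynomial (p := p) b).comp (subst p (powForm p b)) =
      (Algebra.ofId k (RestrictedEnveloping k p L)).comp (MvPolynomial.aeval fun _ => (0 : k)) := by
    refine MvPolynomial.algHom_ext fun i => ?_
    simp [subst, powForm, ofPolynomial_toLinearForm, ι_pMap]
  have h := congrArg (fun g => g f) this
  simp only [AlgHom.comp_apply] at h
  rw [h, Algebra.ofId_apply]
  congr 1
  simp [MvPolynomial.aeval_def, MvPolynomial.eval₂_zero'_apply]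

theorem ofPolynomial_surjective : Function.Surjective (ofPolynomial (p := p) b) := by
  intro a
  induction a using induction with
  | hal r => exact ⟨C r, AlgHom.commutes _ _⟩
  | hι x => exact ⟨_, ofPolynomial_toLinearForm b x⟩
  | hadd x y hx hy =>
    obtain ⟨f, rfl⟩ := hx
    obtain ⟨g, rfl⟩ := hy
    exact ⟨f + g, map_add _ _ _⟩
  | hmul x y hx hy =>
    obtain ⟨f, rfl⟩ := hx
    obtain ⟨g, rfl⟩ := hy
    exact ⟨f * g, map_mul _ _ _⟩

theorem span_monom : ⊤ ≤ Submodule.span k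
    (Set.range fun e : σ → Fin p => (monom b fun i => (e i : ℕ) : RestrictedEnveloping k p L)) := by
  rintro a -
  obtain ⟨f, rfl⟩ := ofPolynomial_surjective b a
  -- Written through `triangular`, each monomial maps to a scalar times a reduced monomial.
  obtain ⟨f, rfl⟩ := (triangular_bijective (powForm_mem b)).2 f
  induction f using MvPolynomial.induction_on' with
  | add f g hf hg => rw [map_add, map_add]; exact add_mem hf hg
  | monomial m c =>
    have : monomial m c = c • monomial m (1 : k) := by simp [smul_monomial]
    rw [this, map_smul, map_smul, triangular_monomial, map_mul, ofPolynomial_subst,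
      ← Algebra.smul_def]
    refine Submodule.smul_mem _ _ (Submodule.smul_mem _ _ (Submodule.subset_span
      ⟨fun i => ⟨m i % p, Nat.mod_lt _ hp.out.pos⟩, ?_⟩))
    rw [monomial_eq, Finsupp.prod_fintype _ _ (by simp), C_1, one_mul, map_prod]
    simp [monom]

variable (p) in
/-- The basis of `u(L)` which consists of the monomials with exponents less than `p`. -/
def monomBasis : Module.Basis (σ → Fin p) k (RestrictedEnveloping k p L) :=
  .mk (v := fun e => monom b fun i => (e i : ℕ)) (by
    classical
    refine LinearIndependent.of_comp (coords p b) ?_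
    have : (coords p b ∘ fun e : σ → Fin p => monom b fun i => (e i : ℕ)) =
        fun e => Pi.single e (1 : k) := funext fun e => coords_monom b e
    rw [this]
    exact Pi.linearIndependent_single_one _ _) (span_monom b)

@[simp]
theorem monomBasis_apply (e : σ → Fin p) : monomBasis p b e = monom b fun i => (e i : ℕ) := by
  simp [monomBasis]

theorem monom_single [DecidableEq σ] (i : σ) :
    monom b (Pi.single i 1) = ι k p L (b i) := by
  rw [monom, Finset.prod_eq_single i] <;> simp +contextual

theorem monom_zero : monom b 0 = (1 : RestrictedEnveloping k p L) := by simp [monom]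

theorem comul_monom [DecidableEq σ] (n : σ → ℕ) :
    Coalgebra.comul (R := k) (monom b n : RestrictedEnveloping k p L) =
      ∑ f ∈ Fintype.piFinset fun i => Finset.range (n i + 1),
        (∏ i, (n i).choose (f i)) • (monom b f ⊗ₜ[k] monom b (n - f)) := by
  have hc (x : L) : Bialgebra.comulAlgHom k (RestrictedEnveloping k p L) (ι k p L x) = ι k p L x ⊗ₜ[k] 1 +
    1 ⊗ₜ[k] ι k p L x := comul_ι k p L x
  change Bialgebra.comulAlgHom k (RestrictedEnveloping k p L) (monom b n) = _
  have h1 (x : RestrictedEnveloping k p L) (m : ℕ) : (x ⊗ₜ[k] (1 : RestrictedEnveloping k p L) +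
      (1 : RestrictedEnveloping k p L) ⊗ₜ[k] x) ^ m =
      ∑ j ∈ Finset.range (m + 1), m.choose j • ((x ^ j) ⊗ₜ[k] (x ^ (m - j))) := by
    rw [add_pow]
    refine Finset.sum_congr rfl fun j _ => ?_
    simp [Algebra.TensorProduct.tmul_pow, mul_comm]
  have h2 (f g : σ → RestrictedEnveloping k p L) :
      ∏ i, (f i ⊗ₜ[k] g i) = (∏ i, f i) ⊗ₜ[k] ∏ i, g i := by
    have h3 (f g : RestrictedEnveloping k p L) : f ⊗ₜ[k] g = (Algebra.TensorProduct.includeLeft :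
        RestrictedEnveloping k p L →ₐ[k] _) f *
        (Algebra.TensorProduct.includeRight : RestrictedEnveloping k p L →ₐ[k] _) g := by simp
    simp only [h3, Finset.prod_mul_distrib, ← map_prod]
  rw [monom, map_prod]
  simp only [map_pow, hc, h1]
  rw [Finset.prod_univ_sum]
  refine Finset.sum_congr rfl fun f _ => ?_
  simp only [Finset.prod_smul, h2]
  rfl

theorem coord_monom [DecidableEq σ] (e : σ → Fin p) {n : σ → ℕ} (hn : ∀ i, n i < p) :
    (monomBasis p b).coord e (monom b n) = if n = (fun i => (e i : ℕ)) then 1 else 0 := by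
  have h : monom b n = monomBasis p b fun i => ⟨n i, hn i⟩ := by simp
  rw [h, Module.Basis.coord_apply, Module.Basis.repr_self, Finsupp.single_apply]
  congr 1
  simp [funext_iff, Fin.ext_iff]

/-- The exponents of the monomial `ι (b i)`. -/
def unitExp [DecidableEq σ] (i j : σ) : Fin p :=
  ⟨(Pi.single i 1 : σ → ℕ) j, by
    have := hp.out.one_lt
    rw [Pi.single_apply]; split_ifs <;> omega⟩

/-- Contraction with the coordinate of `ι (b i)` is the partial derivative with respect to that
variable: a single term of the coproduct survives. -/
theorem contract_monom [DecidableEq σ] (i : σ) {n : σ → ℕ} (hn : ∀ i, n i < p) :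
    HopfExt.contract ((monomBasis p b).coord (unitExp i)) (monom b n) =
      n i • monom b (n - Pi.single i 1) := by
  simp only [HopfExt.contract, LinearMap.comp_apply, comul_monom, map_sum, map_nsmul,
    LinearMap.rTensor_tmul]
  rw [Finset.sum_eq_single (Pi.single i 1)]
  · have h1 : ∏ j, (n j).choose ((Pi.single i 1 : σ → ℕ) j) = n i := by
      rw [Finset.prod_eq_single i] <;> simp +contextual
    rw [h1, coord_monom b _ (n := Pi.single i 1) fun j => (unitExp (p := p) i j).2, if_pos (by rfl)]
    simp
  · intro f hf hfi
    rw [coord_monom b _ (n := f) fun j => ?_, if_neg (c := f = fun j => (unitExp (p := p) i j : ℕ)) hfi]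
    · simp
    · have := Fintype.mem_piFinset.mp hf j
      have := hn j
      simp at *
      omega
  · intro h
    have h0 : n i = 0 := by
      by_contra h0
      refine h (Fintype.mem_piFinset.mpr fun j => ?_)
      rw [Finset.mem_range, Pi.single_apply]
      split_ifs with hj
      · subst hj; omega
      · omega
    rw [Finset.prod_eq_zero (Finset.mem_univ i) (by simp [h0]), zero_smul]

theorem coord_ι [DecidableEq σ] (i : σ) (x : L) :
    (monomBasis p b).coord (unitExp i) (ι k p L x) = b.coord i x := by
  induction x using basis_induction b with
  | zero => simp only [map_zero]
  | add x y hx hy => simp only [map_add, hx, hy]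
  | smul c x hx => simp only [map_smul, hx]
  | coe j =>
    have := coord_monom b (unitExp (p := p) i) (n := Pi.single j 1)
      fun l => (unitExp (p := p) j l).2
    rw [monom_single] at this
    rw [this, Module.Basis.coord_apply, Module.Basis.repr_self, Finsupp.single_apply]
    congr 1
    refine propext ⟨fun h => ?_, fun h => by subst h; rfl⟩
    have := congrFun h j
    by_contra hij
    simp [unitExp, hij] at this

theorem eq_sum_of_mem_primitives {y : RestrictedEnveloping k p L}
    (hy : y ∈ HopfExt.primitives k (RestrictedEnveloping k p L)) [DecidableEq σ] :
    y = ∑ i, (monomBasis p b).coord (unitExp i) y • ι k p L (b i) := by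
  have h1p := hp.out.one_lt
  refine HopfExt.eq_sum_of_mem_primitives (monomBasis p b) (e0 := fun _ => ⟨0, hp.out.pos⟩)
    (by simp [monom]) (fun i => comul_ι k p L (b i)) (fun i => ?_) (fun i j => ?_) (fun e he => ?_)
    hy
  · rw [← monom_zero b, coord_monom b _ (n := 0) fun i => hp.out.pos, if_neg]
    intro h
    simpa [unitExp] using congrFun h i
  · rw [coord_ι, Module.Basis.coord_apply, Module.Basis.repr_self, Finsupp.single_apply]
    simp only [eq_comm]
  -- Differentiate in a variable that occurs. The coefficient `e i` lies strictly between `0` and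
  -- `p`, hence is nonzero in `k`.
  · obtain ⟨i, hi⟩ : ∃ i, (e i : ℕ) ≠ 0 := by
      by_contra! h
      exact he (funext fun i => Fin.ext (h i))
    have hlt (e' : σ → Fin p) (j : σ) :
        ((fun l => (e' l : ℕ)) - Pi.single i 1 : σ → ℕ) j < p :=
      (Nat.sub_le _ _).trans_lt (e' j).2
    refine ⟨i, (monomBasis p b).coord fun j => ⟨_, hlt e j⟩, ?_, fun e' he' => ?_⟩
    · rw [monomBasis_apply, contract_monom b i fun j => (e j).2, map_nsmul,
        coord_monom b _ (hlt e), if_pos rfl, nsmul_eq_mul, mul_one, Ne,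
        CharP.cast_eq_zero_iff k p]
      exact fun h => absurd (Nat.le_of_dvd (by omega) h) (by have := (e i).2; omega)
    · rw [monomBasis_apply, contract_monom b i fun j => (e' j).2, map_nsmul,
        coord_monom b _ (hlt e')]
      split_ifs with h
      -- The subtraction is truncated: two exponents with the same difference are equal unless `e' i
      -- = 0`, and then the coefficient vanishes.
      · suffices h0 : (e' i : ℕ) = 0 by rw [h0, zero_smul]
        by_contra h0
        refine he' (funext fun j => Fin.ext ?_)
        have := congrFun h j
        simp only [Pi.sub_apply, Pi.single_apply] at this
        split_ifs at this with hj
        · subst hj; omega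
        · simpa using this
      · simp

variable (k p L) in
theorem ι_injective [FiniteDimensional k L] : Function.Injective (ι k p L) := by
  classical
  intro x y h
  refine (Module.finBasis k L).ext_elem fun i => ?_
  have := congrArg ((monomBasis p (Module.finBasis k L)).coord (unitExp i)) h
  rwa [coord_ι, coord_ι] at this

variable (k p L) in
/-- The primitive elements of `u(L)` are the elements of `L`. -/
theorem primitives_eq_range [FiniteDimensional k L] :
    (HopfExt.primitives k (RestrictedEnveloping k p L) : Set (RestrictedEnveloping k p L)) =
      Set.range (ι k p L) := by
  classical
  refine Set.Subset.antisymm (fun y hy => ?_) ?_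
  · rw [eq_sum_of_mem_primitives (Module.finBasis k L) hy]
    exact ⟨∑ i, (monomBasis p (Module.finBasis k L)).coord (unitExp i) y •
      Module.finBasis k L i, by simp⟩
  · rintro _ ⟨x, rfl⟩
    exact comul_ι k p L x

variable (k p L) in
theorem finrank_primitives [FiniteDimensional k L] :
    Module.finrank k (HopfExt.primitives k (RestrictedEnveloping k p L)) =
      Module.finrank k L := by
  have h : (HopfExt.primitives k (RestrictedEnveloping k p L)).toSubmodule =
      LinearMap.range (ι k p L : L →ₗ[k] RestrictedEnveloping k p L) :=
    SetLike.coe_injective (primitives_eq_range k p L)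
  change Module.finrank k (HopfExt.primitives k (RestrictedEnveloping k p L)).toSubmodule = _
  rw [h]
  exact LinearMap.finrank_range_of_inj (ι_injective k p L)

variable (k p L) in
theorem finrank_eq [FiniteDimensional k L] :
    Module.finrank k (RestrictedEnveloping k p L) = p ^ Module.finrank k L := by
  rw [Module.finrank_eq_card_basis (monomBasis p (Module.finBasis k L))]
  simp

instance [FiniteDimensional k L] : FiniteDimensional k (RestrictedEnveloping k p L) :=
  (monomBasis p (Module.finBasis k L)).finiteDimensional_of_finite

end RestrictedEnveloping

/-! ### Basis and primitive elements of `B` -/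

section PPolynomial

open Polynomial

variable (k : Type*) (p : ℕ) [Field k] {n : ℕ} (lam : Fin n → k) [hp : Fact p.Prime]

theorem degree_pPolynomial_tail :
    (∑ i : Fin n, C (lam i) * X ^ p ^ (i : ℕ) : k[X]).degree < (p ^ n : ℕ) := by
  refine (Polynomial.degree_sum_le _ _).trans_lt ?_
  rw [Finset.sup_lt_iff (WithBot.bot_lt_coe _)]
  intro i _
  refine (degree_C_mul_X_pow_le _ _).trans_lt ?_
  exact_mod_cast Nat.pow_lt_pow_right hp.out.one_lt i.2

theorem pPolynomial_map_add_C (A : Type*) [CommRing A] [Algebra k A] (Θ : A) :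
    ∃ q : A[X], q.degree < (p ^ n : ℕ) ∧
      (pPolynomial k p lam).map (algebraMap k A) + C Θ = X ^ p ^ n + q := by
  refine ⟨(∑ i : Fin n, C (lam i) * X ^ p ^ (i : ℕ) : k[X]).map (algebraMap k A) + C Θ, ?_, ?_⟩
  · refine (degree_add_le _ _).trans_lt (max_lt ?_ ?_)
    · exact degree_map_le.trans_lt (degree_pPolynomial_tail k p lam)
    · refine degree_C_le.trans_lt ?_
      exact_mod_cast Nat.pow_pos hp.out.pos
  · rw [pPolynomial, Polynomial.map_add, Polynomial.map_pow, map_X, add_assoc]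

theorem monic_pPolynomial_map_add_C (A : Type*) [CommRing A] [Algebra k A] (Θ : A) :
    ((pPolynomial k p lam).map (algebraMap k A) + C Θ).Monic := by
  obtain ⟨q, hq, h⟩ := pPolynomial_map_add_C k p lam A Θ
  rw [h]
  exact monic_X_pow_add hq

theorem natDegree_pPolynomial_map_add_C (A : Type*) [CommRing A] [Nontrivial A] [Algebra k A]
    (Θ : A) : ((pPolynomial k p lam).map (algebraMap k A) + C Θ).natDegree = p ^ n := by
  obtain ⟨q, hq, h⟩ := pPolynomial_map_add_C k p lam A Θ
  rw [h, natDegree_eq_of_degree_eq_some]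
  rw [degree_add_eq_left_of_degree_lt, degree_X_pow]
  rwa [degree_X_pow]

theorem monic_pPolynomial : (pPolynomial k p lam).Monic := by
  have := monic_pPolynomial_map_add_C k p lam k 0
  simpa using this

theorem natDegree_pPolynomial : (pPolynomial k p lam).natDegree = p ^ n := by
  have := natDegree_pPolynomial_map_add_C k p lam k 0
  simpa using this

/-- The basis of the powers of the root in `AdjoinRoot g`, for a monic polynomial `g`. -/
def adjoinRootBasis {R : Type*} [CommRing R] {g : R[X]} (hg : g.Monic) {N : ℕ}
    (hN : g.natDegree = N) : Module.Basis (Fin N) R (AdjoinRoot g) :=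
  (AdjoinRoot.powerBasisAux' hg).reindex (finCongr hN)

theorem adjoinRootBasis_apply {R : Type*} [CommRing R] {g : R[X]} (hg : g.Monic) {N : ℕ}
    (hN : g.natDegree = N) (j : Fin N) :
    adjoinRootBasis hg hN j = AdjoinRoot.root g ^ (j : ℕ) := by
  subst hN
  rw [adjoinRootBasis, Module.Basis.reindex_apply]
  exact (AdjoinRoot.powerBasis' hg).basis_eq_pow j

end PPolynomial

namespace HopfExt

/-- By Lucas' theorem the common last digit `0` in base `p` can be removed from both entries. -/
theorem choose_pow_mul_modEq (p v m : ℕ) [hp : Fact p.Prime] :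
    (p ^ v * m).choose (p ^ v) ≡ m [MOD p] := by
  induction v with
  | zero => simpa using Nat.ModEq.rfl
  | succ v ih =>
    refine Choose.choose_modEq_choose_mod_mul_choose_div_nat.trans ?_
    rw [pow_succ', mul_assoc, Nat.mul_mod_right, Nat.mul_mod_right,
      Nat.mul_div_cancel_left _ hp.out.pos, Nat.mul_div_cancel_left _ hp.out.pos, Nat.choose_self,
      one_mul]
    exact ih

end HopfExt

namespace MonogenicHopf

variable (k : Type*) (p : ℕ) [Field k] {n : ℕ} (lam : Fin n → k) [hp : Fact p.Prime]

/-- The basis of the powers of `z`. -/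
def powerBasis : Module.Basis (Fin (p ^ n)) k (MonogenicHopf k p lam) :=
  adjoinRootBasis (monic_pPolynomial k p lam) (natDegree_pPolynomial k p lam)

@[simp]
theorem powerBasis_apply (j : Fin (p ^ n)) : powerBasis k p lam j = z k p lam ^ (j : ℕ) :=
  adjoinRootBasis_apply _ _ j

variable {k p lam} in
theorem coord_pow (j : Fin (p ^ n)) {m : ℕ} (hm : m < p ^ n) :
    (powerBasis k p lam).coord j (z k p lam ^ m) = if m = j then 1 else 0 := by
  have h : z k p lam ^ m = powerBasis k p lam ⟨m, hm⟩ := by simp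
  rw [h, Module.Basis.coord_apply, Module.Basis.repr_self, Finsupp.single_apply]
  simp [Fin.ext_iff]

/-- The exponent `p^i`. -/
def powIdx (n : ℕ) (i : Fin n) : Fin (p ^ n) := ⟨p ^ (i : ℕ), Nat.pow_lt_pow_right hp.out.one_lt i.2⟩

variable [CharP k p]

variable {k p lam} in
theorem contract_pow (i : Fin n) {m : ℕ} (hm : m < p ^ n) :
    HopfExt.contract ((powerBasis k p lam).coord (powIdx p n i)) (z k p lam ^ m) =
      m.choose (p ^ (i : ℕ)) • z k p lam ^ (m - p ^ (i : ℕ)) := by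
  have hc : Coalgebra.comul (R := k) (z k p lam) = z k p lam ⊗ₜ[k] 1 + 1 ⊗ₜ[k] z k p lam :=
    comul_z k p lam
  rw [HopfExt.contract, LinearMap.comp_apply, LinearMap.comp_apply, Bialgebra.comul_pow, hc,
    add_pow, map_sum, map_sum]
  have h1 (j : ℕ) (hj : j < m + 1) : TensorProduct.lid k (MonogenicHopf k p lam)
      (((powerBasis k p lam).coord (powIdx p n i)).rTensor (MonogenicHopf k p lam)
        ((z k p lam ⊗ₜ[k] (1 : MonogenicHopf k p lam)) ^ j *
          ((1 : MonogenicHopf k p lam) ⊗ₜ[k] z k p lam) ^ (m - j) * (m.choose j : ℕ))) =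
      if j = p ^ (i : ℕ) then m.choose j • z k p lam ^ (m - j) else 0 := by
    rw [Algebra.TensorProduct.tmul_pow, Algebra.TensorProduct.tmul_pow, one_pow, one_pow,
      Algebra.TensorProduct.tmul_mul_tmul, one_mul, mul_one, mul_comm, ← nsmul_eq_mul, map_nsmul,
      map_nsmul, LinearMap.rTensor_tmul, coord_pow _ (by omega), TensorProduct.lid_tmul]
    simp only [powIdx]
    split_ifs with h <;> simp [h]
  refine (Finset.sum_congr rfl fun j hj => h1 j (Finset.mem_range.mp hj)).trans ?_
  rw [Finset.sum_ite_eq']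
  split_ifs with h
  · rfl
  · rw [Nat.choose_eq_zero_of_lt (by simpa using h), zero_smul]

theorem eq_sum_of_mem_primitives {y : MonogenicHopf k p lam}
    (hy : y ∈ HopfExt.primitives k (MonogenicHopf k p lam)) :
    y = ∑ i, (powerBasis k p lam).coord (powIdx p n i) y • z k p lam ^ p ^ (i : ℕ) := by
  refine HopfExt.eq_sum_of_mem_primitives (powerBasis k p lam)
    (e0 := ⟨0, Nat.pow_pos hp.out.pos⟩) (by simp) (fun i => ?_) (fun i => ?_) (fun i j => ?_)
    (fun e he => ?_) hy
  · induction (i : ℕ) with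
    | zero => rw [pow_zero, pow_one]; exact (zPrim k p lam).2
    | succ m ih => rw [pow_succ, pow_mul]; exact HopfExt.pow_mem_primitives p ih
  · rw [← pow_zero (z k p lam), coord_pow _ (Nat.pow_pos hp.out.pos), if_neg]
    exact (Nat.pow_pos hp.out.pos).ne
  · rw [coord_pow _ (m := p ^ (j : ℕ)) (powIdx p n j).2]
    simp [powIdx, Nat.pow_right_inj hp.out.one_lt, Fin.ext_iff, eq_comm]
  · have he0 : (e : ℕ) ≠ 0 := fun h => he (Fin.ext h)
    -- `p^v` is the exact power of `p` dividing `e = p^v m`. Then `e.choose (p^v) ≡ m` is nonzero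
    -- modulo `p`, so the coordinates of the `z^{p^v}` suffice to separate the powers of `z`.
    obtain ⟨v, m, hm, hv⟩ := Nat.exists_eq_pow_mul_and_not_dvd he0 p hp.out.ne_one
    have hle : p ^ v ≤ e := Nat.le_of_dvd (Nat.pos_of_ne_zero he0) ⟨m, hv⟩
    have hvn : v < n := (Nat.pow_lt_pow_iff_right hp.out.one_lt).mp (hle.trans_lt e.2)
    refine ⟨⟨v, hvn⟩, (powerBasis k p lam).coord ⟨e - p ^ v, (Nat.sub_le _ _).trans_lt e.2⟩, ?_,
      fun e' he' => ?_⟩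
    · rw [powerBasis_apply, contract_pow _ e.2, map_nsmul,
        coord_pow _ ((Nat.sub_le _ _).trans_lt e.2), if_pos rfl, nsmul_eq_mul, mul_one, Ne,
        CharP.cast_eq_zero_iff k p]
      intro h
      have := (HopfExt.choose_pow_mul_modEq p v m).dvd_iff dvd_rfl
      rw [← hv] at this
      exact hm (this.mp h)
    · rw [powerBasis_apply, contract_pow _ e'.2, map_nsmul,
        coord_pow _ ((Nat.sub_le _ _).trans_lt e'.2)]
      split_ifs with h
      -- Equal truncated differences with `e' ≠ e` force `e' < p^v`.
      · rw [Nat.choose_eq_zero_of_lt, zero_smul]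
        by_contra hc
        simp only at h hc
        exact he' (Fin.ext (by omega))
      · simp

end MonogenicHopf

/-! ### Structure of the algebra `u(D)` -/

namespace CompatibleDatum

variable {k : Type*} {p : ℕ} {h : Type*} [Field k] [hp : Fact p.Prime] [CharP k p]
  [LieRing h] [LieAlgebra k h] [IsLieAbelian h] [RestrictedLieAlgebra k p h]
  {n : ℕ} {lam : Fin n → k} (D : CompatibleDatum k p h lam)

/-! ### Universal property and induction principle of `u(D)` -/

section UniversalProperty

theorem quotMap_rel {a b : D.Free} (hab : D.Rel a b) : D.quotMap a = D.quotMap b :=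
  RingQuot.mkAlgHom_rel k hab

theorem incl_apply (a : RestrictedEnveloping k p h) : D.incl a = D.quotMap (D.genA a) := rfl

theorem x_mul_incl_sub (a : RestrictedEnveloping k p h) :
    D.x * D.incl a - D.incl a * D.x = D.incl (D.ρz a) := by
  rw [incl_apply, incl_apply, ← D.quotMap_rel (Rel.bracket a), map_sub, map_mul, map_mul]
  rfl

theorem x_mul_incl (a : RestrictedEnveloping k p h) :
    D.x * D.incl a = D.incl a * D.x + D.incl (D.ρz a) := by
  rw [← x_mul_incl_sub]; abel

theorem aeval_x : Polynomial.aeval D.x (pPolynomial k p lam) + D.incl D.Θ = 0 := by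
  have := D.quotMap_rel Rel.top
  rwa [map_add, map_zero, ← Polynomial.aeval_algHom_apply] at this

variable {C : Type*} [Ring C] [Algebra k C]

/-- The universal property of `u(D)`. -/
def lift (φ : RestrictedEnveloping k p h →ₐ[k] C) (c : C)
    (hb : ∀ a, c * φ a - φ a * c = φ (D.ρz a))
    (ht : Polynomial.aeval c (pPolynomial k p lam) + φ D.Θ = 0) : D.u →ₐ[k] C :=
  RingQuot.liftAlgHom k ⟨FreeAlgebra.lift k (Sum.elim φ fun _ => c), by
    intro _ _ hr
    induction hr with
    | add a b => simp
    | mul a b => simp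
    | scalar r => simp
    | bracket a => simpa using hb a
    | top => simpa [← Polynomial.aeval_algHom_apply] using ht⟩

section

variable (φ : RestrictedEnveloping k p h →ₐ[k] C) (c : C)
    (hb : ∀ a, c * φ a - φ a * c = φ (D.ρz a))
    (ht : Polynomial.aeval c (pPolynomial k p lam) + φ D.Θ = 0)

theorem lift_quotMap (a : D.Free) : D.lift φ c hb ht (D.quotMap a) =
    FreeAlgebra.lift k (Sum.elim φ fun _ => c) a :=
  RingQuot.liftAlgHom_mkAlgHom_apply ..

@[simp]
theorem lift_incl (a : RestrictedEnveloping k p h) : D.lift φ c hb ht (D.incl a) = φ a := by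
  rw [incl_apply, lift_quotMap]; simp

@[simp]
theorem lift_x : D.lift φ c hb ht D.x = c := by
  rw [x, lift_quotMap]; simp

end

variable {D} in
theorem induction {q : D.u → Prop} (incl : ∀ a, q (D.incl a)) (x : q D.x)
    (add : ∀ u v, q u → q v → q (u + v)) (mul : ∀ u v, q u → q v → q (u * v)) (u : D.u) : q u := by
  obtain ⟨f, rfl⟩ := RingQuot.mkAlgHom_surjective k D.Rel u
  change q (D.quotMap f)
  induction f using FreeAlgebra.induction with
  | grade0 r => rw [AlgHom.commutes, ← D.incl.commutes]; exact incl _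
  | grade1 a =>
    obtain a | a := a
    · exact incl a
    · exact x
  | mul f g hf hg => rw [map_mul]; exact mul _ _ hf hg
  | add f g hf hg => rw [map_add]; exact add _ _ hf hg

variable {D} in
theorem algHom_ext {f g : D.u →ₐ[k] C} (hi : ∀ a, f (D.incl a) = g (D.incl a))
    (hx : f D.x = g D.x) : f = g := by
  ext u
  induction u using induction with
  | incl a => exact hi a
  | x => exact hx
  | add u v hu hv => rw [map_add, map_add, hu, hv]
  | mul u v hu hv => rw [map_mul, map_mul, hu, hv]

end UniversalProperty

/-! ### The commutative model `A[t]/(f(t) + Θ)` and its derivation -/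

section Representation

open Polynomial

/-- The image of `z^{p^i}` under the representation. -/
theorem toLin_iterate (i : ℕ) : D.ρ.toLin ((RestrictedLieAlgebra.pMap k p)^[i]
    (MonogenicHopf.zPrim k p lam)) = D.ρ.toLin (MonogenicHopf.zPrim k p lam) ^ p ^ i := by
  induction i with
  | zero => simp
  | succ i ih => rw [Function.iterate_succ_apply', D.ρ.map_pMap, ih, ← pow_mul, ← pow_succ]

/-- The relation `f(z) = 0` is a relation in `P(B)` between iterated `p`-maps of `z`. The
representation turns `p`-maps into `p`-th powers. -/
theorem aeval_toLin :
    aeval (D.ρ.toLin (MonogenicHopf.zPrim k p lam)) (pPolynomial k p lam) = 0 := by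
  have h1 (i : ℕ) : (((RestrictedLieAlgebra.pMap k p)^[i] (MonogenicHopf.zPrim k p lam) :
      HopfExt.primitives k (MonogenicHopf k p lam)) : MonogenicHopf k p lam) =
      MonogenicHopf.z k p lam ^ p ^ i := by
    induction i with
    | zero => rw [pow_zero, pow_one]; rfl
    | succ i ih =>
      rw [Function.iterate_succ_apply']
      change (_ : MonogenicHopf k p lam) ^ p = _
      rw [ih, ← pow_mul, ← pow_succ]
  have h2 : (RestrictedLieAlgebra.pMap k p)^[n] (MonogenicHopf.zPrim k p lam) +
      ∑ i : Fin n, lam i • (RestrictedLieAlgebra.pMap k p)^[(i : ℕ)]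
        (MonogenicHopf.zPrim k p lam) = 0 := by
    refine Subtype.ext ?_
    have := MonogenicHopf.aeval_z k p lam
    rw [MonogenicHopf.aeval_pPolynomial] at this
    simp only [← h1] at this
    change (HopfExt.primitives k (MonogenicHopf k p lam)).incl (_ + _) = 0
    rw [map_add, map_sum]
    simp only [map_smul]
    exact this
  have h3 := congrArg D.ρ.toLin h2
  simpa [toLin_iterate, MonogenicHopf.aeval_pPolynomial] using h3

theorem aeval_ρz_ι (v : h) :
    aeval (D.ρz : Module.End k (RestrictedEnveloping k p h)) (pPolynomial k p lam)
      (RestrictedEnveloping.ι k p h v) = 0 := by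
  have h1 (j : ℕ) : ((D.ρz : Module.End k (RestrictedEnveloping k p h)) ^ j)
      (RestrictedEnveloping.ι k p h v) = RestrictedEnveloping.ι k p h
        ((D.ρ.toLin (MonogenicHopf.zPrim k p lam) ^ j) v) := by
    induction j with
    | zero => rfl
    | succ j ih =>
      rw [pow_succ', pow_succ', Module.End.mul_apply, ih, Module.End.mul_apply]
      exact D.ρ.derivation_ι _ _
  have h2 := LinearMap.congr_fun D.aeval_toLin v
  rw [MonogenicHopf.aeval_pPolynomial] at h2 ⊢
  simp only [LinearMap.add_apply, LinearMap.sum_apply, LinearMap.smul_apply, h1] at h2 ⊢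
  rw [← map_zero (RestrictedEnveloping.ι k p h), ← LinearMap.zero_apply (σ₁₂ := RingHom.id k) v,
    ← h2]
  simp

/-- The polynomial `f(t) + Θ` over `A`. -/
def poly : (RestrictedEnveloping k p h)[X] :=
  (pPolynomial k p lam).map (algebraMap k (RestrictedEnveloping k p h)) + C D.Θ

/-- The `A`-module on which `u(D)` is represented, as a commutative algebra: `A[t]/(f(t) + Θ)`. -/
abbrev Model : Type _ := AdjoinRoot D.poly

/-- The map from `A` to the model. -/
def toModel : RestrictedEnveloping k p h →ₐ[k] D.Model :=
  AdjoinRoot.ofAlgHom k D.poly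

/-- The generator `t` of the model. -/
def t : D.Model := AdjoinRoot.root D.poly

theorem eval₂_poly {C : Type*} [CommRing C] [Algebra k C] (φ : RestrictedEnveloping k p h →ₐ[k] C)
    (c : C) : D.poly.eval₂ φ c = aeval c (pPolynomial k p lam) + φ D.Θ := by
  have : ((φ : RestrictedEnveloping k p h →+* C)).comp (algebraMap k _) = algebraMap k C :=
    φ.comp_algebraMap
  rw [poly, eval₂_add, eval₂_map, eval₂_C, aeval_def, ← this]
  rfl

theorem aeval_t : aeval D.t (pPolynomial k p lam) + D.toModel D.Θ = 0 := by
  rw [← eval₂_poly]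
  exact AdjoinRoot.eval₂_root _

theorem model_induction {q : D.Model → Prop} (ι : ∀ v, q (D.toModel (RestrictedEnveloping.ι k p h v)))
    (scalar : ∀ r : k, q (algebraMap k _ r)) (t : q D.t) (add : ∀ u v, q u → q v → q (u + v))
    (mul : ∀ u v, q u → q v → q (u * v)) (r : D.Model) : q r := by
  have hA (a : RestrictedEnveloping k p h) : q (D.toModel a) := by
    induction a using RestrictedEnveloping.induction with
    | hal r => rw [AlgHom.commutes]; exact scalar r
    | hι v => exact ι v
    | hadd a b ha hb => rw [map_add]; exact add _ _ ha hb
    | hmul a b ha hb => rw [map_mul]; exact mul _ _ ha hb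
  obtain ⟨f, rfl⟩ := AdjoinRoot.mk_surjective r
  induction f using Polynomial.induction_on with
  | C a => exact hA a
  | add f g hf hg => rw [map_add]; exact add _ _ hf hg
  | monomial m a hf =>
    rw [pow_succ, ← mul_assoc, map_mul]
    exact mul _ _ hf t

theorem model_algHom_ext {C : Type*} [Semiring C] [Algebra k C] {f g : D.Model →ₐ[k] C}
    (hi : ∀ a, f (D.toModel a) = g (D.toModel a)) (ht : f D.t = g D.t) : f = g := by
  refine AlgHom.ext fun r => ?_
  induction r using D.model_induction with
  | ι v => exact hi _
  | scalar r => simp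
  | t => exact ht
  | add u v hu hv => rw [map_add, map_add, hu, hv]
  | mul u v hu hv => rw [map_mul, map_mul, hu, hv]

/-- The map `a ↦ a + ε ρ_z(a)` on `A`. -/
def inclTriv : RestrictedEnveloping k p h →ₐ[k] TrivSqZeroExt D.Model D.Model :=
  AlgHom.ofLinearMap
    ((TrivSqZeroExt.inlAlgHom k D.Model D.Model).toLinearMap ∘ₗ D.toModel.toLinearMap +
      (TrivSqZeroExt.inrHom D.Model D.Model).restrictScalars k ∘ₗ D.toModel.toLinearMap ∘ₗ
        D.ρz.toLinearMap)
    (by ext <;> simp)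
    (fun a b => by ext <;> simp [mul_comm, add_comm])

theorem inclTriv_apply (a : RestrictedEnveloping k p h) : D.inclTriv a =
    TrivSqZeroExt.inl (D.toModel a) + TrivSqZeroExt.inr (D.toModel (D.ρz a)) := rfl

/-- The map `r ↦ r + ε ∂(r)` on the model. -/
def modelTriv : D.Model →ₐ[k] TrivSqZeroExt D.Model D.Model :=
  AdjoinRoot.liftAlgHom D.poly D.inclTriv (TrivSqZeroExt.inl D.t) (by
    have h1 : aeval (TrivSqZeroExt.inl D.t : TrivSqZeroExt D.Model D.Model)
        (pPolynomial k p lam) = TrivSqZeroExt.inl (aeval D.t (pPolynomial k p lam)) :=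
      aeval_algHom_apply (TrivSqZeroExt.inlAlgHom k D.Model D.Model) _ _
    -- With `t` sent to itself, the relation `f(t) + Θ = 0` is respected because `ρ_z` kills `Θ`.
    have h2 : D.ρz D.Θ = 0 := D.ρ_Θ
    refine (D.eval₂_poly D.inclTriv _).trans ?_
    rw [h1, inclTriv_apply, h2, map_zero, TrivSqZeroExt.inr_zero, add_zero,
      ← TrivSqZeroExt.inl_add, aeval_t, TrivSqZeroExt.inl_zero])

theorem modelTriv_toModel (a : RestrictedEnveloping k p h) : D.modelTriv (D.toModel a) =
    TrivSqZeroExt.inl (D.toModel a) + TrivSqZeroExt.inr (D.toModel (D.ρz a)) := by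
  rw [← inclTriv_apply]
  exact AdjoinRoot.liftAlgHom_of ..

theorem modelTriv_t : D.modelTriv D.t = TrivSqZeroExt.inl D.t := AdjoinRoot.liftAlgHom_root ..

theorem fst_modelTriv (r : D.Model) : (D.modelTriv r).fst = r := by
  have : (TrivSqZeroExt.fstHom k D.Model D.Model).comp D.modelTriv = AlgHom.id k _ :=
    D.model_algHom_ext (fun a => by simp [modelTriv_toModel]) (by simp [modelTriv_t])
  exact congrArg (fun f => f r) this

/-- The derivation of the model which extends `ρ_z` and vanishes on `t`. -/
def modelDer : D.Model →ₗ[k] D.Model :=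
  (TrivSqZeroExt.sndHom D.Model D.Model).restrictScalars k ∘ₗ D.modelTriv.toLinearMap

theorem modelDer_mul (r s : D.Model) :
    D.modelDer (r * s) = D.modelDer r * s + r * D.modelDer s := by
  simp [modelDer, fst_modelTriv, mul_comm, add_comm]

theorem modelDer_toModel (a : RestrictedEnveloping k p h) :
    D.modelDer (D.toModel a) = D.toModel (D.ρz a) := by
  simp [modelDer, modelTriv_toModel]

theorem modelDer_t : D.modelDer D.t = 0 := by
  simp [modelDer, modelTriv_t]

theorem modelDer_one : D.modelDer 1 = 0 := by
  rw [← map_one D.toModel, modelDer_toModel]; simp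

end Representation

end CompatibleDatum

namespace CompatibleDatum

variable {k : Type*} {p : ℕ} {h : Type*} [Field k] [hp : Fact p.Prime] [CharP k p]
  [LieRing h] [LieAlgebra k h] [IsLieAbelian h] [RestrictedLieAlgebra k p h]
  {n : ℕ} {lam : Fin n → k} (D : CompatibleDatum k p h lam)

/-! ### The representation on the model and the normal form `∑ a_j x^j` -/

section ModuleStructure

open Polynomial

theorem lmul_model_apply (r s : D.Model) : Algebra.lmul k D.Model r s = r * s := rfl

theorem modelDer_lmul (r : D.Model) :
    D.modelDer * Algebra.lmul k D.Model r - Algebra.lmul k D.Model r * D.modelDer =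
      Algebra.lmul k D.Model (D.modelDer r) := by
  ext s
  simp [modelDer_mul]

/-- In characteristic `p` the `p^m`-th power of a derivation is a derivation, so a `p`-polynomial in
`∂` is one too. Its vanishing can therefore be checked on generators. -/
theorem aeval_modelDer_mul (r s : D.Model) :
    aeval (D.modelDer : Module.End k D.Model) (pPolynomial k p lam) (r * s) =
      aeval (D.modelDer : Module.End k D.Model) (pPolynomial k p lam) r * s +
        r * aeval (D.modelDer : Module.End k D.Model) (pPolynomial k p lam) s := by
  have h1 (m : ℕ) : ((D.modelDer : Module.End k D.Model) ^ p ^ m) (r * s) =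
      ((D.modelDer : Module.End k D.Model) ^ p ^ m) r * s +
        r * ((D.modelDer : Module.End k D.Model) ^ p ^ m) s := by
    -- The Leibniz rule says that bracketing with `∂` sends multiplication by `r` to multiplication
    -- by `∂ r`; `innerDer_pow` transfers this to `∂^{p^m}`.
    have h2 := HopfExt.innerDer_iterate (X := (D.modelDer : Module.End k D.Model))
      (ψ := Algebra.lmul k D.Model) (d := D.modelDer) D.modelDer_lmul (p ^ m) r
    rw [HopfExt.innerDer_pow, HopfExt.innerDer_apply] at h2
    have h3 := LinearMap.congr_fun h2 s
    simp only [LinearMap.sub_apply, Module.End.mul_apply, lmul_model_apply] at h3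
    rw [← h3]
    abel
  simp only [MonogenicHopf.aeval_pPolynomial, LinearMap.add_apply, LinearMap.sum_apply,
    LinearMap.smul_apply, h1, smul_add, Finset.sum_add_distrib, add_mul, mul_add, Finset.sum_mul,
    Finset.mul_sum, smul_mul_assoc, mul_smul_comm]
  abel

theorem modelDer_pow_toModel (j : ℕ) (a : RestrictedEnveloping k p h) :
    ((D.modelDer : Module.End k D.Model) ^ j) (D.toModel a) =
      D.toModel (((D.ρz : Module.End k (RestrictedEnveloping k p h)) ^ j) a) := by
  induction j with
  | zero => rfl
  | succ j ih =>
    rw [pow_succ', pow_succ', Module.End.mul_apply, ih, Module.End.mul_apply]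
    exact D.modelDer_toModel _

theorem aeval_modelDer_eq_zero_of {r : D.Model} (hr : D.modelDer r = 0) :
    aeval (D.modelDer : Module.End k D.Model) (pPolynomial k p lam) r = 0 := by
  have h1 (m : ℕ) : ((D.modelDer : Module.End k D.Model) ^ p ^ m) r = 0 := by
    obtain ⟨q, hq⟩ := Nat.exists_eq_add_one.mpr (Nat.pow_pos (n := m) hp.out.pos)
    rw [hq, pow_succ, Module.End.mul_apply, hr, map_zero]
  simp [MonogenicHopf.aeval_pPolynomial, h1]

theorem aeval_modelDer :
    aeval (D.modelDer : Module.End k D.Model) (pPolynomial k p lam) = 0 := by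
  refine LinearMap.ext fun r => ?_
  rw [LinearMap.zero_apply]
  induction r using D.model_induction with
  | ι v =>
    have := congrArg D.toModel (D.aeval_ρz_ι v)
    rw [map_zero] at this
    rw [← this]
    simp only [MonogenicHopf.aeval_pPolynomial, LinearMap.add_apply, LinearMap.sum_apply,
      LinearMap.smul_apply, modelDer_pow_toModel, map_add, map_sum, map_smul]
  | scalar r =>
    refine D.aeval_modelDer_eq_zero_of ?_
    rw [Algebra.algebraMap_eq_smul_one, map_smul, modelDer_one, smul_zero]
  | t => exact D.aeval_modelDer_eq_zero_of D.modelDer_t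
  | add u v hu hv => rw [map_add, hu, hv, add_zero]
  | mul u v hu hv => rw [aeval_modelDer_mul, hu, hv]; simp

/-- The action of `x` on the model. -/
def xEnd : Module.End k D.Model := Algebra.lmul k D.Model D.t + D.modelDer

theorem xEnd_apply (r : D.Model) : D.xEnd r = D.t * r + D.modelDer r := rfl

/-- The representation of `u(D)` on the model: `A` acts by multiplication, and `x` acts as
`t + ∂`. -/
def rep : D.u →ₐ[k] Module.End k D.Model :=
  D.lift ((Algebra.lmul k D.Model).comp D.toModel) D.xEnd
    (fun a => by
      refine LinearMap.ext fun r => ?_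
      simp only [AlgHom.comp_apply, LinearMap.sub_apply, Module.End.mul_apply, xEnd_apply,
        lmul_model_apply, modelDer_mul, modelDer_toModel]
      ring)
    (by
      -- Since `∂ t = 0`, multiplication by `t` commutes with `∂`. Hence `f(t + ∂) = f(t) + f(∂) =
      -- f(t)`, and `f(t) = -Θ`.
      have hc : Commute (Algebra.lmul k D.Model D.t) (D.modelDer : Module.End k D.Model) := by
        have := D.modelDer_lmul D.t
        rw [modelDer_t, map_zero, sub_eq_zero] at this
        exact this.symm
      rw [xEnd, MonogenicHopf.aeval_add_of_commute k p lam hc, aeval_modelDer, add_zero,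
        aeval_algHom_apply, AlgHom.comp_apply, ← map_add, aeval_t, map_zero])

theorem rep_incl (a : RestrictedEnveloping k p h) (r : D.Model) :
    D.rep (D.incl a) r = D.toModel a * r := by
  rw [rep, lift_incl]; rfl

/-- The second part carries the induction: `x` acts on `t^j` as plain multiplication by `t`. -/
theorem rep_x_pow_one (j : ℕ) : D.rep (D.x ^ j) 1 = D.t ^ j ∧ D.modelDer (D.t ^ j) = 0 := by
  induction j with
  | zero => simp [modelDer_one]
  | succ j ih =>
    have h1 : D.modelDer (D.t ^ (j + 1)) = 0 := by
      rw [pow_succ, modelDer_mul, ih.2, modelDer_t]; simp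
    refine ⟨?_, h1⟩
    rw [pow_succ', map_mul, Module.End.mul_apply, ih.1, rep, lift_x, xEnd_apply, ih.2, add_zero,
      pow_succ']

/-- The linear map `(a_j) ↦ ∑ a_j x^j`. -/
def ofCoeffs : (Fin (p ^ n) → RestrictedEnveloping k p h) →ₗ[k] D.u :=
  ∑ j : Fin (p ^ n), LinearMap.mulRight k (D.x ^ (j : ℕ)) ∘ₗ D.incl.toLinearMap ∘ₗ
    LinearMap.proj j

theorem ofCoeffs_apply (c : Fin (p ^ n) → RestrictedEnveloping k p h) :
    D.ofCoeffs c = ∑ j, D.incl (c j) * D.x ^ (j : ℕ) := by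
  simp [ofCoeffs]

theorem ofCoeffs_single (j : Fin (p ^ n)) (a : RestrictedEnveloping k p h) :
    D.ofCoeffs (Pi.single j a) = D.incl a * D.x ^ (j : ℕ) := by
  rw [ofCoeffs_apply, Finset.sum_eq_single j] <;> simp +contextual

instance : Nontrivial (RestrictedEnveloping k p h) :=
  (Bialgebra.counitAlgHom k (RestrictedEnveloping k p h)).toRingHom.domain_nontrivial

theorem ofCoeffs_injective : Function.Injective D.ofCoeffs := by
  let β := adjoinRootBasis (monic_pPolynomial_map_add_C k p lam _ D.Θ)
    (natDegree_pPolynomial_map_add_C k p lam _ D.Θ)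
  -- Acting on `1` turns `∑ a_j x^j` into `∑ a_j t^j`, and the powers of `t` below `p^n` are an
  -- `A`-basis of the model because `f(t) + Θ` is monic of that degree.
  have h1 (c) : D.rep (D.ofCoeffs c) 1 = β.equivFun.symm c := by
    rw [ofCoeffs_apply, map_sum, LinearMap.sum_apply, Module.Basis.equivFun_symm_apply]
    refine Finset.sum_congr rfl fun j _ => ?_
    rw [map_mul, Module.End.mul_apply, (D.rep_x_pow_one j).1, rep_incl, adjoinRootBasis_apply,
      Algebra.smul_def]
    rfl
  intro c c' hc
  refine β.equivFun.symm.injective ?_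
  rw [← h1, ← h1, hc]

theorem mul_x_pow_mem (a : RestrictedEnveloping k p h) {j : ℕ} (hj : j < p ^ n) :
    D.incl a * D.x ^ j ∈ LinearMap.range D.ofCoeffs :=
  ⟨Pi.single ⟨j, hj⟩ a, D.ofCoeffs_single _ _⟩

theorem ofCoeffs_surjective : Function.Surjective D.ofCoeffs := by
  have hind (q : D.u → Prop) (hs : ∀ a j, j < p ^ n → q (D.incl a * D.x ^ j)) (h0 : q 0)
      (hadd : ∀ u v, q u → q v → q (u + v)) : ∀ w ∈ LinearMap.range D.ofCoeffs, q w := by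
    rintro _ ⟨c, rfl⟩
    rw [ofCoeffs_apply]
    exact Finset.sum_induction _ q hadd h0 fun j _ => hs _ _ j.2
  have htop : D.x ^ p ^ n = -(∑ i : Fin n, lam i • D.x ^ p ^ (i : ℕ)) - D.incl D.Θ := by
    have := D.aeval_x
    rw [MonogenicHopf.aeval_pPolynomial, add_assoc, add_eq_zero_iff_eq_neg] at this
    rw [this]; abel
  -- The range is a left ideal, and it contains `1`.
  have hmul (u : D.u) : ∀ w ∈ LinearMap.range D.ofCoeffs, u * w ∈ LinearMap.range D.ofCoeffs := by
    induction u using induction with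
    | add u v hu hv => intro w hw; rw [add_mul]; exact add_mem (hu w hw) (hv w hw)
    | mul u v hu hv => intro w hw; rw [mul_assoc]; exact hu _ (hv w hw)
    | incl a =>
      refine hind _ (fun b j hj => ?_) (by simp) fun u v hu hv => by
        rw [mul_add]; exact add_mem hu hv
      rw [← mul_assoc, ← map_mul]
      exact D.mul_x_pow_mem _ hj
    | x =>
      refine hind _ (fun b j hj => ?_) (by simp) fun u v hu hv => by
        rw [mul_add]; exact add_mem hu hv
      rw [← mul_assoc, x_mul_incl, add_mul, mul_assoc, ← pow_succ']
      refine add_mem ?_ (D.mul_x_pow_mem _ hj)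
      -- Only the product with `x^{p^n - 1}` leaves the range of exponents; the top relation brings
      -- it back.
      obtain hj' | hj' := (Nat.succ_le_of_lt hj).lt_or_eq
      · exact D.mul_x_pow_mem _ hj'
      · rw [show j + 1 = p ^ n from hj', htop, mul_sub, mul_neg, Finset.mul_sum]
        refine sub_mem (neg_mem (sum_mem fun i _ => ?_)) ?_
        · rw [mul_smul_comm]
          exact Submodule.smul_mem _ _ (D.mul_x_pow_mem _ (Nat.pow_lt_pow_right hp.out.one_lt i.2))
        · rw [← map_mul]
          simpa using D.mul_x_pow_mem (b * D.Θ) (Nat.pow_pos hp.out.pos)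
  intro u
  have h1 : (1 : D.u) ∈ LinearMap.range D.ofCoeffs := by
    simpa using D.mul_x_pow_mem 1 (Nat.pow_pos hp.out.pos)
  have := hmul u 1 h1
  rwa [mul_one] at this

/-- Every element of `u(D)` is `∑ a_j x^j` with unique `a_j ∈ A`, `j < p^n`. -/
def coeffEquiv : (Fin (p ^ n) → RestrictedEnveloping k p h) ≃ₗ[k] D.u :=
  LinearEquiv.ofBijective D.ofCoeffs ⟨D.ofCoeffs_injective, D.ofCoeffs_surjective⟩

/-- The coefficient `a_0` of `∑ a_j x^j`. -/
def constCoeff : D.u →ₗ[k] RestrictedEnveloping k p h :=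
  LinearMap.proj ⟨0, Nat.pow_pos hp.out.pos⟩ ∘ₗ D.coeffEquiv.symm.toLinearMap

theorem coeffEquiv_symm_apply (a : RestrictedEnveloping k p h) {j : ℕ} (hj : j < p ^ n) :
    D.coeffEquiv.symm (D.incl a * D.x ^ j) = Pi.single ⟨j, hj⟩ a := by
  rw [LinearEquiv.symm_apply_eq]
  exact (D.ofCoeffs_single ⟨j, hj⟩ a).symm

theorem constCoeff_apply (a : RestrictedEnveloping k p h) {j : ℕ} (hj : j < p ^ n) :
    D.constCoeff (D.incl a * D.x ^ j) = if j = 0 then a else 0 := by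
  rw [constCoeff, LinearMap.comp_apply, LinearEquiv.coe_coe, D.coeffEquiv_symm_apply a hj,
    LinearMap.proj_apply, Pi.single_apply]
  simp [Fin.ext_iff, eq_comm]

theorem incl_injective : Function.Injective D.incl := fun a b hab => by
  have hpos : 0 < p ^ n := Nat.pow_pos hp.out.pos
  have := congrArg D.constCoeff hab
  rw [← mul_one (D.incl a), ← mul_one (D.incl b), ← pow_zero D.x, constCoeff_apply _ _ hpos,
    constCoeff_apply _ _ hpos] at this
  simpa using this

theorem finrank_u [FiniteDimensional k h] : Module.finrank k D.u =
    p ^ (Module.finrank k (HopfExt.primitives k (RestrictedEnveloping k p h)) + n) := by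
  rw [← D.coeffEquiv.finrank_eq, Module.finrank_pi_fintype]
  simp [RestrictedEnveloping.finrank_eq, RestrictedEnveloping.finrank_primitives, pow_add, mul_comm]

end ModuleStructure

end CompatibleDatum

/-! ### The Hopf algebra structure of `u(D)` -/

namespace Cobar

/-- This is how `χ ∈ A⁺ ⊗ A⁺` is used: the contribution of `χ` dies as soon as one tensor factor is
mapped by the counit, or by `π` restricted to `A`. -/
theorem map_eq_zero_of_augSq {k A M N : Type*} [Field k] [Ring A] [Bialgebra k A]
    [AddCommGroup M] [Module k M] [AddCommGroup N] [Module k N] {f : A →ₗ[k] M} {g : A →ₗ[k] N}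
    (hfg : (∀ a ∈ augIdeal k A, f a = 0) ∨ ∀ a ∈ augIdeal k A, g a = 0) {c : A ⊗[k] A}
    (hc : c ∈ augSq k A) : TensorProduct.map f g c = 0 := by
  obtain ⟨t, rfl⟩ := hc
  induction t with
  | zero => simp
  | add x y hx hy => rw [map_add, map_add, hx, hy, add_zero]
  | tmul a b =>
    rw [TensorProduct.map_tmul, TensorProduct.map_tmul]
    obtain h | h := hfg
    · rw [Submodule.subtype_apply, h _ a.2, TensorProduct.zero_tmul]
    · rw [Submodule.subtype_apply, Submodule.subtype_apply, h _ b.2, TensorProduct.tmul_zero]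

end Cobar

namespace CompatibleDatum

open Polynomial TensorProduct

variable {k : Type*} {p : ℕ} {h : Type*} [Field k] [hp : Fact p.Prime] [CharP k p]
  [LieRing h] [LieAlgebra k h] [IsLieAbelian h] [RestrictedLieAlgebra k p h]
  {n : ℕ} {lam : Fin n → k} (D : CompatibleDatum k p h lam)

section Comul

/-- The map `A ⊗ A → u(D) ⊗ u(D)`. -/
def inclSq : RestrictedEnveloping k p h ⊗[k] RestrictedEnveloping k p h →ₐ[k] D.u ⊗[k] D.u :=
  Algebra.TensorProduct.map D.incl D.incl

@[simp]
theorem inclSq_tmul (a b : RestrictedEnveloping k p h) :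
    D.inclSq (a ⊗ₜ b) = D.incl a ⊗ₜ D.incl b := rfl

/-- The element `x ⊗ 1 + 1 ⊗ x`. -/
def xSq : D.u ⊗[k] D.u := D.x ⊗ₜ 1 + 1 ⊗ₜ D.x

/-- This supplies the hypothesis of `Cobar.add_pow_eq_opD` and `Cobar.aeval_add_eq_opPhi` for the
element `x ⊗ 1 + 1 ⊗ x`. -/
theorem xSq_mul_inclSq (c : RestrictedEnveloping k p h ⊗[k] RestrictedEnveloping k p h) :
    D.xSq * D.inclSq c - D.inclSq c * D.xSq = D.inclSq (Cobar.act D.ρz.toLinearMap c) := by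
  induction c with
  | zero => simp
  | add c d hc hd => simp only [map_add, mul_add, add_mul, ← hc, ← hd]; abel
  | tmul a b =>
    simp only [xSq, inclSq_tmul, add_mul, mul_add, Algebra.TensorProduct.tmul_mul_tmul, one_mul,
      mul_one, x_mul_incl, add_tmul, tmul_add, Cobar.act, LinearMap.add_apply,
      LinearMap.rTensor_tmul, LinearMap.lTensor_tmul, map_add]
    have hρ (a : RestrictedEnveloping k p h) : D.ρz.toLinearMap a = D.ρz a := rfl
    simp only [hρ]
    abel

theorem aeval_xSq : aeval D.xSq (pPolynomial k p lam) =
    -(D.inclSq (D.Θ ⊗ₜ 1) + D.inclSq (1 ⊗ₜ D.Θ)) := by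
  have hc : Commute (D.x ⊗ₜ[k] (1 : D.u)) ((1 : D.u) ⊗ₜ[k] D.x) := by simp [commute_iff_eq]
  have h0 := eq_neg_of_add_eq_zero_left D.aeval_x
  have h1 := aeval_algHom_apply (Algebra.TensorProduct.includeLeft : D.u →ₐ[k] D.u ⊗[k] D.u)
    D.x (pPolynomial k p lam)
  have h2 := aeval_algHom_apply (Algebra.TensorProduct.includeRight : D.u →ₐ[k] D.u ⊗[k] D.u)
    D.x (pPolynomial k p lam)
  rw [h0] at h1 h2
  simp only [Algebra.TensorProduct.includeLeft_apply,
    Algebra.TensorProduct.includeRight_apply] at h1 h2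
  rw [xSq, MonogenicHopf.aeval_add_of_commute k p lam hc, h1, h2]
  simp [neg_tmul, tmul_neg]
  abel

/-- The comultiplication of `u(D)`. -/
def comul : D.u →ₐ[k] D.u ⊗[k] D.u :=
  D.lift (D.inclSq.comp (Bialgebra.comulAlgHom k _)) (D.xSq + D.inclSq D.χ)
    (fun a => by
      have h1 := D.ρ.comul_derivation (MonogenicHopf.zPrim k p lam) a
      have h2 := D.xSq_mul_inclSq (Coalgebra.comul (R := k) a)
      -- `A ⊗ A` is commutative, so adding `χ` does not change the brackets with the `Δ(a)`.
      have h3 : D.inclSq D.χ * D.inclSq (Coalgebra.comul (R := k) a) =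
          D.inclSq (Coalgebra.comul (R := k) a) * D.inclSq D.χ := by
        rw [← map_mul, mul_comm, map_mul]
      simp only [AlgHom.comp_apply, Bialgebra.comulAlgHom_apply]
      refine Eq.trans ?_ (h2.trans (congrArg D.inclSq h1.symm))
      rw [add_mul, mul_add, h3]
      abel)
    (by
      -- The value is `-(Θ ⊗ 1 + 1 ⊗ Θ) + Φ(χ)`. As `Φ(χ) = d¹(Θ) = Θ ⊗ 1 + 1 ⊗ Θ - Δ(Θ)`, only
      -- `-Δ(Θ)` is left.
      rw [Cobar.aeval_add_eq_opPhi lam D.xSq_mul_inclSq]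
      have h1 : Cobar.opPhi p lam D.ρz.toLinearMap D.χ = _ := D.Φ_χ
      rw [h1, Cobar.d1_apply, aeval_xSq, AlgHom.comp_apply, Bialgebra.comulAlgHom_apply]
      simp only [map_sub, map_add]
      abel)

theorem comul_incl (a : RestrictedEnveloping k p h) :
    D.comul (D.incl a) = D.inclSq (Coalgebra.comul (R := k) a) := by
  rw [comul, lift_incl]; rfl

theorem comul_x : D.comul D.x = D.x ⊗ₜ 1 + 1 ⊗ₜ D.x + D.inclSq D.χ := by
  rw [comul, lift_x, xSq]

/-- The counit of `u(D)`. -/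
def counit : D.u →ₐ[k] k :=
  D.lift (Bialgebra.counitAlgHom k _) 0
    (fun a => by
      have h1 : Coalgebra.counit (R := k) (D.ρz a) = 0 := D.ρ.counit_derivation _ a
      simp [h1])
    (by
      have h1 : Coalgebra.counit (R := k) D.Θ = 0 := D.Θ_mem
      simp [MonogenicHopf.aeval_pPolynomial, hp.out.ne_zero, h1])

theorem counit_incl (a : RestrictedEnveloping k p h) :
    D.counit (D.incl a) = Coalgebra.counit (R := k) a := by
  rw [counit, lift_incl]; rfl

theorem counit_x : D.counit D.x = 0 := by
  rw [counit, lift_x]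

/-- The map `A ⊗ (A ⊗ A) → u(D) ⊗ (u(D) ⊗ u(D))`. -/
def inclCube : RestrictedEnveloping k p h ⊗[k]
    (RestrictedEnveloping k p h ⊗[k] RestrictedEnveloping k p h) →ₐ[k]
      D.u ⊗[k] (D.u ⊗[k] D.u) :=
  Algebra.TensorProduct.map D.incl D.inclSq

theorem assoc_inclSq_tmul (c : RestrictedEnveloping k p h ⊗[k] RestrictedEnveloping k p h)
    (b : RestrictedEnveloping k p h) : Algebra.TensorProduct.assoc k k k D.u D.u D.u
      (D.inclSq c ⊗ₜ D.incl b) = D.inclCube (Algebra.TensorProduct.assoc k k k _ _ _ (c ⊗ₜ b)) := by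
  induction c with
  | zero => simp
  | add c d hc hd => simp only [map_add, add_tmul, hc, hd]
  | tmul a a' => simp [inclCube]

theorem assoc_comul_inclSq (c : RestrictedEnveloping k p h ⊗[k] RestrictedEnveloping k p h) :
    Algebra.TensorProduct.assoc k k k D.u D.u D.u
      (Algebra.TensorProduct.map D.comul (.id k D.u) (D.inclSq c)) =
    D.inclCube (Algebra.TensorProduct.assoc k k k _ _ _
      (Algebra.TensorProduct.map (Bialgebra.comulAlgHom k _) (.id k _) c)) := by
  induction c with
  | zero => simp
  | add c d hc hd => simp only [map_add, hc, hd]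
  | tmul a b =>
    rw [inclSq_tmul, Algebra.TensorProduct.map_tmul, comul_incl, AlgHom.id_apply,
      assoc_inclSq_tmul]
    rfl

theorem lcomul_inclSq (c : RestrictedEnveloping k p h ⊗[k] RestrictedEnveloping k p h) :
    Algebra.TensorProduct.map (.id k D.u) D.comul (D.inclSq c) =
    D.inclCube (Algebra.TensorProduct.map (.id k _) (Bialgebra.comulAlgHom k _) c) := by
  induction c with
  | zero => simp
  | add c d hc hd => simp only [map_add, hc, hd]
  | tmul a b =>
    rw [inclSq_tmul, Algebra.TensorProduct.map_tmul, comul_incl, AlgHom.id_apply]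
    rfl

theorem comul_coassoc : (Algebra.TensorProduct.assoc k k k D.u D.u D.u).toAlgHom.comp
    ((Algebra.TensorProduct.map D.comul (.id k D.u)).comp D.comul) =
    (Algebra.TensorProduct.map (.id k D.u) D.comul).comp D.comul := by
  refine algHom_ext (fun a => ?_) ?_
  · change Algebra.TensorProduct.assoc k k k D.u D.u D.u
      (Algebra.TensorProduct.map D.comul (.id k D.u) (D.comul (D.incl a))) =
      Algebra.TensorProduct.map (.id k D.u) D.comul (D.comul (D.incl a))
    rw [comul_incl, assoc_comul_inclSq, lcomul_inclSq]
    exact congrArg D.inclCube (Coalgebra.coassoc_apply a)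
  · change Algebra.TensorProduct.assoc k k k D.u D.u D.u
      (Algebra.TensorProduct.map D.comul (.id k D.u) (D.comul D.x)) =
      Algebra.TensorProduct.map (.id k D.u) D.comul (D.comul D.x)
    -- On `x` the primitive parts agree, and the two sides differ by the image of `d²(χ)`.
    have h0 : Cobar.d2 k _ D.χ = 0 := D.χ_mem.2
    have h1 := sub_eq_zero.mp ((Cobar.d2_eq D.χ).symm.trans h0)
    have h2 := congrArg D.inclCube h1
    rw [map_add, map_add, ← assoc_comul_inclSq, ← lcomul_inclSq] at h2
    have h3 : D.inclCube ((Algebra.TensorProduct.includeRight : _ →ₐ[k] _) D.χ) =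
        1 ⊗ₜ D.inclSq D.χ := by
      rw [inclCube, Algebra.TensorProduct.includeRight_apply, Algebra.TensorProduct.map_tmul,
        map_one]
    have h4 : D.inclCube (Algebra.TensorProduct.assoc k k k _ _ _
        ((Algebra.TensorProduct.includeLeft : _ →ₐ[k] _) D.χ)) =
        Algebra.TensorProduct.assoc k k k D.u D.u D.u (D.inclSq D.χ ⊗ₜ 1) := by
      rw [Algebra.TensorProduct.includeLeft_apply, ← assoc_inclSq_tmul, map_one]
    rw [h3, h4] at h2
    rw [comul_x]
    simp only [map_add, Algebra.TensorProduct.map_tmul, comul_x, AlgHom.id_apply, map_one,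
      add_tmul, tmul_add, Algebra.TensorProduct.assoc_tmul, Algebra.TensorProduct.one_def]
    set P := Algebra.TensorProduct.assoc k k k D.u D.u D.u
      (Algebra.TensorProduct.map D.comul (.id k D.u) (D.inclSq D.χ))
    set Q := Algebra.TensorProduct.assoc k k k D.u D.u D.u (D.inclSq D.χ ⊗ₜ 1)
    calc _ = D.x ⊗ₜ[k] ((1 : D.u) ⊗ₜ[k] (1 : D.u)) + 1 ⊗ₜ[k] (D.x ⊗ₜ[k] 1) +
          1 ⊗ₜ[k] (1 ⊗ₜ[k] D.x) + (P + Q) := by abel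
      _ = _ := by rw [← h2]; abel

theorem counit_comul_left : (Algebra.TensorProduct.map D.counit (.id k D.u)).comp D.comul =
    (Algebra.TensorProduct.lid k D.u).symm := by
  have h1 (c : RestrictedEnveloping k p h ⊗[k] RestrictedEnveloping k p h) :
      Algebra.TensorProduct.map D.counit (.id k D.u) (D.inclSq c) =
        TensorProduct.map Coalgebra.counit D.incl.toLinearMap c := by
    induction c with
    | zero => simp
    | add c d hc hd => simp only [map_add, hc, hd]
    | tmul a b => simp [counit_incl]
  refine algHom_ext (fun a => ?_) ?_
  · rw [AlgHom.comp_apply, comul_incl, h1, ← LinearMap.lTensor_comp_rTensor, LinearMap.comp_apply,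
      Coalgebra.rTensor_counit_comul]
    simp
  · rw [AlgHom.comp_apply, comul_x, map_add, h1,
      Cobar.map_eq_zero_of_augSq (.inl fun a (ha : Coalgebra.counit (R := k) a = 0) => ha) D.χ_mem.1]
    simp [counit_x]

theorem counit_comul_right : (Algebra.TensorProduct.map (.id k D.u) D.counit).comp D.comul =
    (Algebra.TensorProduct.rid k k D.u).symm := by
  have h1 (c : RestrictedEnveloping k p h ⊗[k] RestrictedEnveloping k p h) :
      Algebra.TensorProduct.map (.id k D.u) D.counit (D.inclSq c) =
        TensorProduct.map D.incl.toLinearMap Coalgebra.counit c := by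
    induction c with
    | zero => simp
    | add c d hc hd => simp only [map_add, hc, hd]
    | tmul a b => simp [counit_incl]
  refine algHom_ext (fun a => ?_) ?_
  · rw [AlgHom.comp_apply, comul_incl, h1, ← LinearMap.rTensor_comp_lTensor, LinearMap.comp_apply,
      Coalgebra.lTensor_counit_comul]
    simp
  · rw [AlgHom.comp_apply, comul_x, map_add, h1,
      Cobar.map_eq_zero_of_augSq (.inr fun a (ha : Coalgebra.counit (R := k) a = 0) => ha) D.χ_mem.1]
    simp [counit_x]

end Comul

end CompatibleDatum

namespace CompatibleDatum

open Polynomial TensorProduct MulOpposite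

variable {k : Type*} {p : ℕ} {h : Type*} [Field k] [hp : Fact p.Prime] [CharP k p]
  [LieRing h] [LieAlgebra k h] [IsLieAbelian h] [RestrictedLieAlgebra k p h]
  {n : ℕ} {lam : Fin n → k} (D : CompatibleDatum k p h lam)

/-! ### The antipode of `u(D)` -/

section Antipode

variable (k p h) in
/-- The map `a ⊗ b ↦ S(a) b` on `A ⊗ A`. -/
def convLeft : RestrictedEnveloping k p h ⊗[k] RestrictedEnveloping k p h →ₐ[k]
    RestrictedEnveloping k p h :=
  Algebra.TensorProduct.productMap (RestrictedEnveloping.antipode k p h) (.id k _)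

variable (k p h) in
/-- The map `a ⊗ b ↦ a S(b)` on `A ⊗ A`. -/
def convRight : RestrictedEnveloping k p h ⊗[k] RestrictedEnveloping k p h →ₐ[k]
    RestrictedEnveloping k p h :=
  Algebra.TensorProduct.productMap (.id k _) (RestrictedEnveloping.antipode k p h)

@[simp]
theorem convLeft_tmul (a b : RestrictedEnveloping k p h) :
    convLeft k p h (a ⊗ₜ b) = RestrictedEnveloping.antipode k p h a * b := by simp [convLeft]

@[simp]
theorem convRight_tmul (a b : RestrictedEnveloping k p h) :
    convRight k p h (a ⊗ₜ b) = a * RestrictedEnveloping.antipode k p h b := by simp [convRight]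

theorem convLeft_comul (a : RestrictedEnveloping k p h) :
    convLeft k p h (Coalgebra.comul (R := k) a) = algebraMap k _ (Coalgebra.counit (R := k) a) := by
  rw [← HopfAlgebra.mul_antipode_rTensor_comul_apply]
  generalize (Coalgebra.comul (R := k) a : RestrictedEnveloping k p h ⊗[k] _) = c
  induction c with
  | zero => simp
  | add c d hc hd => simp only [map_add, hc, hd]
  | tmul a b => rw [convLeft_tmul]; rfl

theorem convRight_comul (a : RestrictedEnveloping k p h) :
    convRight k p h (Coalgebra.comul (R := k) a) =
      algebraMap k _ (Coalgebra.counit (R := k) a) := by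
  rw [← HopfAlgebra.mul_antipode_lTensor_comul_apply]
  generalize (Coalgebra.comul (R := k) a : RestrictedEnveloping k p h ⊗[k] _) = c
  induction c with
  | zero => simp
  | add c d hc hd => simp only [map_add, hc, hd]
  | tmul a b => rw [convRight_tmul]; rfl

variable (k p h) in
/-- The map `a ⊗ b ⊗ c ↦ a S(b) c`. -/
def convMid : RestrictedEnveloping k p h ⊗[k]
    (RestrictedEnveloping k p h ⊗[k] RestrictedEnveloping k p h) →ₐ[k]
    RestrictedEnveloping k p h :=
  Algebra.TensorProduct.productMap (.id k _) (convLeft k p h)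

theorem convMid_assoc (c : RestrictedEnveloping k p h ⊗[k] RestrictedEnveloping k p h)
    (b : RestrictedEnveloping k p h) :
    convMid k p h (TensorProduct.assoc k _ _ _ (c ⊗ₜ b)) = convRight k p h c * b := by
  induction c with
  | zero => simp
  | add c d hc hd => simp only [add_tmul, map_add, hc, hd, add_mul]
  | tmul a b => simp [convMid, mul_assoc]

/-- The two convolutions with the antipode agree on cocycles. -/
theorem convLeft_eq_convRight {c : RestrictedEnveloping k p h ⊗[k] RestrictedEnveloping k p h}
    (hc : c ∈ Cobar.cocycles k (RestrictedEnveloping k p h)) :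
    convLeft k p h c = convRight k p h c := by
  have hd1 (a : RestrictedEnveloping k p h) : convRight k p h (Cobar.d1 k _ a) =
      a + RestrictedEnveloping.antipode k p h a -
        algebraMap k _ (Coalgebra.counit (R := k) a) := by
    rw [Cobar.d1_apply, map_sub, map_add, convRight_comul]; simp
  have hd1' (a : RestrictedEnveloping k p h) : convLeft k p h (Cobar.d1 k _ a) =
      a + RestrictedEnveloping.antipode k p h a -
        algebraMap k _ (Coalgebra.counit (R := k) a) := by
    rw [Cobar.d1_apply, map_sub, map_add, convLeft_comul]; simp [add_comm]
  -- Apply `a ⊗ b ⊗ c ↦ a S(b) c` to `d²`. Besides the two convolutions only terms with a counit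
  -- appear, and these vanish on `A⁺ ⊗ A⁺`.
  have key (c : RestrictedEnveloping k p h ⊗[k] RestrictedEnveloping k p h) :
      convMid k p h (Cobar.d2 k _ c) = convLeft k p h c - convRight k p h c -
        (TensorProduct.lid k _) (TensorProduct.map Coalgebra.counit .id c) +
        (TensorProduct.rid k _) (TensorProduct.map .id Coalgebra.counit c) := by
    induction c with
    | zero => simp
    | add c d hc hd => simp only [map_add, hc, hd]; abel
    | tmul a b =>
      have h1 : convMid k p h (a ⊗ₜ Cobar.d1 k _ b) = a * convLeft k p h (Cobar.d1 k _ b) := by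
        simp [convMid]
      rw [Cobar.d2_tmul, map_sub, convMid_assoc, h1, hd1, hd1']
      simp [Algebra.smul_def]
      ring
  have h0 : Cobar.d2 k _ c = 0 := hc.2
  have h1 := key c
  rw [h0, Cobar.map_eq_zero_of_augSq (.inl fun a (ha : Coalgebra.counit (R := k) a = 0) => ha) hc.1,
    Cobar.map_eq_zero_of_augSq (.inr fun a (ha : Coalgebra.counit (R := k) a = 0) => ha) hc.1] at h1
  simp only [map_zero, sub_zero, add_zero] at h1
  exact (sub_eq_zero.mp h1.symm)

theorem ρz_antipode (a : RestrictedEnveloping k p h) :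
    D.ρz (RestrictedEnveloping.antipode k p h a) =
      RestrictedEnveloping.antipode k p h (D.ρz a) := by
  induction a using RestrictedEnveloping.induction with
  | hal r => simp
  | hι v =>
    rw [RestrictedEnveloping.antipode_ι, map_neg, ρz, AlgebraicRep.derivation_ι,
      RestrictedEnveloping.antipode_ι]
  | hadd a b ha hb => simp only [map_add, ha, hb]
  | hmul a b ha hb => simp [ha, hb]

theorem ρz_convLeft (c : RestrictedEnveloping k p h ⊗[k] RestrictedEnveloping k p h) :
    D.ρz (convLeft k p h c) = convLeft k p h (Cobar.act D.ρz.toLinearMap c) := by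
  have hρ (a : RestrictedEnveloping k p h) : D.ρz.toLinearMap a = D.ρz a := rfl
  induction c with
  | zero => simp
  | add c d hc hd => simp only [map_add, hc, hd]
  | tmul a b => simp [Cobar.act, hρ, ρz_antipode, mul_comm, add_comm]

/-- The antipode of `u(D)`, as an algebra map to the opposite algebra. -/
def antipodeOp : D.u →ₐ[k] D.uᵐᵒᵖ :=
  D.lift (AlgHom.toOpposite (D.incl.comp (RestrictedEnveloping.antipode k p h)) fun a b => by
      simp only [AlgHom.comp_apply, commute_iff_eq, ← map_mul, mul_comm])
    -- The value at `x` is forced by the left antipode axiom `S(x) + x + ∑ S(χ₁) χ₂ = 0`.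
    (op (-(D.x + D.incl (convLeft k p h D.χ))))
    (fun a => by
      change op _ * op _ - op _ * op _ = op (D.incl (RestrictedEnveloping.antipode k p h (D.ρz a)))
      rw [← op_mul, ← op_mul, ← op_sub, ← ρz_antipode, ← x_mul_incl_sub]
      have h1 : D.incl (convLeft k p h D.χ) * D.incl (RestrictedEnveloping.antipode k p h a) =
          D.incl (RestrictedEnveloping.antipode k p h a) * D.incl (convLeft k p h D.χ) := by
        rw [← map_mul, mul_comm, map_mul]
      congr 1
      simp only [AlgHom.coe_comp, Function.comp_apply, mul_neg, neg_mul, add_mul, mul_add, h1]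
      abel)
    (by
      have hop (y : D.u) : aeval (op y) (pPolynomial k p lam) =
          op (aeval y (pPolynomial k p lam)) := by
        simp [MonogenicHopf.aeval_pPolynomial]
      have hneg (y : D.u) : aeval (-y) (pPolynomial k p lam) =
          -aeval y (pPolynomial k p lam) := by
        have h1 := MonogenicHopf.aeval_add_of_commute k p lam (Commute.refl y).neg_right
        have h0 : aeval (0 : D.u) (pPolynomial k p lam) = 0 := by
          simp [MonogenicHopf.aeval_pPolynomial, hp.out.ne_zero]
        rw [add_neg_cancel, h0] at h1
        exact (neg_eq_of_add_eq_zero_right h1.symm).symm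
      -- Convolution sends `Φ(χ) = d¹(Θ)` to `Θ + S(Θ)`, as `ε(Θ) = 0`. Together with `f(x) = -Θ`
      -- this leaves `S(Θ)`, and `f(-y) = -f(y)` gives the relation for `S(x)`.
      have h1 : aeval (D.x + D.incl (convLeft k p h D.χ)) (pPolynomial k p lam) =
          D.incl (RestrictedEnveloping.antipode k p h D.Θ) := by
        have h2 := Cobar.aeval_add_eq_opPhi lam (X := D.x) (δ := D.ρz.toLinearMap)
          (ψ := D.incl.comp (convLeft k p h)) (fun c => by
            rw [AlgHom.comp_apply, AlgHom.comp_apply, x_mul_incl_sub, ρz_convLeft]) D.χ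
        have h3 : Cobar.opPhi p lam D.ρz.toLinearMap D.χ = _ := D.Φ_χ
        have h4 : Coalgebra.counit (R := k) D.Θ = 0 := D.Θ_mem
        rw [h3, eq_neg_of_add_eq_zero_left D.aeval_x, Cobar.d1_apply, AlgHom.comp_apply,
          AlgHom.comp_apply, map_sub, map_add, convLeft_comul, h4] at h2
        rw [h2]
        simp
      change _ + op (D.incl (RestrictedEnveloping.antipode k p h D.Θ)) = 0
      rw [hop, hneg, h1, ← op_add, neg_add_cancel, op_zero])

/-- The antipode of `u(D)`. -/
def antipode : D.u →ₗ[k] D.u :=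
  (opLinearEquiv k).symm.toLinearMap ∘ₗ D.antipodeOp.toLinearMap

theorem antipode_mul (u v : D.u) : D.antipode (u * v) = D.antipode v * D.antipode u := by
  simp [antipode]

theorem antipode_incl (a : RestrictedEnveloping k p h) :
    D.antipode (D.incl a) = D.incl (RestrictedEnveloping.antipode k p h a) := by
  simp [antipode, antipodeOp]
  rfl

theorem antipode_one : D.antipode 1 = 1 := by
  simp [antipode]

theorem antipode_x : D.antipode D.x = -(D.x + D.incl (convLeft k p h D.χ)) := by
  rw [antipode, antipodeOp, LinearMap.comp_apply, AlgHom.toLinearMap_apply, lift_x]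
  rfl

theorem mul_antipode_inclSq_left
    (c : RestrictedEnveloping k p h ⊗[k] RestrictedEnveloping k p h) :
    LinearMap.mul' k D.u (D.antipode.rTensor D.u (D.inclSq c)) = D.incl (convLeft k p h c) := by
  induction c with
  | zero => simp
  | add c d hc hd => simp only [map_add, hc, hd]
  | tmul a b => simp [antipode_incl]

theorem mul_antipode_inclSq_right
    (c : RestrictedEnveloping k p h ⊗[k] RestrictedEnveloping k p h) :
    LinearMap.mul' k D.u (D.antipode.lTensor D.u (D.inclSq c)) = D.incl (convRight k p h c) := by
  induction c with
  | zero => simp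
  | add c d hc hd => simp only [map_add, hc, hd]
  | tmul a b => simp [antipode_incl]

theorem mul_antipode_left (u : D.u) : LinearMap.mul' k D.u (D.antipode.rTensor D.u (D.comul u)) =
    algebraMap k D.u (D.counit u) := by
  induction u using induction with
  | incl a => rw [comul_incl, mul_antipode_inclSq_left, convLeft_comul, counit_incl, AlgHom.commutes]
  | x =>
    rw [comul_x, map_add, map_add, mul_antipode_inclSq_left, counit_x]
    simp [antipode_x, antipode_one]
  | add u v hu hv => simp only [map_add, hu, hv]
  | mul u v hu hv =>
    have h1 (c : D.u ⊗[k] D.u) (a b : D.u) :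
        LinearMap.mul' k D.u (D.antipode.rTensor D.u (c * (a ⊗ₜ b))) =
          D.antipode a * LinearMap.mul' k D.u (D.antipode.rTensor D.u c) * b := by
      induction c with
      | zero => simp
      | add c d hc hd => simp only [map_add, add_mul, mul_add, hc, hd]
      | tmul c d => simp [antipode_mul, mul_assoc]
    -- As `S` reverses products, the inner factor `∑ S(u₁) u₂` collapses to the scalar `ε(u)`. So
    -- the axiom passes from two elements to their product.
    have h2 (c : D.u ⊗[k] D.u) :
        LinearMap.mul' k D.u (D.antipode.rTensor D.u (D.comul u * c)) =
          D.counit u • LinearMap.mul' k D.u (D.antipode.rTensor D.u c) := by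
      induction c with
      | zero => simp
      | add c d hc hd => simp only [map_add, mul_add, smul_add, hc, hd]
      | tmul c d => rw [h1, hu]; simp [Algebra.algebraMap_eq_smul_one]
    rw [map_mul, h2, hv, map_mul, map_mul, Algebra.smul_def]

theorem mul_antipode_right (u : D.u) : LinearMap.mul' k D.u (D.antipode.lTensor D.u (D.comul u)) =
    algebraMap k D.u (D.counit u) := by
  induction u using induction with
  | incl a =>
    rw [comul_incl, mul_antipode_inclSq_right, convRight_comul, counit_incl, AlgHom.commutes]
  | x =>
    -- The right axiom produces `∑ χ₁ S(χ₂)` whereas `S(x)` was defined with `∑ S(χ₁) χ₂`. They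
    -- agree because `χ` is a cocycle.
    rw [comul_x, map_add, map_add, mul_antipode_inclSq_right, counit_x,
      ← convLeft_eq_convRight D.χ_mem]
    simp [antipode_x, antipode_one]
  | add u v hu hv => simp only [map_add, hu, hv]
  | mul u v hu hv =>
    have h1 (c : D.u ⊗[k] D.u) (a b : D.u) :
        LinearMap.mul' k D.u (D.antipode.lTensor D.u ((a ⊗ₜ b) * c)) =
          a * LinearMap.mul' k D.u (D.antipode.lTensor D.u c) * D.antipode b := by
      induction c with
      | zero => simp
      | add c d hc hd => simp only [map_add, add_mul, mul_add, hc, hd]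
      | tmul c d => simp [antipode_mul, mul_assoc]
    have h2 (c : D.u ⊗[k] D.u) :
        LinearMap.mul' k D.u (D.antipode.lTensor D.u (c * D.comul v)) =
          D.counit v • LinearMap.mul' k D.u (D.antipode.lTensor D.u c) := by
      induction c with
      | zero => simp
      | add c d hc hd => simp only [map_add, add_mul, smul_add, hc, hd]
      | tmul c d => rw [h1, hv]; simp [Algebra.algebraMap_eq_smul_one]
    rw [map_mul, h2, hu, map_mul, map_mul, Algebra.smul_def, Algebra.commutes]

/-- The Hopf algebra structure of `u(D)`. -/
def hopfStructure : HopfStructure k D.u where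
  comul := D.comul
  counit := D.counit
  antipode := D.antipode
  coassoc := D.comul_coassoc
  counit_left := D.counit_comul_left
  counit_right := D.counit_comul_right
  antipode_left := D.mul_antipode_left
  antipode_right := D.mul_antipode_right

theorem isPrescribed : D.IsPrescribed D.hopfStructure where
  comul_incl := D.comul_incl
  counit_incl := D.counit_incl
  comul_x := D.comul_x
  counit_x := D.counit_x

end Antipode

end CompatibleDatum

/-! ### Weight filtrations and connectedness -/

namespace HopfExt

section WeightFiltration

variable {k : Type*} {H : Type*} [Field k] [Ring H] [Algebra k H]
  {J : Type*} {g : J → H} {w : J → ℕ}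

variable (k g w) in
/-- The span of the products of generators `g j` of total weight at most `m`. -/
def weightFiltration (m : ℕ) : Submodule k H :=
  Submodule.span k {y | ∃ l : List J, (l.map w).sum ≤ m ∧ (l.map g).prod = y}

/-- The filtration of `H ⊗ H` which is induced by a filtration of `H`. -/
def tensorFiltration (F : ℕ → Submodule k H) (m : ℕ) : Submodule k (H ⊗[k] H) :=
  Submodule.span k {y | ∃ i j : ℕ, i + j ≤ m ∧ ∃ a ∈ F i, ∃ b ∈ F j, a ⊗ₜ[k] b = y}

theorem tmul_mem_tensorFiltration {F : ℕ → Submodule k H} {m i j : ℕ} (hm : i + j ≤ m) {a b : H}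
    (ha : a ∈ F i) (hb : b ∈ F j) : a ⊗ₜ[k] b ∈ tensorFiltration F m :=
  Submodule.subset_span ⟨i, j, hm, a, ha, b, hb, rfl⟩

theorem weightFiltration_mono {m m' : ℕ} (h : m ≤ m') :
    weightFiltration k g w m ≤ weightFiltration k g w m' :=
  Submodule.span_mono fun _ ⟨l, hl, e⟩ => ⟨l, hl.trans h, e⟩

theorem one_mem_weightFiltration (m : ℕ) : (1 : H) ∈ weightFiltration k g w m :=
  Submodule.subset_span ⟨[], by simp, by simp⟩

theorem gen_mem_weightFiltration (j : J) : g j ∈ weightFiltration k g w (w j) :=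
  Submodule.subset_span ⟨[j], by simp, by simp⟩

theorem mul_mem_weightFiltration {a b : ℕ} {u v : H} (hu : u ∈ weightFiltration k g w a)
    (hv : v ∈ weightFiltration k g w b) : u * v ∈ weightFiltration k g w (a + b) := by
  have h := Submodule.mul_mem_mul hu hv
  rw [weightFiltration, weightFiltration, Submodule.span_mul_span] at h
  refine Submodule.span_mono ?_ h
  rintro _ ⟨_, ⟨l, hl, rfl⟩, _, ⟨l', hl', rfl⟩, rfl⟩
  exact ⟨l ++ l', by simp; omega, by simp⟩

theorem mul_mem_tensorFiltration {a b : ℕ} {u v : H ⊗[k] H}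
    (hu : u ∈ tensorFiltration (weightFiltration k g w) a)
    (hv : v ∈ tensorFiltration (weightFiltration k g w) b) :
    u * v ∈ tensorFiltration (weightFiltration k g w) (a + b) := by
  have h := Submodule.mul_mem_mul hu hv
  rw [tensorFiltration, tensorFiltration, Submodule.span_mul_span] at h
  refine Submodule.span_mono ?_ h
  rintro _ ⟨_, ⟨i, j, hij, c, hc, d, hd, rfl⟩, _, ⟨i', j', hij', c', hc', d', hd', rfl⟩, rfl⟩
  exact ⟨i + i', j + j', by omega, c * c', mul_mem_weightFiltration hc hc', d * d',
    mul_mem_weightFiltration hd hd', by simp⟩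

theorem tensorFiltration_mono {F : ℕ → Submodule k H} {m m' : ℕ} (h : m ≤ m') :
    tensorFiltration F m ≤ tensorFiltration F m' :=
  Submodule.span_mono fun _ ⟨i, j, hij, e⟩ => ⟨i, j, hij.trans h, e⟩

theorem weightFiltration_zero (hw : ∀ j, w j ≠ 0) :
    weightFiltration k g w 0 ≤ Submodule.span k {1} := by
  refine Submodule.span_mono ?_
  rintro _ ⟨l, hl, rfl⟩
  cases l with
  | nil => simp
  | cons j l => simp [hw j] at hl

/-- An algebra map which respects the filtrations on generators respects them. -/
theorem map_mem_tensorFiltration {Δ : H →ₐ[k] H ⊗[k] H}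
    (hΔ : ∀ j, Δ (g j) ∈ tensorFiltration (weightFiltration k g w) (w j)) {m : ℕ} {u : H}
    (hu : u ∈ weightFiltration k g w m) : Δ u ∈ tensorFiltration (weightFiltration k g w) m := by
  suffices h : weightFiltration k g w m ≤
      (tensorFiltration (weightFiltration k g w) m).comap Δ.toLinearMap from h hu
  rw [weightFiltration, Submodule.span_le]
  rintro _ ⟨l, hl, rfl⟩
  refine tensorFiltration_mono hl ?_
  clear hl
  change Δ _ ∈ _
  induction l with
  | nil =>
    simpa [Algebra.TensorProduct.one_def] using tmul_mem_tensorFiltration (k := k) (le_refl (0 + 0))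
      (one_mem_weightFiltration (k := k) (g := g) (w := w) 0) (one_mem_weightFiltration 0)
  | cons j l ih =>
    rw [List.map_cons, List.map_cons, List.prod_cons, List.sum_cons, map_mul]
    exact mul_mem_tensorFiltration (hΔ j) ih

theorem exists_mem_weightFiltration_of_mul {u v : H} (hu : ∃ m, u ∈ weightFiltration k g w m)
    (hv : ∃ m, v ∈ weightFiltration k g w m) : ∃ m, u * v ∈ weightFiltration k g w m := by
  obtain ⟨a, ha⟩ := hu
  obtain ⟨b, hb⟩ := hv
  exact ⟨a + b, mul_mem_weightFiltration ha hb⟩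

theorem exists_mem_weightFiltration_of_add {u v : H} (hu : ∃ m, u ∈ weightFiltration k g w m)
    (hv : ∃ m, v ∈ weightFiltration k g w m) : ∃ m, u + v ∈ weightFiltration k g w m := by
  obtain ⟨a, ha⟩ := hu
  obtain ⟨b, hb⟩ := hv
  exact ⟨max a b, add_mem (weightFiltration_mono (le_max_left _ _) ha)
    (weightFiltration_mono (le_max_right _ _) hb)⟩

theorem exists_mem_tensorFiltration (hex : ∀ u : H, ∃ m, u ∈ weightFiltration k g w m)
    (c : H ⊗[k] H) : ∃ m, c ∈ tensorFiltration (weightFiltration k g w) m := by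
  induction c with
  | zero => exact ⟨0, zero_mem _⟩
  | add c d hc hd =>
    obtain ⟨a, ha⟩ := hc
    obtain ⟨b, hb⟩ := hd
    exact ⟨max a b, add_mem (tensorFiltration_mono (le_max_left _ _) ha)
      (tensorFiltration_mono (le_max_right _ _) hb)⟩
  | tmul a b =>
    obtain ⟨i, hi⟩ := hex a
    obtain ⟨j, hj⟩ := hex b
    exact ⟨i + j, tmul_mem_tensorFiltration le_rfl hi hj⟩

end WeightFiltration

/-! ### Connectedness from a coalgebra filtration -/

section Connected

variable {k : Type*} {H : Type*} [Field k] [Ring H] [Bialgebra k H] {F : ℕ → Submodule k H}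

/-- A bialgebra with an exhaustive coalgebra filtration such that `F 0` consists of scalars:
every non-zero subcoalgebra contains `1`. -/
theorem one_mem_of_isSubcoalgebra (h0 : F 0 ≤ Submodule.span k {1})
    (hmono : Monotone F) (hex : ∀ u : H, ∃ m, u ∈ F m)
    (hΔ : ∀ m, ∀ u ∈ F m, Coalgebra.comul (R := k) u ∈ tensorFiltration F m)
    {C : Submodule k H} (hC : IsSubcoalgebra k C) (hbot : C ≠ ⊥) : (1 : H) ∈ C := by
  obtain ⟨c, hc, hc0⟩ := Submodule.exists_mem_ne_zero_of_ne_bot hbot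
  obtain ⟨m, hm, hmin⟩ : ∃ m, c ∈ F m ∧ ∀ i : ℕ, i < m → c ∉ F i := by
    classical
    exact ⟨Nat.find (hex c), Nat.find_spec (hex c), fun i hi => Nat.find_min (hex c) hi⟩
  cases m with
  | zero =>
    obtain ⟨r, rfl⟩ : ∃ r : k, r • (1 : H) = c := Submodule.mem_span_singleton.mp (h0 hm)
    have hr : r ≠ 0 := fun h => hc0 (by rw [h, zero_smul])
    have := C.smul_mem r⁻¹ hc
    rwa [inv_smul_smul₀ hr] at this
  | succ m =>
    -- With `c` of minimal filtration degree `m + 1`, choose `φ` with `φ(c) ≠ 0` that kills `F m`.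
    -- In `(φ ⊗ id)(Δ(c))` only terms with second factor in `F 0` survive, so the result is a
    -- scalar, and it lies in `C`.
    obtain ⟨φ, hφc, hφ⟩ := Submodule.exists_le_ker_of_notMem (hmin m (Nat.lt_succ_self m))
    have h1 : ∀ t ∈ tensorFiltration F (m + 1),
        TensorProduct.lid k H (φ.rTensor H t) ∈ Submodule.span k {(1 : H)} := by
      intro t ht
      refine (Submodule.span_le (p := (Submodule.span k {(1 : H)}).comap
        ((TensorProduct.lid k H).toLinearMap ∘ₗ φ.rTensor H))).mpr ?_ ht
      rintro _ ⟨i, j, hij, a, ha, b, hb, rfl⟩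
      change TensorProduct.lid k H (φ.rTensor H (a ⊗ₜ b)) ∈
        Submodule.span k {(1 : H)}
      rw [LinearMap.rTensor_tmul, TensorProduct.lid_tmul]
      by_cases hi : i ≤ m
      · rw [show φ a = 0 from hφ (hmono hi ha), zero_smul]
        exact zero_mem _
      · obtain rfl : j = 0 := by omega
        exact Submodule.smul_mem _ _ (h0 hb)
    obtain ⟨r, hr⟩ := Submodule.mem_span_singleton.mp (h1 _ (hΔ _ c hm))
    have h2 : TensorProduct.lid k H (φ.rTensor H (Coalgebra.comul (R := k) c)) ∈ C := by
      obtain ⟨t, ht⟩ := hC c hc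
      rw [← ht]
      clear ht
      induction t with
      | zero => simp
      | add x y hx hy => rw [map_add, map_add, map_add]; exact add_mem hx hy
      | tmul a b => simpa using C.smul_mem _ b.2
    -- The counit axiom computes the scalar, which is therefore nonzero.
    have h3 : r = φ c := by
      have h4 : ∀ t : H ⊗[k] H, Coalgebra.counit (R := k)
          (TensorProduct.lid k H (φ.rTensor H t)) =
          φ (TensorProduct.rid k H (Coalgebra.counit.lTensor H t)) := by
        intro t
        induction t with
        | zero => simp
        | add x y hx hy => simp only [map_add, hx, hy]
        | tmul a b => simp [mul_comm]
      have h5 := h4 (Coalgebra.comul (R := k) c)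
      rw [← hr, Coalgebra.lTensor_counit_comul] at h5
      simpa using h5
    rw [← hr] at h2
    have := C.smul_mem r⁻¹ h2
    rwa [inv_smul_smul₀ (by rw [h3]; exact hφc)] at this

/-- The line spanned by `1` is a subcoalgebra contained in every nonzero one, so it is the only
simple subcoalgebra. -/
theorem isConnected_of_filtration (h0 : F 0 ≤ Submodule.span k {1})
    (hmono : Monotone F) (hex : ∀ u : H, ∃ m, u ∈ F m)
    (hΔ : ∀ m, ∀ u ∈ F m, Coalgebra.comul (R := k) u ∈ tensorFiltration F m) :
    IsConnected k H := by
  have hne : (1 : H) ≠ 0 := fun h => by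
    have := congrArg (Coalgebra.counit (R := k)) h
    simp at this
  have hsub : IsSubcoalgebra k (Submodule.span k {(1 : H)}) := by
    intro c hc
    obtain ⟨r, rfl⟩ := Submodule.mem_span_singleton.mp hc
    let e : Submodule.span k {(1 : H)} := ⟨1, Submodule.mem_span_singleton_self 1⟩
    exact ⟨r • (e ⊗ₜ e), by simp [e, Algebra.TensorProduct.one_def]⟩
  have hle {C : Submodule k H} (hC : IsSubcoalgebra k C) (hbot : C ≠ ⊥) :
      Submodule.span k {(1 : H)} ≤ C := by
    rw [Submodule.span_singleton_le_iff_mem]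
    exact one_mem_of_isSubcoalgebra h0 hmono hex hΔ hC hbot
  have hbot : Submodule.span k {(1 : H)} ≠ ⊥ := by simpa using hne
  have hcor : coradical k H = Submodule.span k {1} := by
    refine le_antisymm (sSup_le fun C hC => ?_) (le_sSup ⟨hsub, hbot, fun E hE hE1 => ?_⟩)
    · exact ((hC.2.2 _ hsub (hle hC.1 hC.2.1)).resolve_left hbot).ge
    · by_cases hE0 : E = ⊥
      · exact .inl hE0
      · exact .inr (le_antisymm hE1 (hle hE hE0))
  rw [IsConnected, hcor]
  exact finrank_span_singleton hne

end Connected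

end HopfExt

namespace CompatibleDatum

variable {k : Type*} {p : ℕ} {h : Type*} [Field k] [hp : Fact p.Prime] [CharP k p]
  [LieRing h] [LieAlgebra k h] [IsLieAbelian h] [RestrictedLieAlgebra k p h]
  {n : ℕ} {lam : Fin n → k} (D : CompatibleDatum k p h lam)

open HopfExt

theorem exists_mem_weightFiltration_enveloping (a : RestrictedEnveloping k p h) :
    ∃ m, a ∈ weightFiltration k (RestrictedEnveloping.ι k p h) (fun _ => 1) m := by
  induction a using RestrictedEnveloping.induction with
  | hal r =>
    rw [Algebra.algebraMap_eq_smul_one]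
    exact ⟨0, Submodule.smul_mem _ _ (one_mem_weightFiltration 0)⟩
  | hι v => exact ⟨1, gen_mem_weightFiltration v⟩
  | hadd a b ha hb => exact exists_mem_weightFiltration_of_add ha hb
  | hmul a b ha hb => exact exists_mem_weightFiltration_of_mul ha hb

theorem isConnected : letI : HopfAlgebra k D.u := D.hopfStructure.toHopfAlgebra
    HopfExt.IsConnected k D.u := by
  let : HopfAlgebra k D.u := D.hopfStructure.toHopfAlgebra
  obtain ⟨N, hN⟩ := exists_mem_tensorFiltration exists_mem_weightFiltration_enveloping D.χ
  let g : h ⊕ Unit → D.u := Sum.elim (fun v => D.incl (RestrictedEnveloping.ι k p h v)) fun _ => D.x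
  -- If `χ` has weight at most `N`, weight `N + 1` for `x` keeps `Δ(x)` in the filtration. It is
  -- also positive, so that weight zero consists of scalars.
  let w : h ⊕ Unit → ℕ := Sum.elim (fun _ => 1) fun _ => N + 1
  have hincl {m : ℕ} {a : RestrictedEnveloping k p h}
      (ha : a ∈ weightFiltration k (RestrictedEnveloping.ι k p h) (fun _ => 1) m) :
      D.incl a ∈ weightFiltration k g w m := by
    refine (Submodule.span_le (p := (weightFiltration k g w m).comap D.incl.toLinearMap)).mpr ?_ ha
    rintro _ ⟨l, hl, rfl⟩
    refine Submodule.subset_span ⟨l.map Sum.inl, ?_, ?_⟩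
    · simpa [w, Function.comp_def] using hl
    · change _ = D.incl _
      rw [map_list_prod]
      simp [g, Function.comp_def]
  have hχ : D.inclSq D.χ ∈ tensorFiltration (weightFiltration k g w) N := by
    refine (Submodule.span_le (p := (tensorFiltration (weightFiltration k g w) N).comap
      D.inclSq.toLinearMap)).mpr ?_ hN
    rintro _ ⟨i, j, hij, a, ha, b, hb, rfl⟩
    exact tmul_mem_tensorFiltration hij (hincl ha) (hincl hb)
  have hgen (j : h ⊕ Unit) : D.comul (g j) ∈ tensorFiltration (weightFiltration k g w) (w j) := by
    have hprim : g j ⊗ₜ[k] 1 + 1 ⊗ₜ[k] g j ∈ tensorFiltration (weightFiltration k g w) (w j) :=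
      add_mem (tmul_mem_tensorFiltration (Nat.add_zero _).le (gen_mem_weightFiltration j)
        (one_mem_weightFiltration 0)) (tmul_mem_tensorFiltration (Nat.zero_add _).le
        (one_mem_weightFiltration 0) (gen_mem_weightFiltration j))
    obtain v | j := j
    · have h1 : D.comul (g (Sum.inl v)) = g (Sum.inl v) ⊗ₜ[k] 1 + 1 ⊗ₜ[k] g (Sum.inl v) := by
        have h2 : Coalgebra.comul (R := k) (RestrictedEnveloping.ι k p h v) =
          RestrictedEnveloping.ι k p h v ⊗ₜ[k] 1 + 1 ⊗ₜ[k] RestrictedEnveloping.ι k p h v :=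
          RestrictedEnveloping.comul_ι k p h v
        change D.comul (D.incl _) = _
        rw [comul_incl, h2]
        simp [g]
      rw [h1]
      exact hprim
    · change D.comul D.x ∈ _
      rw [comul_x]
      exact add_mem hprim (tensorFiltration_mono (Nat.le_succ N) hχ)
  refine isConnected_of_filtration (F := weightFiltration k g w) (weightFiltration_zero ?_)
    (fun _ _ => weightFiltration_mono) (fun u => ?_)
    fun m u hu => map_mem_tensorFiltration (Δ := D.comul) hgen hu
  · rintro (v | j) <;> simp [w]
  · induction u using induction with
    | incl a =>
      obtain ⟨m, hm⟩ := exists_mem_weightFiltration_enveloping a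
      exact ⟨m, hincl hm⟩
    | x => exact ⟨_, gen_mem_weightFiltration (Sum.inr ())⟩
    | add u v hu hv => exact exists_mem_weightFiltration_of_add hu hv
    | mul u v hu hv => exact exists_mem_weightFiltration_of_mul hu hv

end CompatibleDatum

/-! ### The extension `A → u(D) → B` -/

namespace CompatibleDatum

open Polynomial TensorProduct

variable {k : Type*} {p : ℕ} {h : Type*} [Field k] [hp : Fact p.Prime] [CharP k p]
  [LieRing h] [LieAlgebra k h] [IsLieAbelian h] [RestrictedLieAlgebra k p h]
  {n : ℕ} {lam : Fin n → k} (D : CompatibleDatum k p h lam)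

section Extension

instance : HopfAlgebra k D.u := D.hopfStructure.toHopfAlgebra

theorem coalgebra_comul_apply (u : D.u) : Coalgebra.comul (R := k) u = D.comul u := rfl

theorem map_inclSq {M N : Type*} [AddCommGroup M] [Module k M] [AddCommGroup N] [Module k N]
    (f : D.u →ₗ[k] M) (g : D.u →ₗ[k] N)
    (c : RestrictedEnveloping k p h ⊗[k] RestrictedEnveloping k p h) :
    TensorProduct.map f g (D.inclSq c) =
      TensorProduct.map (f ∘ₗ D.incl.toLinearMap) (g ∘ₗ D.incl.toLinearMap) c := by
  induction c with
  | zero => simp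
  | add c d hc hd => simp only [map_add, hc, hd]
  | tmul a b => simp

/-- The inclusion of `A` as a map of bialgebras. -/
def inclHom : RestrictedEnveloping k p h →ₐc[k] D.u :=
  BialgHom.ofAlgHom D.incl (AlgHom.ext D.counit_incl)
    (AlgHom.ext fun a => (D.comul_incl a).symm)

theorem inclHom_apply (a : RestrictedEnveloping k p h) : D.inclHom a = D.incl a := rfl

/-- The projection of `u(D)` to `B`, as an algebra map. -/
def projAlgHom : D.u →ₐ[k] MonogenicHopf k p lam :=
  D.lift ((Algebra.ofId k _).comp (Bialgebra.counitAlgHom k _)) (MonogenicHopf.z k p lam)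
    (fun a => by
      have h1 : Coalgebra.counit (R := k) (D.ρz a) = 0 := D.ρ.counit_derivation _ a
      simp [h1, mul_comm])
    (by
      have h1 : Coalgebra.counit (R := k) D.Θ = 0 := D.Θ_mem
      simp [h1, MonogenicHopf.aeval_z])

theorem projAlgHom_incl (a : RestrictedEnveloping k p h) :
    D.projAlgHom (D.incl a) = algebraMap k _ (Coalgebra.counit (R := k) a) := by
  rw [projAlgHom, lift_incl]; rfl

theorem projAlgHom_x : D.projAlgHom D.x = MonogenicHopf.z k p lam := by
  rw [projAlgHom, lift_x]

theorem projAlgHom_incl_eq_zero (a : RestrictedEnveloping k p h)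
    (ha : a ∈ Cobar.augIdeal k (RestrictedEnveloping k p h)) :
    (D.projAlgHom.toLinearMap ∘ₗ D.incl.toLinearMap) a = 0 := by
  have h1 : Coalgebra.counit (R := k) a = 0 := ha
  simp [projAlgHom_incl, h1]

/-- The coaction `(id ⊗ π) ∘ Δ`. -/
def coaction : D.u →ₐ[k] D.u ⊗[k] MonogenicHopf k p lam :=
  (Algebra.TensorProduct.map (.id k D.u) D.projAlgHom).comp D.comul

theorem coaction_incl (a : RestrictedEnveloping k p h) :
    D.coaction (D.incl a) = D.incl a ⊗ₜ 1 := by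
  change TensorProduct.map LinearMap.id D.projAlgHom.toLinearMap (D.comul (D.incl a)) = _
  rw [comul_incl, map_inclSq]
  have h1 : D.projAlgHom.toLinearMap ∘ₗ D.incl.toLinearMap =
      (Algebra.linearMap k (MonogenicHopf k p lam)) ∘ₗ Coalgebra.counit :=
    LinearMap.ext D.projAlgHom_incl
  rw [h1, LinearMap.id_comp]
  have h2 : TensorProduct.map D.incl.toLinearMap
      (Algebra.linearMap k (MonogenicHopf k p lam) ∘ₗ Coalgebra.counit) =
      TensorProduct.map D.incl.toLinearMap (Algebra.linearMap k (MonogenicHopf k p lam)) ∘ₗ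
        (Coalgebra.counit (R := k) (A := RestrictedEnveloping k p h)).lTensor _ := by
    rw [LinearMap.lTensor, ← TensorProduct.map_comp, LinearMap.comp_id]
  rw [h2, LinearMap.comp_apply, Coalgebra.lTensor_counit_comul]
  simp

/-- The second factors of `χ` lie in `A⁺` and die in `B`; hence `x` coacts as if it were primitive.
-/
theorem coaction_x : D.coaction D.x = D.x ⊗ₜ 1 + 1 ⊗ₜ MonogenicHopf.z k p lam := by
  have h1 : Algebra.TensorProduct.map (.id k D.u) D.projAlgHom (D.inclSq D.χ) = 0 := by
    change TensorProduct.map LinearMap.id D.projAlgHom.toLinearMap (D.inclSq D.χ) = _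
    rw [map_inclSq, Cobar.map_eq_zero_of_augSq (.inr D.projAlgHom_incl_eq_zero) D.χ_mem.1]
  rw [coaction, AlgHom.comp_apply, comul_x, map_add, h1]
  simp [projAlgHom_x]

/-- The projection of `u(D)` to `B`. -/
def proj : D.u →ₐc[k] MonogenicHopf k p lam :=
  BialgHom.ofAlgHom D.projAlgHom
    (algHom_ext (fun a => by
        have h1 : Bialgebra.counitAlgHom k D.u (D.incl a) = _ := D.counit_incl a
        rw [h1, AlgHom.comp_apply, projAlgHom_incl, AlgHom.commutes]
        rfl) (by
        have h1 : Bialgebra.counitAlgHom k D.u D.x = _ := D.counit_x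
        rw [h1, AlgHom.comp_apply, projAlgHom_x]
        exact MonogenicHopf.counit_z k p lam))
    (algHom_ext (fun a => by
        have h1 (u : D.u) : Algebra.TensorProduct.map D.projAlgHom D.projAlgHom (D.comul u) =
            Algebra.TensorProduct.map D.projAlgHom (.id k _) (D.coaction u) := by
          rw [coaction, ← AlgHom.comp_apply, ← AlgHom.comp_apply, ← AlgHom.comp_assoc,
            ← Algebra.TensorProduct.map_comp]
          simp
        refine (h1 (D.incl a)).trans ?_
        rw [coaction_incl, AlgHom.comp_apply, projAlgHom_incl, AlgHom.commutes]
        simp [projAlgHom_incl, Algebra.TensorProduct.algebraMap_apply]) (by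
        have h1 (u : D.u) : Algebra.TensorProduct.map D.projAlgHom D.projAlgHom (D.comul u) =
            Algebra.TensorProduct.map D.projAlgHom (.id k _) (D.coaction u) := by
          rw [coaction, ← AlgHom.comp_apply, ← AlgHom.comp_apply, ← AlgHom.comp_assoc,
            ← Algebra.TensorProduct.map_comp]
          simp
        refine (h1 D.x).trans ?_
        rw [coaction_x, AlgHom.comp_apply, projAlgHom_x]
        refine Eq.trans ?_ (MonogenicHopf.comul_z k p lam).symm
        simp [projAlgHom_x]))

theorem proj_apply (u : D.u) : D.proj u = D.projAlgHom u := rfl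

theorem proj_surjective : Function.Surjective D.proj := by
  intro b
  rw [← (MonogenicHopf.powerBasis k p lam).sum_repr b]
  refine ⟨∑ j, (MonogenicHopf.powerBasis k p lam).repr b j • D.x ^ (j : ℕ), ?_⟩
  rw [proj_apply]
  simp [projAlgHom_x]

theorem constCoeff_incl (a : RestrictedEnveloping k p h) : D.constCoeff (D.incl a) = a := by
  have h1 := D.constCoeff_apply a (Nat.pow_pos (n := n) hp.out.pos)
  rwa [pow_zero, mul_one, if_pos rfl] at h1

/-- The map `(a_0 ⊗ id) ∘ (id ⊗ π) ∘ Δ`, which sends `a x^j` to `a ⊗ z^j`. -/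
def toTensor : D.u →ₗ[k] RestrictedEnveloping k p h ⊗[k] MonogenicHopf k p lam :=
  D.constCoeff.rTensor _ ∘ₗ D.coaction.toLinearMap

/-- In the expansion of `(x ⊗ 1 + 1 ⊗ z)^j` only the term without `x` in the left factor has a
nonzero constant coefficient. -/
theorem toTensor_apply (a : RestrictedEnveloping k p h) {j : ℕ} (hj : j < p ^ n) :
    D.toTensor (D.incl a * D.x ^ j) = a ⊗ₜ (MonogenicHopf.z k p lam ^ j) := by
  have hc : Commute (D.x ⊗ₜ[k] (1 : MonogenicHopf k p lam))
      ((1 : D.u) ⊗ₜ[k] MonogenicHopf.z k p lam) := by simp [commute_iff_eq]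
  rw [toTensor, LinearMap.comp_apply, AlgHom.toLinearMap_apply, map_mul, map_pow, coaction_incl,
    coaction_x, hc.add_pow, Finset.mul_sum, map_sum, Finset.sum_eq_single 0]
  · simp [Algebra.TensorProduct.tmul_pow, constCoeff_incl]
  · intro i hi hi0
    have hi' : i < p ^ n := by have := Finset.mem_range.mp hi; omega
    rw [← mul_assoc, Algebra.TensorProduct.tmul_pow, Algebra.TensorProduct.tmul_pow,
      Algebra.TensorProduct.tmul_mul_tmul, Algebra.TensorProduct.tmul_mul_tmul, ← Nat.cast_comm,
      ← nsmul_eq_mul, map_nsmul, LinearMap.rTensor_tmul, one_pow, mul_one,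
      D.constCoeff_apply a hi', if_neg hi0, zero_tmul, smul_zero]
  · simp

theorem toTensor_injective : Function.Injective D.toTensor := by
  rw [← LinearMap.ker_eq_bot, LinearMap.ker_eq_bot']
  intro u hu
  obtain ⟨c, rfl⟩ := D.ofCoeffs_surjective u
  have h1 (i : Fin (p ^ n)) : c i = 0 := by
    have h2 := congrArg (TensorProduct.rid k _ ∘
      ((MonogenicHopf.powerBasis k p lam).coord i).lTensor (RestrictedEnveloping k p h)) hu
    simp only [Function.comp_apply, map_zero] at h2
    rw [ofCoeffs_apply, map_sum, Finset.sum_congr rfl fun j _ => D.toTensor_apply (c j) j.2,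
      map_sum, map_sum] at h2
    simp only [LinearMap.lTensor_tmul, MonogenicHopf.coord_pow i (Fin.is_lt _), rid_tmul,
      ← Fin.ext_iff, ite_smul, one_smul, zero_smul] at h2
    simpa using h2
  rw [funext h1]
  exact map_zero _

theorem coaction_eq_iff (u : D.u) : u ∈ Set.range D.incl ↔ D.coaction u = u ⊗ₜ 1 := by
  constructor
  · rintro ⟨a, rfl⟩
    exact D.coaction_incl a
  · intro hu
    -- If `u` coacts trivially, `toTensor` sends both `u` and its constant coefficient to
    -- `constCoeff u ⊗ 1`.
    refine ⟨D.constCoeff u, D.toTensor_injective ?_⟩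
    have h1 := D.toTensor_apply (D.constCoeff u) (Nat.pow_pos (n := n) hp.out.pos)
    rw [pow_zero, pow_zero, mul_one] at h1
    rw [h1, toTensor, LinearMap.comp_apply, AlgHom.toLinearMap_apply, hu, LinearMap.rTensor_tmul]

/-- Both sides are algebra maps in `u`, and on `x` the cocycle disappears in either order. This
gives cocentrality and reduces left coinvariants to right ones. -/
theorem map_proj_comul (u : D.u) :
    Algebra.TensorProduct.map D.projAlgHom (.id k D.u) (D.comul u) =
      Algebra.TensorProduct.comm k _ _ (D.coaction u) := by
  suffices h1 : (Algebra.TensorProduct.map D.projAlgHom (.id k D.u)).comp D.comul =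
      (Algebra.TensorProduct.comm k D.u (MonogenicHopf k p lam)).toAlgHom.comp D.coaction from
    congrArg (fun f => f u) h1
  refine algHom_ext (fun a => ?_) ?_
  · have h1 : D.projAlgHom.toLinearMap ∘ₗ D.incl.toLinearMap =
        (Algebra.linearMap k (MonogenicHopf k p lam)) ∘ₗ Coalgebra.counit :=
      LinearMap.ext D.projAlgHom_incl
    have h2 : TensorProduct.map
        (Algebra.linearMap k (MonogenicHopf k p lam) ∘ₗ Coalgebra.counit) D.incl.toLinearMap =
        TensorProduct.map (Algebra.linearMap k (MonogenicHopf k p lam)) D.incl.toLinearMap ∘ₗ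
          (Coalgebra.counit (R := k) (A := RestrictedEnveloping k p h)).rTensor _ := by
      rw [LinearMap.rTensor, ← TensorProduct.map_comp, LinearMap.comp_id]
    rw [AlgHom.comp_apply, AlgHom.comp_apply, coaction_incl]
    change TensorProduct.map D.projAlgHom.toLinearMap LinearMap.id (D.comul (D.incl a)) =
      1 ⊗ₜ D.incl a
    rw [comul_incl, map_inclSq, h1, LinearMap.id_comp, h2, LinearMap.comp_apply,
      Coalgebra.rTensor_counit_comul]
    simp
  · have h1 : Algebra.TensorProduct.map D.projAlgHom (.id k D.u) (D.inclSq D.χ) = 0 := by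
      change TensorProduct.map D.projAlgHom.toLinearMap LinearMap.id (D.inclSq D.χ) = _
      rw [map_inclSq, Cobar.map_eq_zero_of_augSq (.inl D.projAlgHom_incl_eq_zero) D.χ_mem.1]
    rw [AlgHom.comp_apply, AlgHom.comp_apply, coaction_x, comul_x, map_add, h1]
    change _ = Algebra.TensorProduct.comm k D.u (MonogenicHopf k p lam) _
    simp [projAlgHom_x, add_comm]

/-- The image of the augmentation ideal `A⁺`. -/
def augImage : Submodule k D.u :=
  (Cobar.augIdeal k (RestrictedEnveloping k p h)).map D.incl.toLinearMap

theorem incl_mem_augImage {a : RestrictedEnveloping k p h}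
    (ha : Coalgebra.counit (R := k) a = 0) : D.incl a ∈ D.augImage := ⟨a, ha, rfl⟩

theorem counit_ρz (a : RestrictedEnveloping k p h) : Coalgebra.counit (R := k) (D.ρz a) = 0 :=
  D.ρ.counit_derivation _ a

/-- Moving `x` past `A⁺` costs a term in `ρ_z(A)`, which lies in `A⁺`. With its mirror image this
gives normality. -/
theorem mul_mem_augImage_mul_top (u w : D.u) (hw : w ∈ D.augImage * ⊤) :
    u * w ∈ D.augImage * ⊤ := by
  induction u using induction generalizing w with
  | add u v hu hv => rw [add_mul]; exact add_mem (hu w hw) (hv w hw)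
  | mul u v hu hv => rw [mul_assoc]; exact hu _ (hv w hw)
  | incl a =>
    induction hw using Submodule.mul_induction_on' with
    | add v _ w _ hv hw => rw [mul_add]; exact add_mem hv hw
    | mem_mul_mem b hb v hv =>
      obtain ⟨b, hb, rfl⟩ := hb
      have hb' : Coalgebra.counit (R := k) b = 0 := hb
      rw [AlgHom.toLinearMap_apply, ← mul_assoc, ← map_mul]
      exact Submodule.mul_mem_mul (D.incl_mem_augImage (by simp [hb'])) hv
  | x =>
    induction hw using Submodule.mul_induction_on' with
    | add v _ w _ hv hw => rw [mul_add]; exact add_mem hv hw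
    | mem_mul_mem b hb v hv =>
      obtain ⟨b, hb, rfl⟩ := hb
      rw [AlgHom.toLinearMap_apply, ← mul_assoc, x_mul_incl, add_mul, mul_assoc]
      exact add_mem (Submodule.mul_mem_mul (D.incl_mem_augImage hb) trivial)
        (Submodule.mul_mem_mul (D.incl_mem_augImage (D.counit_ρz b)) hv)

theorem mul_mem_top_mul_augImage (u w : D.u) (hw : w ∈ ⊤ * D.augImage) :
    w * u ∈ ⊤ * D.augImage := by
  induction u using induction generalizing w with
  | add u v hu hv => rw [mul_add]; exact add_mem (hu w hw) (hv w hw)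
  | mul u v hu hv => rw [← mul_assoc]; exact hv _ (hu w hw)
  | incl a =>
    induction hw using Submodule.mul_induction_on' with
    | add v _ w _ hv hw => rw [add_mul]; exact add_mem hv hw
    | mem_mul_mem v hv b hb =>
      obtain ⟨b, hb, rfl⟩ := hb
      have hb' : Coalgebra.counit (R := k) b = 0 := hb
      rw [AlgHom.toLinearMap_apply, mul_assoc, ← map_mul]
      exact Submodule.mul_mem_mul hv (D.incl_mem_augImage (by simp [hb']))
  | x =>
    induction hw using Submodule.mul_induction_on' with
    | add v _ w _ hv hw => rw [add_mul]; exact add_mem hv hw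
    | mem_mul_mem v hv b hb =>
      obtain ⟨b, hb, rfl⟩ := hb
      rw [AlgHom.toLinearMap_apply, mul_assoc, eq_sub_of_add_eq (D.x_mul_incl b).symm, mul_sub,
        ← mul_assoc]
      exact sub_mem (Submodule.mul_mem_mul trivial (D.incl_mem_augImage hb))
        (Submodule.mul_mem_mul hv (D.incl_mem_augImage (D.counit_ρz b)))

theorem augImage_mul_top : D.augImage * ⊤ = ⊤ * D.augImage := by
  refine le_antisymm (Submodule.mul_le.mpr fun b hb u _ => ?_)
    (Submodule.mul_le.mpr fun u _ b hb => ?_)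
  · refine D.mul_mem_top_mul_augImage u b ?_
    rw [← one_mul b]
    exact Submodule.mul_mem_mul trivial hb
  · refine D.mul_mem_augImage_mul_top u b ?_
    rw [← mul_one b]
    exact Submodule.mul_mem_mul hb trivial

theorem ker_projAlgHom : LinearMap.ker D.projAlgHom.toLinearMap = D.augImage * ⊤ := by
  refine le_antisymm (fun u hu => ?_) (Submodule.mul_le.mpr ?_)
  · obtain ⟨c, rfl⟩ := D.ofCoeffs_surjective u
    rw [LinearMap.mem_ker, AlgHom.toLinearMap_apply, ofCoeffs_apply, map_sum] at hu
    simp only [map_mul, map_pow, projAlgHom_incl, projAlgHom_x, ← Algebra.smul_def,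
      ← MonogenicHopf.powerBasis_apply] at hu
    -- `π` sends `∑ a_j x^j` to `∑ ε(a_j) z^j`, and the powers of `z` are independent, so every
    -- `a_j` lies in `A⁺`.
    have h1 := Fintype.linearIndependent_iff.mp
      (MonogenicHopf.powerBasis k p lam).linearIndependent _ hu
    rw [ofCoeffs_apply]
    exact sum_mem fun j _ => Submodule.mul_mem_mul (D.incl_mem_augImage (h1 j)) trivial
  · rintro _ ⟨b, hb, rfl⟩ u _
    have h1 : D.projAlgHom (D.incl b) = 0 := D.projAlgHom_incl_eq_zero b hb
    simp [h1]

theorem isExtension : HopfExt.IsExtension D.inclHom D.proj where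
  injective := D.incl_injective
  surjective := D.proj_surjective
  normal := D.augImage_mul_top
  ker_eq := D.ker_projAlgHom
  right_coinvariants := D.coaction_eq_iff
  left_coinvariants u := by
    refine (D.coaction_eq_iff u).trans ?_
    change _ ↔ Algebra.TensorProduct.map D.projAlgHom (.id k D.u) (D.comul u) = 1 ⊗ₜ u
    have h1 : (1 : MonogenicHopf k p lam) ⊗ₜ[k] u =
        Algebra.TensorProduct.comm k D.u (MonogenicHopf k p lam) (u ⊗ₜ 1) := rfl
    rw [map_proj_comul, h1, EmbeddingLike.apply_eq_iff_eq]

theorem isCocentral : HopfExt.IsCocentral D.proj := by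
  intro u
  refine (D.map_proj_comul u).trans ?_
  change TensorProduct.comm k _ _ (D.projAlgHom.toLinearMap.lTensor D.u (D.comul u)) =
    D.projAlgHom.toLinearMap.rTensor D.u (TensorProduct.comm k _ _ (D.comul u))
  generalize D.comul u = t
  induction t with
  | zero => simp
  | add s t hs ht => simp only [map_add, hs, ht]
  | tmul a b => simp

end Extension

end CompatibleDatum

/-! ### The primitive elements of `u(D)` -/

namespace CompatibleDatum

open Polynomial TensorProduct

variable {k : Type*} {p : ℕ} {h : Type*} [Field k] [hp : Fact p.Prime] [CharP k p]
  [LieRing h] [LieAlgebra k h] [IsLieAbelian h] [RestrictedLieAlgebra k p h]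
  {n : ℕ} {lam : Fin n → k} (D : CompatibleDatum k p h lam)

section Primitives

/-- The cocycle `D^m(χ)` is the obstruction to `x^{p^m}` being primitive. -/
theorem comul_x_pow (m : ℕ) : D.comul (D.x ^ p ^ m) =
    (D.x ^ p ^ m) ⊗ₜ 1 + 1 ⊗ₜ (D.x ^ p ^ m) + D.inclSq (D.cocycle m) := by
  have h1 : D.xSq ^ p ^ m = (D.x ^ p ^ m) ⊗ₜ 1 + 1 ⊗ₜ (D.x ^ p ^ m) := by
    induction m with
    | zero => simp [xSq]
    | succ m ih =>
      have hc' : Commute ((D.x ^ p ^ m) ⊗ₜ[k] (1 : D.u)) ((1 : D.u) ⊗ₜ[k] (D.x ^ p ^ m)) := by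
        simp [commute_iff_eq]
      rw [pow_succ, pow_mul, ih, HopfExt.add_pow_of_commute k p hc', pow_mul]
      simp [Algebra.TensorProduct.tmul_pow]
  rw [map_pow, comul_x, ← h1]
  exact Cobar.add_pow_eq_opD D.xSq_mul_inclSq D.χ m

theorem comul_incl_eq (a : RestrictedEnveloping k p h) :
    D.comul (D.incl a) = D.incl a ⊗ₜ 1 + 1 ⊗ₜ D.incl a - D.inclSq (Cobar.d1 k _ a) := by
  rw [comul_incl, Cobar.d1_apply]
  simp

theorem inclSq_injective : Function.Injective D.inclSq :=
  TensorProduct.map_injective_of_flat_flat _ _ D.incl_injective D.incl_injective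

theorem sum_cohomologyClass_eq_zero_iff (c : Fin n → k) :
    ∑ i, c i • D.cohomologyClass i = 0 ↔ ∃ b : RestrictedEnveloping k p h,
      Coalgebra.counit (R := k) b = 0 ∧
        Cobar.d1 k _ b = ∑ i, c i • (D.cocycle i : RestrictedEnveloping k p h ⊗[k] _) := by
  have h1 : ∑ i, c i • D.cohomologyClass i =
      Submodule.Quotient.mk (∑ i, c i • D.cocycle i) := by
    simp only [cohomologyClass, ← Submodule.mkQ_apply, map_sum, map_smul]
  rw [h1, Submodule.Quotient.mk_eq_zero, Submodule.submoduleOf, Submodule.mem_comap]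
  simp only [Submodule.subtype_apply, Submodule.coe_sum, Submodule.coe_smul]
  rfl

/-- A combination of the `x^{p^i}` and of an element of `A` is primitive if and only if the
coboundary of the latter is the combination of the cocycles. -/
theorem sum_add_incl_mem_primitives_iff (c : Fin n → k) (b : RestrictedEnveloping k p h) :
    ∑ i, c i • D.x ^ p ^ (i : ℕ) + D.incl b ∈ HopfExt.primitives k D.u ↔
      Cobar.d1 k _ b = ∑ i, c i • (D.cocycle i : RestrictedEnveloping k p h ⊗[k] _) := by
  rw [HopfExt.mem_primitives, coalgebra_comul_apply, map_add, map_sum, comul_incl_eq]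
  simp only [map_smul, comul_x_pow, smul_add, Finset.sum_add_distrib, add_tmul, tmul_add,
    TensorProduct.sum_tmul, TensorProduct.tmul_sum, ← TensorProduct.smul_tmul',
    TensorProduct.tmul_smul]
  rw [← D.inclSq_injective.eq_iff, map_sum]
  simp only [map_smul]
  rw [← sub_eq_zero, eq_comm, ← sub_eq_zero (a := D.inclSq _), ← neg_eq_zero (a := D.inclSq _ - _)]
  rw [eq_comm]
  refine Eq.congr ?_ rfl
  abel

theorem incl_ι_mem_primitives (v : h) :
    D.incl (RestrictedEnveloping.ι k p h v) ∈ HopfExt.primitives k D.u := by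
  have h2 : Coalgebra.comul (R := k) (RestrictedEnveloping.ι k p h v) =
    RestrictedEnveloping.ι k p h v ⊗ₜ[k] 1 + 1 ⊗ₜ[k] RestrictedEnveloping.ι k p h v :=
    RestrictedEnveloping.comul_ι k p h v
  rw [HopfExt.mem_primitives, coalgebra_comul_apply, comul_incl, h2]
  simp

/-- Every primitive element of `u(D)` is a combination of the `x^{p^i}` and of an element of
`A⁺`. -/
theorem exists_eq_of_mem_primitives {y : D.u} (hy : y ∈ HopfExt.primitives k D.u) :
    ∃ (c : Fin n → k) (b : RestrictedEnveloping k p h), Coalgebra.counit (R := k) b = 0 ∧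
      y = ∑ i, c i • D.x ^ p ^ (i : ℕ) + D.incl b := by
  have hyc : D.comul y = y ⊗ₜ 1 + 1 ⊗ₜ y := hy
  have hπ : D.projAlgHom y ∈ HopfExt.primitives k (MonogenicHopf k p lam) := by
    rw [HopfExt.mem_primitives]
    refine (CoalgHomClass.map_comp_comul_apply D.proj y).symm.trans ?_
    change TensorProduct.map D.projAlgHom.toLinearMap D.projAlgHom.toLinearMap (D.comul y) = _
    rw [hyc]
    simp
  obtain ⟨c, hc⟩ : ∃ c : Fin n → k,
      D.projAlgHom y = ∑ i, c i • MonogenicHopf.z k p lam ^ p ^ (i : ℕ) :=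
    ⟨_, MonogenicHopf.eq_sum_of_mem_primitives k p lam hπ⟩
  have h1 (m : ℕ) : D.coaction (D.x ^ p ^ m) =
      (D.x ^ p ^ m) ⊗ₜ 1 + 1 ⊗ₜ (MonogenicHopf.z k p lam ^ p ^ m) := by
    have h2 : Algebra.TensorProduct.map (.id k D.u) D.projAlgHom (D.inclSq (D.cocycle m)) = 0 := by
      change TensorProduct.map LinearMap.id D.projAlgHom.toLinearMap _ = _
      rw [map_inclSq, Cobar.map_eq_zero_of_augSq (.inr D.projAlgHom_incl_eq_zero)
        (D.cocycle m).2.1]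
    rw [coaction, AlgHom.comp_apply, comul_x_pow, map_add, h2]
    simp [projAlgHom_x]
  have h3 : D.coaction y = y ⊗ₜ 1 + 1 ⊗ₜ D.projAlgHom y := by
    rw [coaction, AlgHom.comp_apply, hyc]
    simp
  -- Both `y` and the `x^{p^i}` coact as primitives do, and `c` was chosen to match their images in
  -- `B`. The difference is therefore coinvariant and lies in `A`.
  obtain ⟨b, hb⟩ := (D.coaction_eq_iff (y - ∑ i, c i • D.x ^ p ^ (i : ℕ))).mpr (by
    rw [map_sub, h3, map_sum, hc]
    simp only [map_smul, h1, smul_add, Finset.sum_add_distrib, sub_tmul, TensorProduct.sum_tmul,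
      TensorProduct.tmul_sum, ← TensorProduct.smul_tmul', TensorProduct.tmul_smul]
    abel)
  have hε (m : ℕ) : D.counit (D.x ^ p ^ m) = 0 := by
    rw [map_pow, counit_x, zero_pow (pow_ne_zero _ hp.out.ne_zero)]
  refine ⟨c, b, ?_, by rw [hb]; abel⟩
  have h4 : D.counit y = 0 := HopfExt.counit_of_mem_primitives hy
  rw [← counit_incl, hb]
  simp [h4, hε]

/-- The exponents `p^i` are distinct, positive and below `p^n`, so in the normal form the `x^{p^i}`
are independent of each other and of `A`. -/
theorem smul_eq_zero_of_sum_mem_range {c : Fin n → k} {a : RestrictedEnveloping k p h}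
    (hc : ∑ i, c i • D.x ^ p ^ (i : ℕ) = D.incl a) (i : Fin n) : c i = 0 := by
  have h1 (m : ℕ) (hm : m < p ^ n) : D.coeffEquiv.symm (D.x ^ m) = Pi.single ⟨m, hm⟩ 1 := by
    have := D.coeffEquiv_symm_apply 1 hm
    rwa [map_one, one_mul] at this
  have h2 : D.coeffEquiv.symm (D.incl a) = Pi.single ⟨0, Nat.pow_pos hp.out.pos⟩ a := by
    have := D.coeffEquiv_symm_apply a (Nat.pow_pos (n := n) hp.out.pos)
    rwa [pow_zero, mul_one] at this
  have h3 := congrFun (congrArg D.coeffEquiv.symm hc) (MonogenicHopf.powIdx p n i)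
  rw [map_sum, h2, Finset.sum_apply, Finset.sum_eq_single i] at h3
  · rw [map_smul, h1 (p ^ (i : ℕ)) (MonogenicHopf.powIdx p n i).2, Pi.smul_apply,
      Pi.single_eq_of_ne (i := (⟨0, Nat.pow_pos hp.out.pos⟩ : Fin (p ^ n))) fun h =>
        (Nat.pow_pos (n := (i : ℕ)) hp.out.pos).ne' (congrArg Fin.val h)] at h3
    have h4 : c i • (1 : RestrictedEnveloping k p h) = 0 := by
      rw [← h3]
      congr 1
      exact (Pi.single_eq_same (M := fun _ => RestrictedEnveloping k p h) _ 1).symm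
    exact (smul_eq_zero.mp h4).resolve_right one_ne_zero
  · intro j _ hj
    rw [map_smul, h1 (p ^ (j : ℕ)) (MonogenicHopf.powIdx p n j).2,
      Pi.smul_apply, Pi.single_eq_of_ne, smul_zero]
    intro h
    exact hj (Fin.ext (Nat.pow_right_injective hp.out.two_le (congrArg Fin.val h)).symm)
  · simp

theorem primitives_eq_of_linearIndependent [FiniteDimensional k h]
    (hli : LinearIndependent k fun i : Fin n => D.cohomologyClass i) :
    (HopfExt.primitives k D.u : Set D.u) =
      Set.range fun a : h => D.incl (RestrictedEnveloping.ι k p h a) := by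
  refine Set.Subset.antisymm (fun y hy => ?_) ?_
  · obtain ⟨c, b, hb, rfl⟩ := D.exists_eq_of_mem_primitives hy
    have hd1 := (D.sum_add_incl_mem_primitives_iff c b).mp hy
    have hc := Fintype.linearIndependent_iff.mp hli c
      ((D.sum_cohomologyClass_eq_zero_iff c).mpr ⟨b, hb, hd1⟩)
    -- With all `c_i = 0` the equation becomes `d¹(b) = 0`, which says that `b` is primitive in `A`.
    simp only [hc, zero_smul, Finset.sum_const_zero, Cobar.d1_apply] at hd1
    have hbP : b ∈ (HopfExt.primitives k (RestrictedEnveloping k p h) :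
      Set (RestrictedEnveloping k p h)) := (sub_eq_zero.mp hd1).symm
    rw [RestrictedEnveloping.primitives_eq_range] at hbP
    obtain ⟨v, rfl⟩ := hbP
    exact ⟨v, by simp [hc]⟩
  · rintro _ ⟨v, rfl⟩
    exact D.incl_ι_mem_primitives v

theorem linearIndependent_of_primitives_eq
    (hP : (HopfExt.primitives k D.u : Set D.u) =
      Set.range fun a : h => D.incl (RestrictedEnveloping.ι k p h a)) :
    LinearIndependent k fun i : Fin n => D.cohomologyClass i := by
  rw [Fintype.linearIndependent_iff]
  intro c hc
  obtain ⟨b, -, hd1⟩ := (D.sum_cohomologyClass_eq_zero_iff c).mp hc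
  -- A relation among the classes produces a primitive element with leading part `∑ c_i x^{p^i}`;
  -- lying in the image of `h`, it has no such part.
  have hy := (D.sum_add_incl_mem_primitives_iff c b).mpr hd1
  rw [← SetLike.mem_coe, hP] at hy
  obtain ⟨v, hv⟩ := hy
  refine D.smul_eq_zero_of_sum_mem_range (a := RestrictedEnveloping.ι k p h v - b) ?_
  rw [map_sub]
  exact eq_sub_of_add_eq hv.symm

/-- The map from `h` to the primitive elements of `u(D)`. -/
def toPrimitives : h →ₗ⁅k⁆ HopfExt.primitives k D.u where
  toFun v := ⟨D.incl (RestrictedEnveloping.ι k p h v), D.incl_ι_mem_primitives v⟩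
  map_add' v w := Subtype.ext (by simp)
  map_smul' c v := Subtype.ext (by simp)
  map_lie' {v w} := Subtype.ext (by
    change D.incl (RestrictedEnveloping.ι k p h ⁅v, w⁆) =
      D.incl (RestrictedEnveloping.ι k p h v) * D.incl (RestrictedEnveloping.ι k p h w) -
        D.incl (RestrictedEnveloping.ι k p h w) * D.incl (RestrictedEnveloping.ι k p h v)
    rw [← map_mul D.incl, ← map_mul D.incl, mul_comm (RestrictedEnveloping.ι k p h w), sub_self,
      trivial_lie_zero, map_zero, map_zero])

theorem toPrimitives_pMap (v : h) : D.toPrimitives (RestrictedLieAlgebra.pMap k p v) =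
    HopfExt.primitivePow p (D.toPrimitives v) := by
  refine Subtype.ext ?_
  change D.incl (RestrictedEnveloping.ι k p h _) = D.incl (RestrictedEnveloping.ι k p h v) ^ p
  rw [RestrictedEnveloping.ι_pMap, map_pow]

theorem toPrimitives_injective [FiniteDimensional k h] : Function.Injective D.toPrimitives :=
  fun _ _ hvw => RestrictedEnveloping.ι_injective k p h (D.incl_injective (congrArg Subtype.val hvw))

theorem primitives_eq_range_iff : (HopfExt.primitives k D.u : Set D.u) =
      Set.range (fun a : h => D.incl (RestrictedEnveloping.ι k p h a)) ↔
    Function.Surjective D.toPrimitives := by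
  constructor
  · rintro hP ⟨y, hy⟩
    have hy' := hy
    rw [← SetLike.mem_coe, hP] at hy'
    obtain ⟨v, rfl⟩ := hy'
    exact ⟨v, rfl⟩
  · intro hs
    refine Set.Subset.antisymm (fun y hy => ?_) ?_
    · obtain ⟨v, hv⟩ := hs ⟨y, hy⟩
      exact ⟨v, congrArg Subtype.val hv⟩
    · rintro _ ⟨v, rfl⟩
      exact D.incl_ι_mem_primitives v

theorem tfae_primitives [FiniteDimensional k h] : List.TFAE [
    LinearIndependent k (fun i : Fin n => D.cohomologyClass i),
    (HopfExt.primitives k D.u : Set D.u) =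
      Set.range (fun a : h => D.incl (RestrictedEnveloping.ι k p h a)),
    ∃ e : HopfExt.primitives k D.u ≃ₗ⁅k⁆ h, ∀ y,
      e (HopfExt.primitivePow p y) = RestrictedLieAlgebra.pMap k p (e y),
    Nonempty (HopfExt.primitives k D.u ≃ₗ[k] h)] := by
  tfae_have 1 → 2 := D.primitives_eq_of_linearIndependent
  tfae_have 2 → 1 := D.linearIndependent_of_primitives_eq
  tfae_have 2 → 3 := fun hP => by
    let e := LieEquiv.ofBijective D.toPrimitives
      ⟨D.toPrimitives_injective, D.primitives_eq_range_iff.mp hP⟩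
    have he (v : h) : e.symm (D.toPrimitives v) = v := e.symm_apply_apply v
    refine ⟨e.symm, fun y => ?_⟩
    obtain ⟨v, rfl⟩ := D.primitives_eq_range_iff.mp hP y
    rw [← D.toPrimitives_pMap, he, he]
  tfae_have 3 → 4 := fun ⟨e, _⟩ => ⟨e.toLinearEquiv⟩
  -- The injection of `h` into the primitives is onto as soon as the dimensions agree, whatever the
  -- given isomorphism.
  tfae_have 4 → 2 := fun ⟨e⟩ => by
    have : FiniteDimensional k (HopfExt.primitives k D.u) := e.symm.finiteDimensional
    rw [primitives_eq_range_iff]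
    exact (LinearMap.injective_iff_surjective_of_finrank_eq_finrank
      (f := (D.toPrimitives : h →ₗ[k] HopfExt.primitives k D.u)) e.finrank_eq.symm).mp
      D.toPrimitives_injective
  tfae_finish

end Primitives

end CompatibleDatum

end

theorem theorem0p1 {k : Type*} [Field k] {p : ℕ} [Fact p.Prime] [CharP k p]
    {h : Type*} [LieRing h] [LieAlgebra k h] [IsLieAbelian h] [RestrictedLieAlgebra k p h]
    [FiniteDimensional k h] {n : ℕ} (hn : 1 ≤ n) (lam : Fin n → k)
    (D : CompatibleDatum k p h lam) :
    ∃ S : HopfStructure k D.u, D.IsPrescribed S ∧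
      letI : HopfAlgebra k D.u := S.toHopfAlgebra
      -- (a)
      (HopfExt.IsConnected k D.u ∧
        Module.finrank k D.u =
          p ^ (Module.finrank k (HopfExt.primitives k (RestrictedEnveloping k p h)) + n)) ∧
      -- (b)
      (∃ (ι : RestrictedEnveloping k p h →ₐc[k] D.u) (π : D.u →ₐc[k] MonogenicHopf k p lam),
        (∀ a, ι a = D.incl a) ∧ π D.x = MonogenicHopf.z k p lam ∧
        HopfExt.IsExtension ι π ∧ HopfExt.IsCocentral π) ∧
      -- (c)
      List.TFAE [
        LinearIndependent k (fun i : Fin n => D.cohomologyClass i),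
        (HopfExt.primitives k D.u : Set D.u) =
          Set.range (fun a : h => D.incl (RestrictedEnveloping.ι k p h a)),
        ∃ e : HopfExt.primitives k D.u ≃ₗ⁅k⁆ h, ∀ y,
          e (HopfExt.primitivePow p y) = RestrictedLieAlgebra.pMap k p (e y),
        Nonempty (HopfExt.primitives k D.u ≃ₗ[k] h)] :=
  ⟨D.hopfStructure, D.isPrescribed, ⟨D.isConnected, D.finrank_u⟩,
    ⟨D.inclHom, D.proj, D.inclHom_apply, D.projAlgHom_x, D.isExtension, D.isCocentral⟩,
    D.tfae_primitives⟩
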